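/- Let $\Bbbk$ be a commutative ring. **Conventions.** A *superspace* is a $\Bbbk$-module with a decomposition $V=V_{\bar 0}\oplus V_{\bar 1}$. A *supercategory* is a $\Bbbk$-linear category whose morphism spaces are superspaces and whose composition is even; a *superfunctor* is a functor that is $\Bbbk$-linear and even on morphism spaces. A *monoidal supercategory* is a supercategory $\mathcal A$ with a superfunctor $-\otimes-:\mathcal A\boxtimes\mathcal A\to\mathcal A$ (that is, even bilinear maps on morphism spaces with $1_\lambda\otimes 1_\mu=1_{\lambda\otimes\mu}$ and $(f\otimes g)\circ(h\otimes k)=(-1)^{|g||h|}(f\circ h)\otimes(g\circ k)$), a unit object $\mathbb 1$, and even natural isomorphisms $a,l,r$ satisfying the pentagon and triangle axioms. A *monoidal superfunctor* is a superfunctor $F$ with an even natural isomorphism $c:F\lambda\otimes F\mu\to F(\lambda\otimes\mu)$ and an even isomorphism $i:\mathbb 1\to F\mathbb 1$ satisfying the usual axioms. A *monoidal natural transformation* $x:F\Rightarrow G$ is a natural transformation with even components such that $x_{\lambda\otimes\mu}\circ c_F=c_G\circ(x_\lambda\otimes x_\mu)$ and $x_{\mathbb 1}\circ i_F=i_G$.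 A *monoidal $\Pi$-supercategory* $(\mathcal A,\pi,\zeta)$ is a monoidal supercategory with an object $\pi$ and an odd isomorphism $\zeta:\pi\to\mathbb 1$. Let $\mathcal{SM}on$ (resp. $\Pi\text{-}\mathcal{SM}on$) be the strict 2-category of monoidal supercategories (resp. monoidal $\Pi$-supercategories), with all monoidal superfunctors as 1-morphisms and all monoidal natural transformations as 2-morphisms; $\nu:\Pi\text{-}\mathcal{SM}on\to\mathcal{SM}on$ forgets $\pi$ and $\zeta$. Write $\mathcal Hom(\mathcal A,\mathcal B)$ for the category of monoidal superfunctors $\mathcal A\to\mathcal B$ and monoidal natural transformations. The *$\Pi$-envelope* $\mathcal A_\pi$ of a monoidal supercategory $\mathcal A$ has objects $\Pi^a\lambda$ ($\lambda\in\operatorname{ob}\mathcal A$, $a\in\mathbb Z/2$), and morphisms $f_a^b:\Pi^a\lambda\to\Pi^b\mu$ for $f:\lambda\to\mu$ in $\mathcal A$, of parity $|f|+a+b$ for homogeneous $f$ and composed as in $\mathcal A$, with $$\Pi^a\lambda\otimes\Pi^b\mu=\Pi^{a+b}(\lambda\otimes\mu),\qquad f_a^b\otimes g_c^d=(-1)^{a|g|+|f|d+ad+ac}(f\otimes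 g)_{a+c}^{b+d},$$ unit $\Pi^{\bar 0}\mathbb 1$, the coherence maps of $\mathcal A$, $\pi=\Pi^{\bar 1}\mathbb 1$ and $\zeta=(1_{\mathbb 1})_{\bar 1}^{\bar 0}$. It extends to a 2-functor (1) $:\mathcal{SM}on\to\Pi\text{-}\mathcal{SM}on$ by $F_\pi(\Pi^a\lambda)=\Pi^aF\lambda$, $F_\pi(f_a^b)=(Ff)_a^b$ (with the coherence maps of $F$) and $(x_\pi)_{\Pi^a\lambda}=(x_\lambda)_a^a$. The functors $J:\mathcal A\to\mathcal A_\pi$, $\lambda\mapsto\Pi^{\bar 0}\lambda$, $f\mapsto f_{\bar 0}^{\bar 0}$, with identity coherence maps, form a 2-natural transformation $\mathrm{id}\Rightarrow\nu\circ(-)_\pi$. A *monoidal $\Pi$-category* $(\mathcal A,\pi,\beta,\xi)$ is a $\Bbbk$-linear monoidal category $\mathcal A$ (with bilinear tensor product) with an object $(\pi,\beta)$ of its Drinfeld center, $\beta_\lambda:\pi\otimes\lambda\to\lambda\otimes\pi$, such that $\beta_\pi=-1_{\pi\otimes\pi}$, and an isomorphism $\xi:\pi\otimes\pi\to\mathbb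 1$ such that for all $\lambda$ $$(1_\lambda\otimes\xi^{-1})\circ r_\lambda^{-1}\circ l_\lambda\circ(\xi\otimes1_\lambda)=a_{\lambda,\pi,\pi}\circ(\beta_\lambda\otimes1_\pi)\circ a_{\pi,\lambda,\pi}^{-1}\circ(1_\pi\otimes\beta_\lambda)\circ a_{\pi,\pi,\lambda}.$$ A *monoidal $\Pi$-functor* is a $\Bbbk$-linear (strong) monoidal functor $(F,c,i)$ with an isomorphism $j:\pi_{\mathcal B}\to F\pi_{\mathcal A}$ such that $F(\beta_{\mathcal A})_\lambda\circ c\circ(j\otimes 1_{F\lambda})=c\circ(1_{F\lambda}\otimes j)\circ(\beta_{\mathcal B})_{F\lambda}$ and $i\circ\xi_{\mathcal B}=F\xi_{\mathcal A}\circ c\circ(j\otimes j)$. These form a category $\Pi\text{-}\mathcal{M}on$. The functor (2) $:\Pi\text{-}\mathcal{SM}on\to\Pi\text{-}\mathcal{M}on$ sends $(\mathcal A,\pi,\zeta)$ to $(\underline{\mathcal A},\pi,\beta,\xi)$, where $\underline{\mathcal A}$ is the underlying category (same objects, even morphisms), $\beta_\lambda=(1_\lambda\otimes\zeta^{-1})\circ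 r_\lambda^{-1}\circ l_\lambda\circ(\zeta\otimes1_\lambda)$ and $\xi=l_{\mathbb 1}\circ(\zeta\otimes\zeta)$, and sends a monoidal superfunctor $F$ to its restriction $\underline F$ to even morphisms with $j=(F\zeta_{\mathcal A})^{-1}\circ i\circ\zeta_{\mathcal B}$. **Theorem.** 1. The $\Pi$-envelope 2-functor (1) is left 2-adjoint to $\nu$: for every monoidal supercategory $\mathcal A$ and every monoidal $\Pi$-supercategory $\mathcal B$ there is an equivalence of categories $\mathcal Hom(\mathcal A,\nu\mathcal B)\to\mathcal Hom(\mathcal A_\pi,\mathcal B)$, $F\mapsto\tilde F$, $x\mapsto\tilde x$, with $\tilde FJ=F$ and $\tilde xJ=x$; its quasi-inverse, restriction along the 2-natural transformation $J$, is also an equivalence. 2. The functor (2) is an equivalence of categories. -/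

import Mathlib

open CategoryTheory

universe w v u v' u' v'' u''

noncomputable section

namespace PiSuper

/-! ### Superspaces and supercategories -/

/-- The sign `(-1)^p`, for a parity `p ∈ ℤ/2`. -/
def sgn (p : ZMod 2) : ℤ := if p = 0 then 1 else -1

theorem sgn_zero : sgn 0 = 1 := by decide

theorem sgn_mul_sgn (p q : ZMod 2) : sgn p * sgn q = sgn (p + q) := by
  revert p q; decide

/-- A supercategory over `k`: a category whose morphism spaces are superspaces
(`k`-modules with a decomposition `Hom = Hom₀ ⊕ Hom₁`) and whose composition is given by even
bilinear maps. Bilinearity is part of `Preadditive` and `Linear`. -/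
class Supercategory (k : Type w) [CommRing k] (C : Type u) [Category.{v} C] [Preadditive C]
    [Linear k C] where
  /-- `parity X Y p` is the space of homogeneous morphisms `X ⟶ Y` of parity `p`. -/
  parity : ∀ X Y : C, ZMod 2 → Submodule k (X ⟶ Y)
  isCompl : ∀ X Y : C, IsCompl (parity X Y 0) (parity X Y 1)
  id_mem : ∀ X : C, 𝟙 X ∈ parity X X 0
  comp_mem : ∀ {X Y Z : C} {p q : ZMod 2} {f : X ⟶ Y} {g : Y ⟶ Z},
    f ∈ parity X Y p → g ∈ parity Y Z q → f ≫ g ∈ parity X Z (p + q)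

section

variable (k : Type w) [CommRing k] {C : Type u} [Category.{v} C] [Preadditive C] [Linear k C]
  [Supercategory k C]

/-- `HasParity k f p` says that the morphism `f` is homogeneous of parity `p`. -/
def HasParity {X Y : C} (f : X ⟶ Y) (p : ZMod 2) : Prop := f ∈ Supercategory.parity (k := k) X Y p

variable {k}

theorem HasParity.id (X : C) : HasParity k (𝟙 X) 0 := Supercategory.id_mem X

theorem HasParity.comp {X Y Z : C} {p q : ZMod 2} {f : X ⟶ Y} {g : Y ⟶ Z}
    (hf : HasParity k f p) (hg : HasParity k g q) : HasParity k (f ≫ g) (p + q) :=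
  Supercategory.comp_mem hf hg

theorem HasParity.of_eq {X Y : C} {p q : ZMod 2} {f : X ⟶ Y} (hf : HasParity k f p)
    (h : p = q) : HasParity k f q := h ▸ hf

theorem HasParity.zsmul {X Y : C} {p : ZMod 2} {f : X ⟶ Y} (hf : HasParity k f p) (n : ℤ) :
    HasParity k (n • f) p := zsmul_mem (S := Submodule k (X ⟶ Y)) hf n

theorem HasParity.comp_even {X Y Z : C} {p : ZMod 2} {f : X ⟶ Y} {g : Y ⟶ Z}
    (hf : HasParity k f p) (hg : HasParity k g 0) : HasParity k (f ≫ g) p :=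
  (hf.comp hg).of_eq (add_zero p)

theorem HasParity.even_comp {X Y Z : C} {p : ZMod 2} {f : X ⟶ Y} {g : Y ⟶ Z}
    (hf : HasParity k f 0) (hg : HasParity k g p) : HasParity k (f ≫ g) p :=
  (hf.comp hg).of_eq (zero_add p)

variable (k) in
theorem exists_decomp {X Y : C} (f : X ⟶ Y) :
    ∃ f₀ f₁ : X ⟶ Y, HasParity k f₀ 0 ∧ HasParity k f₁ 1 ∧ f = f₀ + f₁ := by
  have h : f ∈ Supercategory.parity (k := k) X Y 0 ⊔ Supercategory.parity (k := k) X Y 1 := by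
    rw [(Supercategory.isCompl X Y).sup_eq_top]; trivial
  obtain ⟨a, ha, b, hb, e⟩ := Submodule.mem_sup.1 h
  exact ⟨a, b, ha, hb, e.symm⟩

theorem eq_zero_of_parity {X Y : C} {p : ZMod 2} {f : X ⟶ Y} (h₀ : HasParity k f p)
    (h₁ : HasParity k f (p + 1)) : f = 0 := by
  have := (Supercategory.isCompl (k := k) X Y).disjoint
  fin_cases p
  · exact Submodule.disjoint_def.1 this f h₀ h₁
  · exact Submodule.disjoint_def.1 this f h₁ h₀

variable (k) in
/-- To prove an additive statement for all morphisms, it suffices to treat homogeneous ones. -/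
@[elab_as_elim]
theorem homogeneous_induction {X Y : C} {P : (X ⟶ Y) → Prop} (f : X ⟶ Y)
    (hom : ∀ (p : ZMod 2) (g : X ⟶ Y), HasParity k g p → P g)
    (add : ∀ g h, P g → P h → P (g + h)) : P f := by
  obtain ⟨f₀, f₁, h₀, h₁, rfl⟩ := exists_decomp k f
  exact add _ _ (hom 0 _ h₀) (hom 1 _ h₁)

/-- The inverse of a homogeneous isomorphism is homogeneous of the same parity. -/
theorem HasParity.inv {X Y : C} {p : ZMod 2} {e : X ≅ Y} (h : HasParity k e.hom p) :
    HasParity k e.inv p := by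
  obtain ⟨g, g', hg, hg', hs⟩ : ∃ g g' : Y ⟶ X,
      HasParity k g p ∧ HasParity k g' (p + 1) ∧ e.inv = g + g' := by
    obtain ⟨f₀, f₁, h₀, h₁, e⟩ := exists_decomp k e.inv
    fin_cases p
    · exact ⟨f₀, f₁, h₀, h₁, e⟩
    · exact ⟨f₁, f₀, h₁, h₀, by rw [e, add_comm]⟩
  have key : e.hom ≫ g' = 0 := by
    have e1 : e.hom ≫ g' = 𝟙 X - e.hom ≫ g := by
      rw [← e.hom_inv_id, hs, Preadditive.comp_add]; abel
    refine eq_zero_of_parity (k := k) (p := 0) ?_ ?_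
    · rw [e1]
      exact sub_mem (HasParity.id X) ((h.comp hg).of_eq (CharTwo.add_self_eq_zero p))
    · refine (h.comp hg').of_eq ?_
      rw [← add_assoc, CharTwo.add_self_eq_zero]
  have : g' = 0 := by simpa using congrArg (fun t => e.inv ≫ t) key
  rw [hs, this, add_zero]; exact hg

/-- The parity involution `f₀ + f₁ ↦ f₀ - f₁` of a morphism space, raised to the power `d`. -/
def twist (d : ZMod 2) {X Y : C} : (X ⟶ Y) →ₗ[k] (X ⟶ Y) :=
  Submodule.projection _ _ (Supercategory.isCompl (k := k) X Y) +
    sgn d • Submodule.projection _ _ (Supercategory.isCompl (k := k) X Y).symm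

theorem twist_apply (d : ZMod 2) {X Y : C} {f : X ⟶ Y} {p : ZMod 2} (hf : HasParity k f p) :
    twist (k := k) d f = sgn (d * p) • f := by
  have key : twist (k := k) d f =
      Submodule.projection _ _ (Supercategory.isCompl (k := k) X Y) f +
        sgn d • Submodule.projection _ _ (Supercategory.isCompl (k := k) X Y).symm f := rfl
  rw [key]
  obtain rfl | rfl : p = 0 ∨ p = 1 := (by decide : ∀ p : ZMod 2, p = 0 ∨ p = 1) p
  · rw [Submodule.projection_apply_of_mem_left _ hf,
      (Submodule.projection_apply_eq_zero_iff _).2 hf, mul_zero, sgn_zero, smul_zero, add_zero,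
      one_zsmul]
  · rw [Submodule.projection_apply_of_mem_left _ hf,
      (Submodule.projection_apply_eq_zero_iff _).2 hf, mul_one, zero_add]

end

/-! ### Monoidal supercategories -/

/-- A monoidal supercategory. The tensor product superfunctor `C ⊠ C ⥤ C` is given by its values
on objects and the even bilinear maps `tensorHom` on morphisms; `tensorHom_id` and the super
interchange law `interchange` are functoriality with respect to the composition of `C ⊠ C`. The
coherence isomorphisms are even and natural, and satisfy the pentagon and triangle axioms. -/
class MonoidalSupercategory (k : Type w) [CommRing k] (C : Type u) [Category.{v} C]
    [Preadditive C] [Linear k C] [Supercategory k C] where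
  tensorObj : C → C → C
  tensorHom : ∀ {X₁ Y₁ X₂ Y₂ : C},
    (X₁ ⟶ Y₁) →ₗ[k] (X₂ ⟶ Y₂) →ₗ[k] (tensorObj X₁ X₂ ⟶ tensorObj Y₁ Y₂)
  tensorHom_mem : ∀ {X₁ Y₁ X₂ Y₂ : C} {p q : ZMod 2} {f : X₁ ⟶ Y₁} {g : X₂ ⟶ Y₂},
    HasParity k f p → HasParity k g q → HasParity k (tensorHom f g) (p + q)
  tensorHom_id : ∀ X Y : C, tensorHom (𝟙 X) (𝟙 Y) = 𝟙 (tensorObj X Y)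
  interchange : ∀ {X₁ Y₁ Z₁ X₂ Y₂ Z₂ : C} {p q : ZMod 2} (f₁ : X₁ ⟶ Y₁) (f₂ : X₂ ⟶ Y₂)
    (g₁ : Y₁ ⟶ Z₁) (g₂ : Y₂ ⟶ Z₂), HasParity k f₁ p → HasParity k g₂ q →
      tensorHom f₁ f₂ ≫ tensorHom g₁ g₂ = sgn (q * p) • tensorHom (f₁ ≫ g₁) (f₂ ≫ g₂)
  tensorUnit : C
  associator : ∀ X Y Z : C, tensorObj (tensorObj X Y) Z ≅ tensorObj X (tensorObj Y Z)
  leftUnitor : ∀ X : C, tensorObj tensorUnit X ≅ X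
  rightUnitor : ∀ X : C, tensorObj X tensorUnit ≅ X
  associator_mem : ∀ X Y Z : C, HasParity k (associator X Y Z).hom 0
  leftUnitor_mem : ∀ X : C, HasParity k (leftUnitor X).hom 0
  rightUnitor_mem : ∀ X : C, HasParity k (rightUnitor X).hom 0
  associator_naturality : ∀ {X₁ Y₁ X₂ Y₂ X₃ Y₃ : C} (f₁ : X₁ ⟶ Y₁) (f₂ : X₂ ⟶ Y₂)
    (f₃ : X₃ ⟶ Y₃), tensorHom (tensorHom f₁ f₂) f₃ ≫ (associator Y₁ Y₂ Y₃).hom =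
      (associator X₁ X₂ X₃).hom ≫ tensorHom f₁ (tensorHom f₂ f₃)
  leftUnitor_naturality : ∀ {X Y : C} (f : X ⟶ Y),
    tensorHom (𝟙 tensorUnit) f ≫ (leftUnitor Y).hom = (leftUnitor X).hom ≫ f
  rightUnitor_naturality : ∀ {X Y : C} (f : X ⟶ Y),
    tensorHom f (𝟙 tensorUnit) ≫ (rightUnitor Y).hom = (rightUnitor X).hom ≫ f
  pentagon : ∀ W X Y Z : C,
    tensorHom (associator W X Y).hom (𝟙 Z) ≫ (associator W (tensorObj X Y) Z).hom ≫
        tensorHom (𝟙 W) (associator X Y Z).hom =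
      (associator (tensorObj W X) Y Z).hom ≫ (associator W X (tensorObj Y Z)).hom
  triangle : ∀ X Y : C,
    (associator X tensorUnit Y).hom ≫ tensorHom (𝟙 X) (leftUnitor Y).hom =
      tensorHom (rightUnitor X).hom (𝟙 Y)

open MonoidalSupercategory

section

variable (k : Type w) [CommRing k] {C : Type u} [Category.{v} C] [Preadditive C] [Linear k C]
  [Supercategory k C] [MonoidalSupercategory k C]

/-- Tensor product of objects of a monoidal supercategory. -/
abbrev tObj (X Y : C) : C := tensorObj k X Y

/-- Tensor product of morphisms of a monoidal supercategory. -/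
abbrev tHom {X₁ Y₁ X₂ Y₂ : C} (f : X₁ ⟶ Y₁) (g : X₂ ⟶ Y₂) : tObj k X₁ X₂ ⟶ tObj k Y₁ Y₂ :=
  tensorHom (k := k) f g

variable {k}

theorem tHom_id (X Y : C) : tHom k (𝟙 X) (𝟙 Y) = 𝟙 (tObj k X Y) := tensorHom_id X Y

theorem add_tHom {X₁ Y₁ X₂ Y₂ : C} (f f' : X₁ ⟶ Y₁) (g : X₂ ⟶ Y₂) :
    tHom k (f + f') g = tHom k f g + tHom k f' g := LinearMap.map_add₂ _ f f' g

theorem tHom_add {X₁ Y₁ X₂ Y₂ : C} (f : X₁ ⟶ Y₁) (g g' : X₂ ⟶ Y₂) :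
    tHom k f (g + g') = tHom k f g + tHom k f g' := map_add _ g g'

theorem zsmul_tHom {X₁ Y₁ X₂ Y₂ : C} (n : ℤ) (f : X₁ ⟶ Y₁) (g : X₂ ⟶ Y₂) :
    tHom k (n • f) g = n • tHom k f g := by
  simp only [tHom, map_zsmul, LinearMap.smul_apply]

theorem tHom_zsmul {X₁ Y₁ X₂ Y₂ : C} (n : ℤ) (f : X₁ ⟶ Y₁) (g : X₂ ⟶ Y₂) :
    tHom k f (n • g) = n • tHom k f g := map_zsmul _ n g

theorem tHom_comp_left_even {X₁ Y₁ Z₁ X₂ Y₂ Z₂ : C} {f₁ : X₁ ⟶ Y₁} (f₂ : X₂ ⟶ Y₂)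
    (g₁ : Y₁ ⟶ Z₁) (g₂ : Y₂ ⟶ Z₂) (h : HasParity k f₁ 0) :
    tHom k f₁ f₂ ≫ tHom k g₁ g₂ = tHom k (f₁ ≫ g₁) (f₂ ≫ g₂) := by
  refine homogeneous_induction k g₂ (fun q g hg => ?_) (fun g g' hg hg' => ?_)
  · rw [interchange f₁ f₂ g₁ g h hg, mul_zero, sgn_zero, one_zsmul]
  · simp only [tHom_add, Preadditive.comp_add, hg, hg']

theorem tHom_comp_right_even {X₁ Y₁ Z₁ X₂ Y₂ Z₂ : C} (f₁ : X₁ ⟶ Y₁) (f₂ : X₂ ⟶ Y₂)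
    (g₁ : Y₁ ⟶ Z₁) {g₂ : Y₂ ⟶ Z₂} (h : HasParity k g₂ 0) :
    tHom k f₁ f₂ ≫ tHom k g₁ g₂ = tHom k (f₁ ≫ g₁) (f₂ ≫ g₂) := by
  refine homogeneous_induction k f₁ (fun q g hg => ?_) (fun g g' hg hg' => ?_)
  · rw [interchange g f₂ g₁ g₂ hg h, zero_mul, sgn_zero, one_zsmul]
  · simp only [add_tHom, Preadditive.add_comp, hg, hg']

end

/-! ### The underlying monoidal category -/

/-- The underlying category of a supercategory: the same objects, but only the even morphisms. -/
structure Underlying (k : Type w) (C : Type u) where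
  /-- the object of the supercategory -/
  of : C

namespace Underlying

variable (k : Type w) [CommRing k] (C : Type u) [Category.{v} C] [Preadditive C] [Linear k C]
  [Supercategory k C]

instance : Category (Underlying k C) where
  Hom X Y := Supercategory.parity (k := k) X.of Y.of 0
  id X := ⟨𝟙 X.of, HasParity.id X.of⟩
  comp f g := ⟨f.1 ≫ g.1, HasParity.comp_even f.2 g.2⟩
  id_comp f := Subtype.ext (Category.id_comp f.1)
  comp_id f := Subtype.ext (Category.comp_id f.1)
  assoc f g h := Subtype.ext (Category.assoc f.1 g.1 h.1)

variable {k C}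

theorem hom_ext {X Y : Underlying k C} {f g : X ⟶ Y} (h : f.1 = g.1) : f = g := Subtype.ext h

@[simp] theorem id_val (X : Underlying k C) : (𝟙 X : X ⟶ X).1 = 𝟙 X.of := rfl

@[simp] theorem comp_val {X Y Z : Underlying k C} (f : X ⟶ Y) (g : Y ⟶ Z) :
    (f ≫ g).1 = f.1 ≫ g.1 := rfl

/-- An even morphism, as a morphism of the underlying category. -/
def mkHom {X Y : C} (f : X ⟶ Y) (h : HasParity k f 0) :
    (⟨X⟩ : Underlying k C) ⟶ (⟨Y⟩ : Underlying k C) := ⟨f, h⟩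

/-- An even isomorphism, as an isomorphism of the underlying category. -/
def mkIso {X Y : C} (e : X ≅ Y) (h : HasParity k e.hom 0) :
    (⟨X⟩ : Underlying k C) ≅ (⟨Y⟩ : Underlying k C) where
  hom := mkHom e.hom h
  inv := mkHom e.inv h.inv
  hom_inv_id := hom_ext e.hom_inv_id
  inv_hom_id := hom_ext e.inv_hom_id

variable (k C)

instance : Preadditive (Underlying k C) where
  homGroup X Y := inferInstanceAs (AddCommGroup (Supercategory.parity (k := k) X.of Y.of 0))
  add_comp _ _ _ f f' g := hom_ext (Preadditive.add_comp _ _ _ f.1 f'.1 g.1)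
  comp_add _ _ _ f g g' := hom_ext (Preadditive.comp_add _ _ _ f.1 g.1 g'.1)

instance : Linear k (Underlying k C) where
  homModule X Y := inferInstanceAs (Module k (Supercategory.parity (k := k) X.of Y.of 0))
  smul_comp _ _ _ r f g := hom_ext (Linear.smul_comp _ _ _ r f.1 g.1)
  comp_smul _ _ _ f r g := hom_ext (Linear.comp_smul _ _ _ f.1 r g.1)

variable {k C}

@[simp] theorem add_val {X Y : Underlying k C} (f g : X ⟶ Y) : (f + g).1 = f.1 + g.1 := rfl

@[simp] theorem neg_val {X Y : Underlying k C} (f : X ⟶ Y) : (-f).1 = -f.1 := rfl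

@[simp] theorem zero_val {X Y : Underlying k C} : (0 : X ⟶ Y).1 = 0 := rfl

@[simp] theorem smul_val {X Y : Underlying k C} (r : k) (f : X ⟶ Y) : (r • f).1 = r • f.1 := rfl

variable [MonoidalSupercategory k C]

variable (k C) in
instance : MonoidalCategoryStruct (Underlying k C) where
  tensorObj X Y := ⟨tObj k X.of Y.of⟩
  tensorUnit := ⟨tensorUnit k⟩
  tensorHom f g := mkHom (tHom k f.1 g.1) (tensorHom_mem f.2 g.2)
  whiskerLeft X _ _ f := mkHom (tHom k (𝟙 X.of) f.1) (tensorHom_mem (HasParity.id X.of) f.2)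
  whiskerRight f X := mkHom (tHom k f.1 (𝟙 X.of)) (tensorHom_mem f.2 (HasParity.id X.of))
  associator X Y Z := mkIso (associator X.of Y.of Z.of) (associator_mem X.of Y.of Z.of)
  leftUnitor X := mkIso (leftUnitor X.of) (leftUnitor_mem X.of)
  rightUnitor X := mkIso (rightUnitor X.of) (rightUnitor_mem X.of)

variable (k C) in
instance : MonoidalCategory (Underlying k C) :=
  MonoidalCategory.ofTensorHom
    (id_tensorHom_id := fun X Y => hom_ext (tensorHom_id X.of Y.of))
    (id_tensorHom := fun _ _ _ _ => rfl)
    (tensorHom_id := fun _ _ => rfl)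
    (tensorHom_comp_tensorHom := fun f₁ f₂ g₁ g₂ =>
      hom_ext (tHom_comp_left_even f₂.1 g₁.1 g₂.1 f₁.2))
    (associator_naturality := fun f g h => hom_ext (associator_naturality f.1 g.1 h.1))
    (leftUnitor_naturality := fun f => hom_ext (leftUnitor_naturality f.1))
    (rightUnitor_naturality := fun f => hom_ext (rightUnitor_naturality f.1))
    (pentagon := fun W X Y Z => hom_ext (pentagon W.of X.of Y.of Z.of))
    (triangle := fun X Y => hom_ext (triangle X.of Y.of))

open MonoidalCategory

@[simp] theorem tensorHom_val {X₁ Y₁ X₂ Y₂ : Underlying k C} (f : X₁ ⟶ Y₁) (g : X₂ ⟶ Y₂) :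
    (f ⊗ₘ g).1 = tHom k f.1 g.1 := rfl

@[simp] theorem whiskerLeft_val (X : Underlying k C) {Y Z : Underlying k C} (f : Y ⟶ Z) :
    (X ◁ f).1 = tHom k (𝟙 X.of) f.1 := rfl

@[simp] theorem whiskerRight_val {Y Z : Underlying k C} (f : Y ⟶ Z) (X : Underlying k C) :
    (f ▷ X).1 = tHom k f.1 (𝟙 X.of) := rfl

variable (k C) in
instance : MonoidalPreadditive (Underlying k C) where
  whiskerLeft_zero := hom_ext (map_zero (tensorHom (k := k) _))
  zero_whiskerRight := hom_ext (LinearMap.map_zero₂ (tensorHom (k := k)) _)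
  whiskerLeft_add f g := hom_ext (map_add (tensorHom (k := k) _) f.1 g.1)
  add_whiskerRight f g := hom_ext (LinearMap.map_add₂ (tensorHom (k := k)) f.1 g.1 _)

variable (k C) in
instance : MonoidalLinear k (Underlying k C) where
  whiskerLeft_smul _ _ _ r f := hom_ext (map_smul (tensorHom (k := k) _) r f.1)
  smul_whiskerRight r _ _ f _ := hom_ext (LinearMap.map_smul₂ (tensorHom (k := k)) r f.1 _)

end Underlying

/-! ### The `Π`-envelope -/

/-- The objects `Π^a X` of the `Π`-envelope of `C`. -/
structure PiEnv (C : Type u) where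
  /-- the object `X` -/
  base : C
  /-- the exponent `a` -/
  deg : ZMod 2

namespace PiEnv

section

variable (k : Type w) [CommRing k] (C : Type u) [Category.{v} C]

/-- The morphisms `f_a^b : Π^a X ⟶ Π^b Y` are the morphisms `f : X ⟶ Y`; only their parity
changes. -/
instance : Category (PiEnv C) where
  Hom X Y := X.base ⟶ Y.base
  id X := 𝟙 X.base
  comp f g := CategoryStruct.comp (obj := C) f g
  id_comp f := Category.id_comp (obj := C) f
  comp_id f := Category.comp_id (obj := C) f
  assoc f g h := Category.assoc (obj := C) f g h

variable {C} in
/-- The morphism `f_a^b : Π^a X ⟶ Π^b Y` given by `f : X ⟶ Y`. -/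
def homMk {X Y : C} (f : X ⟶ Y) (a b : ZMod 2) : (⟨X, a⟩ : PiEnv C) ⟶ ⟨Y, b⟩ := f

variable {C} in
/-- The morphism of `C` underlying a morphism of the `Π`-envelope. -/
def homOf {X Y : PiEnv C} (f : X ⟶ Y) : X.base ⟶ Y.base := f

variable {C} in
/-- An isomorphism of `C`, as an isomorphism `Π^a X ≅ Π^b Y`. -/
def isoMk {X Y : C} (e : X ≅ Y) (a b : ZMod 2) : (⟨X, a⟩ : PiEnv C) ≅ ⟨Y, b⟩ where
  hom := homMk e.hom a b
  inv := homMk e.inv b a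
  hom_inv_id := e.hom_inv_id
  inv_hom_id := e.inv_hom_id

variable [Preadditive C] [Linear k C]

instance : Preadditive (PiEnv C) where
  homGroup X Y := inferInstanceAs (AddCommGroup (X.base ⟶ Y.base))
  add_comp X Y Z f f' g := Preadditive.add_comp X.base Y.base Z.base f f' g
  comp_add X Y Z f g g' := Preadditive.comp_add X.base Y.base Z.base f g g'

instance : Linear k (PiEnv C) where
  homModule X Y := inferInstanceAs (Module k (X.base ⟶ Y.base))
  smul_comp X Y Z r f g := Linear.smul_comp X.base Y.base Z.base r f g
  comp_smul X Y Z f r g := Linear.comp_smul X.base Y.base Z.base f r g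

variable [Supercategory k C]

/-- `f_a^b` has parity `|f| + a + b`. -/
instance : Supercategory k (PiEnv C) where
  parity X Y p := Supercategory.parity (k := k) X.base Y.base (p + X.deg + Y.deg)
  isCompl X Y := by
    have h := Supercategory.isCompl (k := k) X.base Y.base
    rw [zero_add, show (1 : ZMod 2) + X.deg + Y.deg = X.deg + Y.deg + 1 by ring]
    generalize X.deg + Y.deg = s
    obtain rfl | rfl : s = 0 ∨ s = 1 := (by decide : ∀ p : ZMod 2, p = 0 ∨ p = 1) s
    · exact h
    · exact h.symm
  id_mem X := (HasParity.id (k := k) X.base).of_eq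
    ((by decide : ∀ a : ZMod 2, 0 = 0 + a + a) X.deg)
  comp_mem {X Y Z p q} _ _ hf hg := (HasParity.comp (k := k) (C := C) hf hg).of_eq
    ((by decide : ∀ p q a b c : ZMod 2, p + a + b + (q + b + c) = p + q + a + c)
      p q X.deg Y.deg Z.deg)

variable {k C}

theorem hasParity_iff {X Y : PiEnv C} (f : X ⟶ Y) (p : ZMod 2) :
    HasParity k f p ↔ HasParity k (homOf f) (p + X.deg + Y.deg) := Iff.rfl

theorem hasParity_homOf {X Y : PiEnv C} {f : X ⟶ Y} {p : ZMod 2} (h : HasParity k f p) :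
    HasParity k (homOf f) (p + X.deg + Y.deg) := h

theorem homMk_even {X Y : C} {f : X ⟶ Y} (h : HasParity k f 0) {a b : ZMod 2} (e : a = b) :
    HasParity k (homMk f a b) 0 :=
  HasParity.of_eq (k := k) (C := C) h (by subst e; exact (by decide : ∀ a : ZMod 2, 0 = 0 + a + a) a)

end

section

variable {k : Type w} [CommRing k] {C : Type u} [Category.{v} C]
  [Preadditive C] [Linear k C] [Supercategory k C] [MonoidalSupercategory k C]

variable (k) in
/-- Tensor product of morphisms in the `Π`-envelope: for homogeneous `f` and `g`,
`f_a^b ⊗ g_c^d = (-1)^(a|g| + |f|d + ad + ac) (f ⊗ g)_{a+c}^{b+d}`. -/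
def tensorHom {X₁ Y₁ X₂ Y₂ : PiEnv C} : (X₁ ⟶ Y₁) →ₗ[k] (X₂ ⟶ Y₂) →ₗ[k]
    ((⟨tObj k X₁.base X₂.base, X₁.deg + X₂.deg⟩ : PiEnv C) ⟶
      ⟨tObj k Y₁.base Y₂.base, Y₁.deg + Y₂.deg⟩) :=
  sgn (X₁.deg * Y₂.deg + X₁.deg * X₂.deg) •
    (MonoidalSupercategory.tensorHom (k := k) (X₁ := X₁.base) (Y₁ := Y₁.base) (X₂ := X₂.base)
      (Y₂ := Y₂.base)).compl₁₂ (twist (k := k) (C := C) Y₂.deg) (twist (k := k) (C := C) X₁.deg)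

theorem tensorHom_apply {X₁ Y₁ X₂ Y₂ : PiEnv C} (f : X₁ ⟶ Y₁) (g : X₂ ⟶ Y₂) {p q : ZMod 2}
    (hf : HasParity k (homOf f) p) (hg : HasParity k (homOf g) q) :
    tensorHom k f g =
      homMk (sgn (X₁.deg * q + p * Y₂.deg + X₁.deg * Y₂.deg + X₁.deg * X₂.deg) •
        tHom k (homOf f) (homOf g)) _ _ := by
  have e : tensorHom k f g = homMk (sgn (X₁.deg * Y₂.deg + X₁.deg * X₂.deg) •
      tHom k (twist (k := k) Y₂.deg (homOf f)) (twist (k := k) X₁.deg (homOf g))) _ _ := rfl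
  rw [e, twist_apply _ hf, twist_apply _ hg, zsmul_tHom, tHom_zsmul, smul_smul, smul_smul,
    sgn_mul_sgn, sgn_mul_sgn]
  congr 3
  ring

theorem tensorHom_mem {X₁ Y₁ X₂ Y₂ : PiEnv C} {f : X₁ ⟶ Y₁} {g : X₂ ⟶ Y₂} {p q : ZMod 2}
    (hf : HasParity k f p) (hg : HasParity k g q) : HasParity k (tensorHom k f g) (p + q) := by
  rw [tensorHom_apply f g (hasParity_homOf hf) (hasParity_homOf hg)]
  refine HasParity.of_eq (C := C) ((MonoidalSupercategory.tensorHom_mem (hasParity_homOf hf)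
    (hasParity_homOf hg)).zsmul _) ?_
  dsimp only
  ring

theorem tensorHom_id (X Y : PiEnv C) : tensorHom k (𝟙 X) (𝟙 Y) = 𝟙 _ := by
  rw [tensorHom_apply (𝟙 X) (𝟙 Y) (p := 0) (q := 0) (HasParity.id (k := k) X.base)
    (HasParity.id (k := k) Y.base)]
  have e : sgn (X.deg * 0 + 0 * Y.deg + X.deg * Y.deg + X.deg * Y.deg) = 1 :=
    (by decide : ∀ a b : ZMod 2, sgn (a * 0 + 0 * b + a * b + a * b) = 1) X.deg Y.deg
  rw [e, one_zsmul]
  exact MonoidalSupercategory.tensorHom_id X.base Y.base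

theorem interchange {X₁ Y₁ Z₁ X₂ Y₂ Z₂ : PiEnv C} {p q : ZMod 2} (f₁ : X₁ ⟶ Y₁) (f₂ : X₂ ⟶ Y₂)
    (g₁ : Y₁ ⟶ Z₁) (g₂ : Y₂ ⟶ Z₂) (hf₁ : HasParity k f₁ p) (hg₂ : HasParity k g₂ q) :
    tensorHom k f₁ f₂ ≫ tensorHom k g₁ g₂ =
      sgn (q * p) • tensorHom k (f₁ ≫ g₁) (f₂ ≫ g₂) := by
  refine homogeneous_induction k f₂ (fun r f₂ hf₂ => ?_) (fun a b ha hb => ?_)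
  swap
  · simp only [map_add, Preadditive.add_comp, ha, hb, smul_add]
  refine homogeneous_induction k g₁ (fun s g₁ hg₁ => ?_) (fun a b ha hb => ?_)
  swap
  · simp only [map_add, LinearMap.add_apply, Preadditive.comp_add, ha, hb, smul_add]
  replace hf₁ := hasParity_homOf hf₁
  replace hf₂ := hasParity_homOf hf₂
  replace hg₁ := hasParity_homOf hg₁
  replace hg₂ := hasParity_homOf hg₂
  rw [tensorHom_apply f₁ f₂ hf₁ hf₂, tensorHom_apply g₁ g₂ hg₁ hg₂,
    tensorHom_apply (f₁ ≫ g₁) (f₂ ≫ g₂) (HasParity.comp (C := C) hf₁ hg₁)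
      (HasParity.comp (C := C) hf₂ hg₂)]
  have e := MonoidalSupercategory.interchange (homOf f₁) (homOf f₂) (homOf g₁) (homOf g₂) hf₁ hg₂
  obtain ⟨X₁, a⟩ := X₁
  obtain ⟨Y₁, b⟩ := Y₁
  obtain ⟨Z₁, c⟩ := Z₁
  obtain ⟨X₂, a'⟩ := X₂
  obtain ⟨Y₂, b'⟩ := Y₂
  obtain ⟨Z₂, c'⟩ := Z₂
  dsimp only at e ⊢
  change (_ • tHom k (homOf f₁) (homOf f₂)) ≫ (_ • tHom k (homOf g₁) (homOf g₂)) =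
    sgn (q * p) • (_ • tHom k (homOf f₁ ≫ homOf g₁) (homOf f₂ ≫ homOf g₂))
  rw [Preadditive.zsmul_comp, Preadditive.comp_zsmul]
  refine (congrArg (fun t => _ • _ • t) e).trans ?_
  simp only [smul_smul, sgn_mul_sgn]
  congr 2
  grind

theorem tensorHom_even {X₁ Y₁ X₂ Y₂ : PiEnv C} (f : X₁ ⟶ Y₁) (g : X₂ ⟶ Y₂)
    (hf : HasParity k (homOf f) 0) (hg : HasParity k (homOf g) 0) (h : X₂.deg = Y₂.deg) :
    tensorHom k f g = homMk (tHom k (homOf f) (homOf g)) _ _ := by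
  rw [tensorHom_apply f g hf hg]
  have e : sgn (X₁.deg * 0 + 0 * Y₂.deg + X₁.deg * Y₂.deg + X₁.deg * X₂.deg) = 1 := by
    rw [h]
    exact (by decide : ∀ a b : ZMod 2, sgn (a * 0 + 0 * b + a * b + a * b) = 1) X₁.deg Y₂.deg
  rw [e, one_zsmul]

theorem associator_naturality {X₁ Y₁ X₂ Y₂ X₃ Y₃ : PiEnv C} (f₁ : X₁ ⟶ Y₁) (f₂ : X₂ ⟶ Y₂)
    (f₃ : X₃ ⟶ Y₃) :
    tensorHom k (tensorHom k f₁ f₂) f₃ ≫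
        (homMk (associator (k := k) Y₁.base Y₂.base Y₃.base).hom _ _ :
          _ ⟶ (⟨_, Y₁.deg + (Y₂.deg + Y₃.deg)⟩ : PiEnv C)) =
      (homMk (associator (k := k) X₁.base X₂.base X₃.base).hom _ _ :
          _ ⟶ (⟨_, X₁.deg + (X₂.deg + X₃.deg)⟩ : PiEnv C)) ≫
        tensorHom k f₁ (tensorHom k f₂ f₃) := by
  refine homogeneous_induction k f₁ (fun p f₁ h₁ => ?_) (fun a b ha hb => ?_)
  swap
  · simp only [map_add, LinearMap.add_apply, Preadditive.add_comp, Preadditive.comp_add, ha, hb]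
  refine homogeneous_induction k f₂ (fun q f₂ h₂ => ?_) (fun a b ha hb => ?_)
  swap
  · simp only [map_add, LinearMap.add_apply, Preadditive.add_comp, Preadditive.comp_add, ha, hb]
  refine homogeneous_induction k f₃ (fun r f₃ h₃ => ?_) (fun a b ha hb => ?_)
  swap
  · simp only [map_add, Preadditive.add_comp, Preadditive.comp_add, ha, hb]
  rw [tensorHom_apply (tensorHom k f₁ f₂) f₃ (hasParity_homOf (tensorHom_mem h₁ h₂))
      (hasParity_homOf h₃), tensorHom_apply f₁ (tensorHom k f₂ f₃) (hasParity_homOf h₁)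
      (hasParity_homOf (tensorHom_mem h₂ h₃)),
    tensorHom_apply f₁ f₂ (hasParity_homOf h₁) (hasParity_homOf h₂),
    tensorHom_apply f₂ f₃ (hasParity_homOf h₂) (hasParity_homOf h₃)]
  have e := MonoidalSupercategory.associator_naturality (k := k) (homOf f₁) (homOf f₂) (homOf f₃)
  obtain ⟨X₁, a⟩ := X₁
  obtain ⟨Y₁, b⟩ := Y₁
  obtain ⟨X₂, a'⟩ := X₂
  obtain ⟨Y₂, b'⟩ := Y₂
  obtain ⟨X₃, a''⟩ := X₃
  obtain ⟨Y₃, b''⟩ := Y₃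
  dsimp only at e ⊢
  change (_ • tHom k (_ • tHom k (homOf f₁) (homOf f₂)) (homOf f₃)) ≫ (associator Y₁ Y₂ Y₃).hom =
    (associator X₁ X₂ X₃).hom ≫ (_ • tHom k (homOf f₁) (_ • tHom k (homOf f₂) (homOf f₃)))
  rw [zsmul_tHom, tHom_zsmul, smul_smul, smul_smul, Preadditive.zsmul_comp,
    Preadditive.comp_zsmul]
  refine (congrArg (fun t => _ • t) e).trans ?_
  simp only [sgn_mul_sgn]
  congr 2
  grind

theorem leftUnitor_naturality {X Y : PiEnv C} (f : X ⟶ Y) :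
    tensorHom k (𝟙 (⟨tensorUnit k, 0⟩ : PiEnv C)) f ≫
        (homMk (leftUnitor (k := k) Y.base).hom _ _ : _ ⟶ Y) =
      (homMk (leftUnitor (k := k) X.base).hom _ _ : _ ⟶ X) ≫ f := by
  refine homogeneous_induction k f (fun p f h => ?_) (fun a b ha hb => ?_)
  swap
  · simp only [map_add, Preadditive.add_comp, Preadditive.comp_add, ha, hb]
  rw [tensorHom_apply _ f (HasParity.id (k := k) (tensorUnit k : C)) (hasParity_homOf h)]
  have e := MonoidalSupercategory.leftUnitor_naturality (k := k) (homOf f)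
  dsimp only
  rw [show sgn (0 * (p + X.deg + Y.deg) + 0 * Y.deg + 0 * Y.deg + 0 * X.deg) = 1 by
    simp [sgn_zero], one_zsmul]
  exact e

theorem rightUnitor_naturality {X Y : PiEnv C} (f : X ⟶ Y) :
    tensorHom k f (𝟙 (⟨tensorUnit k, 0⟩ : PiEnv C)) ≫
        (homMk (rightUnitor (k := k) Y.base).hom _ _ : _ ⟶ Y) =
      (homMk (rightUnitor (k := k) X.base).hom _ _ : _ ⟶ X) ≫ f := by
  refine homogeneous_induction k f (fun p f h => ?_) (fun a b ha hb => ?_)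
  swap
  · simp only [map_add, LinearMap.add_apply, Preadditive.add_comp, Preadditive.comp_add, ha, hb]
  rw [tensorHom_apply f (𝟙 (⟨tensorUnit k, 0⟩ : PiEnv C)) (hasParity_homOf h) (HasParity.id (k := k) (tensorUnit k : C))]
  have e := MonoidalSupercategory.rightUnitor_naturality (k := k) (homOf f)
  dsimp only
  rw [show sgn (X.deg * 0 + (p + X.deg + Y.deg) * 0 + X.deg * 0 + X.deg * 0) = 1 by
    simp [sgn_zero], one_zsmul]
  exact e

end

/-- The monoidal structure of the `Π`-envelope: `Π^a X ⊗ Π^b Y = Π^(a+b) (X ⊗ Y)`, with unit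
`Π^0 𝟙` and the coherence maps of `C`. -/
instance (k : Type w) [CommRing k] (C : Type u) [Category.{v} C] [Preadditive C] [Linear k C]
    [Supercategory k C] [MonoidalSupercategory k C] : MonoidalSupercategory k (PiEnv C) where
  tensorObj X Y := ⟨tObj k X.base Y.base, X.deg + Y.deg⟩
  tensorHom := tensorHom k
  tensorHom_mem := tensorHom_mem
  tensorHom_id := tensorHom_id
  interchange := interchange
  tensorUnit := ⟨tensorUnit k, 0⟩
  associator X Y Z := isoMk (associator X.base Y.base Z.base) _ _
  leftUnitor X := isoMk (leftUnitor X.base) _ _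
  rightUnitor X := isoMk (rightUnitor X.base) _ _
  associator_mem X Y Z := homMk_even (associator_mem X.base Y.base Z.base) (add_assoc _ _ _)
  leftUnitor_mem X := homMk_even (leftUnitor_mem X.base) (zero_add _)
  rightUnitor_mem X := homMk_even (rightUnitor_mem X.base) (add_zero _)
  associator_naturality := associator_naturality
  leftUnitor_naturality := leftUnitor_naturality
  rightUnitor_naturality := rightUnitor_naturality
  pentagon W X Y Z := by
    rw [tensorHom_even (k := k) (X₂ := Z) (Y₂ := Z) _ (𝟙 Z) (associator_mem W.base X.base Y.base)
        (HasParity.id Z.base) rfl,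
      tensorHom_even (k := k) (X₁ := W) (Y₁ := W) (𝟙 W) _ (HasParity.id W.base)
        (associator_mem X.base Y.base Z.base) (add_assoc _ _ _)]
    exact MonoidalSupercategory.pentagon (k := k) W.base X.base Y.base Z.base
  triangle X Y := by
    rw [tensorHom_even (k := k) (X₂ := Y) (Y₂ := Y) _ (𝟙 Y) (rightUnitor_mem X.base)
        (HasParity.id Y.base) rfl,
      tensorHom_even (k := k) (X₁ := X) (Y₁ := X) (𝟙 X) _ (HasParity.id X.base)
        (leftUnitor_mem Y.base) (zero_add _)]
    exact MonoidalSupercategory.triangle (k := k) X.base Y.base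

end PiEnv

/-! ### Monoidal superfunctors and monoidal natural transformations -/

section

variable (k : Type w) [CommRing k]
  (C : Type u) [Category.{v} C] [Preadditive C] [Linear k C] [Supercategory k C]
  [MonoidalSupercategory k C]
  (D : Type u') [Category.{v'} D] [Preadditive D] [Linear k D] [Supercategory k D]
  [MonoidalSupercategory k D]
  (E : Type u'') [Category.{v''} E] [Preadditive E] [Linear k E] [Supercategory k E]
  [MonoidalSupercategory k E]

/-- A (strong) monoidal superfunctor: a functor which is even and linear on morphism spaces, with
even coherence isomorphisms `c : F X ⊗ F Y ≅ F (X ⊗ Y)`, natural in `X` and `Y`, and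
`i : 𝟙 ≅ F 𝟙`, subject to the usual axioms. -/
structure MonoidalSuperfunctor extends C ⥤ D where
  map_add : ∀ {X Y : C} (f g : X ⟶ Y), map (f + g) = map f + map g
  map_smul : ∀ {X Y : C} (r : k) (f : X ⟶ Y), map (r • f) = r • map f
  map_mem : ∀ {X Y : C} {f : X ⟶ Y} {p : ZMod 2}, HasParity k f p → HasParity k (map f) p
  c : ∀ X Y : C, tObj k (obj X) (obj Y) ≅ obj (tObj k X Y)
  i : (tensorUnit k : D) ≅ obj (tensorUnit k)
  c_mem : ∀ X Y : C, HasParity k (c X Y).hom 0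
  i_mem : HasParity k i.hom 0
  c_naturality : ∀ {X₁ Y₁ X₂ Y₂ : C} (f : X₁ ⟶ Y₁) (g : X₂ ⟶ Y₂),
    tHom k (map f) (map g) ≫ (c Y₁ Y₂).hom = (c X₁ X₂).hom ≫ map (tHom k f g)
  associativity : ∀ X Y Z : C,
    tHom k (c X Y).hom (𝟙 (obj Z)) ≫ (c (tObj k X Y) Z).hom ≫ map (associator (k := k) X Y Z).hom =
      (associator (k := k) (obj X) (obj Y) (obj Z)).hom ≫ tHom k (𝟙 (obj X)) (c Y Z).hom ≫
        (c X (tObj k Y Z)).hom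
  left_unitality : ∀ X : C, (leftUnitor (k := k) (obj X)).hom =
    tHom k i.hom (𝟙 (obj X)) ≫ (c (tensorUnit k) X).hom ≫ map (leftUnitor (k := k) X).hom
  right_unitality : ∀ X : C, (rightUnitor (k := k) (obj X)).hom =
    tHom k (𝟙 (obj X)) i.hom ≫ (c X (tensorUnit k)).hom ≫ map (rightUnitor (k := k) X).hom

variable {k C D E}

namespace MonoidalSuperfunctor

theorem ext' {F G : MonoidalSuperfunctor k C D} (h : F.toFunctor = G.toFunctor)
    (hc : ∀ X Y, HEq (F.c X Y).hom (G.c X Y).hom) (hi : HEq F.i.hom G.i.hom) : F = G := by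
  obtain ⟨F, _, _, _, c, i, _, _, _, _, _, _⟩ := F
  obtain ⟨G, _, _, _, c', i', _, _, _, _, _, _⟩ := G
  obtain rfl : F = G := h
  obtain rfl : c = c' := by
    funext X Y; exact Iso.ext (eq_of_heq (hc X Y))
  obtain rfl : i = i' := Iso.ext (eq_of_heq hi)
  rfl

variable (k C) in
/-- The identity monoidal superfunctor. -/
def id : MonoidalSuperfunctor k C C where
  toFunctor := 𝟭 C
  map_add _ _ := rfl
  map_smul _ _ := rfl
  map_mem h := h
  c _ _ := Iso.refl _
  i := Iso.refl _
  c_mem _ _ := HasParity.id _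
  i_mem := HasParity.id _
  c_naturality f g := (Category.comp_id _).trans (Category.id_comp _).symm
  associativity X Y Z := by
    dsimp only [Functor.id_obj, Functor.id_map, Iso.refl_hom]
    rw [tHom_id, tHom_id]; simp
  left_unitality X := by
    dsimp only [Functor.id_obj, Functor.id_map, Iso.refl_hom]
    rw [tHom_id]; simp
  right_unitality X := by
    dsimp only [Functor.id_obj, Functor.id_map, Iso.refl_hom]
    rw [tHom_id]; simp

/-- The composite of two monoidal superfunctors. -/
def comp (F : MonoidalSuperfunctor k C D) (G : MonoidalSuperfunctor k D E) :
    MonoidalSuperfunctor k C E where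
  toFunctor := F.toFunctor ⋙ G.toFunctor
  map_add f g := (congrArg G.map (F.map_add f g)).trans (G.map_add _ _)
  map_smul r f := (congrArg G.map (F.map_smul r f)).trans (G.map_smul _ _)
  map_mem h := G.map_mem (F.map_mem h)
  c X Y := G.c (F.obj X) (F.obj Y) ≪≫ G.mapIso (F.c X Y)
  i := G.i ≪≫ G.mapIso F.i
  c_mem X Y := (G.c_mem _ _).comp_even (G.map_mem (F.c_mem X Y))
  i_mem := G.i_mem.comp_even (G.map_mem F.i_mem)
  c_naturality f g := by
    dsimp
    rw [← Category.assoc, G.c_naturality, Category.assoc, Category.assoc, ← G.map_comp,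
      ← G.map_comp, F.c_naturality]
  associativity X Y Z := by
    have h1 := G.c_naturality (F.c X Y).hom (𝟙 (F.obj Z))
    have h2 := G.c_naturality (𝟙 (F.obj X)) (F.c Y Z).hom
    rw [G.map_id] at h1 h2
    have e1 : tHom k ((G.c (F.obj X) (F.obj Y)).hom ≫ G.map (F.c X Y).hom) (𝟙 (G.obj (F.obj Z))) =
        tHom k (G.c (F.obj X) (F.obj Y)).hom (𝟙 (G.obj (F.obj Z))) ≫
          tHom k (G.map (F.c X Y).hom) (𝟙 (G.obj (F.obj Z))) := by
      rw [tHom_comp_left_even _ _ _ (G.c_mem _ _), Category.id_comp]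
    have e2 : tHom k (𝟙 (G.obj (F.obj X))) ((G.c (F.obj Y) (F.obj Z)).hom ≫ G.map (F.c Y Z).hom) =
        tHom k (𝟙 (G.obj (F.obj X))) (G.c (F.obj Y) (F.obj Z)).hom ≫
          tHom k (𝟙 (G.obj (F.obj X))) (G.map (F.c Y Z).hom) := by
      rw [tHom_comp_left_even _ _ _ (HasParity.id _), Category.id_comp]
    dsimp
    rw [e1, e2]
    simp only [Category.assoc]
    rw [reassoc_of% h1, reassoc_of% h2]
    rw [← G.map_comp, ← G.map_comp, ← G.map_comp, ← reassoc_of% (G.associativity _ _ _),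
      ← G.map_comp, F.associativity]
  left_unitality X := by
    have h1 := G.c_naturality F.i.hom (𝟙 (F.obj X))
    rw [G.map_id] at h1
    have e1 : tHom k (G.i.hom ≫ G.map F.i.hom) (𝟙 (G.obj (F.obj X))) =
        tHom k G.i.hom (𝟙 (G.obj (F.obj X))) ≫ tHom k (G.map F.i.hom) (𝟙 (G.obj (F.obj X))) := by
      rw [tHom_comp_left_even _ _ _ G.i_mem, Category.id_comp]
    dsimp
    rw [e1]
    simp only [Category.assoc]
    rw [reassoc_of% h1, ← G.map_comp, ← G.map_comp, ← F.left_unitality, ← G.left_unitality]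
  right_unitality X := by
    have h1 := G.c_naturality (𝟙 (F.obj X)) F.i.hom
    rw [G.map_id] at h1
    have e1 : tHom k (𝟙 (G.obj (F.obj X))) (G.i.hom ≫ G.map F.i.hom) =
        tHom k (𝟙 (G.obj (F.obj X))) G.i.hom ≫ tHom k (𝟙 (G.obj (F.obj X))) (G.map F.i.hom) := by
      rw [tHom_comp_left_even _ _ _ (HasParity.id _), Category.id_comp]
    dsimp
    rw [e1]
    simp only [Category.assoc]
    rw [reassoc_of% h1, ← G.map_comp, ← G.map_comp, ← F.right_unitality, ← G.right_unitality]

theorem map_zsmul (F : MonoidalSuperfunctor k C D) {X Y : C} (n : ℤ) (f : X ⟶ Y) :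
    F.map (n • f) = n • F.map f := by
  simpa using _root_.map_zsmul (AddMonoidHom.mk' (fun f : X ⟶ Y => F.map f) F.map_add) n f

end MonoidalSuperfunctor

/-- A monoidal natural transformation: an even supernatural transformation (that is, a natural
transformation with even components) compatible with the coherence maps. -/
structure MonoidalNatTrans (F G : MonoidalSuperfunctor k C D) extends
    NatTrans F.toFunctor G.toFunctor where
  app_mem : ∀ X : C, HasParity k (app X) 0
  app_tensor : ∀ X Y : C, (F.c X Y).hom ≫ app (tObj k X Y) =
    tHom k (app X) (app Y) ≫ (G.c X Y).hom
  app_unit : F.i.hom ≫ app (tensorUnit k) = G.i.hom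

namespace MonoidalNatTrans

theorem ext' {F G : MonoidalSuperfunctor k C D} {x y : MonoidalNatTrans F G}
    (h : ∀ X, x.app X = y.app X) : x = y := by
  obtain ⟨⟨x, _⟩, _, _, _⟩ := x
  obtain ⟨⟨y, _⟩, _, _, _⟩ := y
  obtain rfl : x = y := funext h
  rfl

/-- The identity transformation. -/
def id (F : MonoidalSuperfunctor k C D) : MonoidalNatTrans F F where
  toNatTrans := NatTrans.id F.toFunctor
  app_mem X := HasParity.id _
  app_tensor X Y := by
    rw [NatTrans.id_app', NatTrans.id_app', NatTrans.id_app']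
    rw [tHom_id]
    simp
  app_unit := Category.comp_id _

/-- Vertical composition. -/
def vcomp {F G H : MonoidalSuperfunctor k C D} (x : MonoidalNatTrans F G)
    (y : MonoidalNatTrans G H) : MonoidalNatTrans F H where
  toNatTrans := NatTrans.vcomp x.toNatTrans y.toNatTrans
  app_mem X := (x.app_mem X).comp_even (y.app_mem X)
  app_tensor X Y := by
    rw [NatTrans.vcomp_app, NatTrans.vcomp_app, NatTrans.vcomp_app]
    rw [← tHom_comp_left_even _ _ _ (x.app_mem X), Category.assoc, ← y.app_tensor,
      ← reassoc_of% (x.app_tensor X Y)]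
  app_unit := by
    rw [NatTrans.vcomp_app, reassoc_of% x.app_unit, y.app_unit]

end MonoidalNatTrans

instance : Category (MonoidalSuperfunctor k C D) where
  Hom := MonoidalNatTrans
  id := MonoidalNatTrans.id
  comp := MonoidalNatTrans.vcomp
  id_comp _ := MonoidalNatTrans.ext' fun _ => Category.id_comp _
  comp_id _ := MonoidalNatTrans.ext' fun _ => Category.comp_id _
  assoc _ _ _ := MonoidalNatTrans.ext' fun _ => Category.assoc _ _ _

namespace MonoidalSuperfunctor

theorem hom_ext {F G : MonoidalSuperfunctor k C D} {x y : F ⟶ G}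
    (h : ∀ X, x.app X = y.app X) : x = y := MonoidalNatTrans.ext' h

@[simp] theorem id_app (F : MonoidalSuperfunctor k C D) (X : C) :
    (MonoidalNatTrans.toNatTrans (𝟙 F)).app X = 𝟙 (F.obj X) := rfl

@[simp] theorem comp_app {F G H : MonoidalSuperfunctor k C D} (x : F ⟶ G) (y : G ⟶ H) (X : C) :
    (MonoidalNatTrans.toNatTrans (x ≫ y)).app X = x.app X ≫ y.app X := rfl

/-- The whiskering `x ↦ x F`, with components `x_{F X}`. -/
def whiskerLeft (F : MonoidalSuperfunctor k C D) {G H : MonoidalSuperfunctor k D E} (x : G ⟶ H) :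
    F.comp G ⟶ F.comp H where
  app X := x.app (F.obj X)
  naturality _ _ f := x.naturality (F.map f)
  app_mem X := x.app_mem (F.obj X)
  app_tensor X Y := by
    change ((G.c _ _).hom ≫ G.map (F.c X Y).hom) ≫ _ = _ ≫ (H.c _ _).hom ≫ H.map (F.c X Y).hom
    rw [Category.assoc, x.naturality, reassoc_of% (x.app_tensor (F.obj X) (F.obj Y))]
    rfl
  app_unit := by
    change (G.i.hom ≫ G.map F.i.hom) ≫ _ = H.i.hom ≫ H.map F.i.hom
    rw [Category.assoc, x.naturality, reassoc_of% x.app_unit]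

/-- The whiskering `x ↦ G x`, with components `G (x_X)`. -/
def whiskerRight {F F' : MonoidalSuperfunctor k C D} (x : F ⟶ F') (G : MonoidalSuperfunctor k D E) :
    F.comp G ⟶ F'.comp G where
  app X := G.map (x.app X)
  naturality _ _ f := by
    change G.map (F.map f) ≫ G.map _ = G.map _ ≫ G.map (F'.map f)
    rw [← G.map_comp, ← G.map_comp, x.naturality]
  app_mem X := G.map_mem (x.app_mem X)
  app_tensor X Y := by
    change ((G.c _ _).hom ≫ G.map (F.c X Y).hom) ≫ _ = _ ≫ (G.c _ _).hom ≫ G.map (F'.c X Y).hom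
    rw [Category.assoc, ← G.map_comp, x.app_tensor, G.map_comp]
    exact ((reassoc_of% (G.c_naturality (x.app X) (x.app Y))) (G.map (F'.c X Y).hom)).symm
  app_unit := by
    change (G.i.hom ≫ G.map F.i.hom) ≫ _ = G.i.hom ≫ G.map F'.i.hom
    rw [Category.assoc, ← G.map_comp, x.app_unit]

theorem id_comp' (F : MonoidalSuperfunctor k C D) : (id k C).comp F = F := by
  refine ext' rfl (fun X Y => heq_of_eq ?_) (heq_of_eq ?_)
  · change (F.c X Y).hom ≫ F.map (𝟙 _) = _
    rw [F.map_id]; exact Category.comp_id _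
  · change F.i.hom ≫ F.map (𝟙 _) = _
    rw [F.map_id]; exact Category.comp_id _

theorem comp_id' (F : MonoidalSuperfunctor k C D) : F.comp (id k D) = F := by
  refine ext' rfl (fun X Y => heq_of_eq ?_) (heq_of_eq ?_)
  · exact Category.id_comp (F.c X Y).hom
  · exact Category.id_comp F.i.hom

end MonoidalSuperfunctor

end


/-! ### The 2-categories of monoidal supercategories and of monoidal `Π`-supercategories -/

/-- A (bundled) monoidal supercategory over `k`. -/
structure SMon (k : Type w) [CommRing k] where
  carrier : Type u
  [category : Category.{v} carrier]
  [preadditive : Preadditive carrier]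
  [linear : Linear k carrier]
  [supercategory : Supercategory k carrier]
  [monoidal : MonoidalSupercategory k carrier]

attribute [instance] SMon.category SMon.preadditive SMon.linear SMon.supercategory SMon.monoidal

/-- A (bundled) monoidal `Π`-supercategory: a monoidal supercategory with a distinguished object
`π` and an odd isomorphism `ζ : π ≅ 𝟙`. -/
structure PiSMon (k : Type w) [CommRing k] extends SMon.{w, v, u} k where
  pi : carrier
  zeta : pi ≅ (tensorUnit k : carrier)
  zeta_mem : HasParity k zeta.hom 1

namespace SMon

variable (k : Type w) [CommRing k]

theorem eqToHom_app {A B : SMon.{w, v, u} k} {F G : MonoidalSuperfunctor k A.carrier B.carrier}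
    (h : F = G) (X : A.carrier) :
    (MonoidalNatTrans.toNatTrans (eqToHom h)).app X = eqToHom (by rw [h]) := by
  subst h; rfl

theorem comp_assoc {A B C D : SMon.{w, v, u} k} (F : MonoidalSuperfunctor k A.carrier B.carrier)
    (G : MonoidalSuperfunctor k B.carrier C.carrier)
    (H : MonoidalSuperfunctor k C.carrier D.carrier) :
    (F.comp G).comp H = F.comp (G.comp H) := by
  refine MonoidalSuperfunctor.ext' rfl (fun X Y => heq_of_eq ?_) (heq_of_eq ?_)
  · change (H.c _ _).hom ≫ H.map ((G.c _ _).hom ≫ G.map (F.c X Y).hom) =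
      ((H.c _ _).hom ≫ H.map (G.c _ _).hom) ≫ H.map (G.map (F.c X Y).hom)
    rw [H.map_comp, Category.assoc]
  · change H.i.hom ≫ H.map (G.i.hom ≫ G.map F.i.hom) =
      (H.i.hom ≫ H.map G.i.hom) ≫ H.map (G.map F.i.hom)
    rw [H.map_comp, Category.assoc]

/-- The strict 2-category of monoidal supercategories, monoidal superfunctors and monoidal natural
transformations. -/
instance : Bicategory (SMon.{w, v, u} k) where
  Hom A B := MonoidalSuperfunctor k A.carrier B.carrier
  id A := MonoidalSuperfunctor.id k A.carrier
  comp F G := MonoidalSuperfunctor.comp F G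
  homCategory A B := inferInstanceAs (Category (MonoidalSuperfunctor k A.carrier B.carrier))
  whiskerLeft F _ _ x := MonoidalSuperfunctor.whiskerLeft F x
  whiskerRight x G := MonoidalSuperfunctor.whiskerRight x G
  associator F G H := eqToIso (comp_assoc k F G H)
  leftUnitor F := eqToIso (MonoidalSuperfunctor.id_comp' F)
  rightUnitor F := eqToIso (MonoidalSuperfunctor.comp_id' F)
  whiskerLeft_id F G := rfl
  whiskerLeft_comp F _ _ _ x y := rfl
  id_whiskerLeft {A B F G} x := MonoidalSuperfunctor.hom_ext fun X => by
    simp only [MonoidalSuperfunctor.comp_app, eqToIso.hom, eqToIso.inv, eqToHom_app]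
    exact ((Category.id_comp _).trans (Category.comp_id _)).symm
  comp_whiskerLeft F G H H' x := MonoidalSuperfunctor.hom_ext fun X => by
    simp only [MonoidalSuperfunctor.comp_app, eqToIso.hom, eqToIso.inv, eqToHom_app]
    exact ((Category.id_comp _).trans (Category.comp_id _)).symm
  id_whiskerRight F G := MonoidalSuperfunctor.hom_ext fun X => G.map_id _
  comp_whiskerRight x y G := MonoidalSuperfunctor.hom_ext fun X => G.map_comp _ _
  whiskerRight_id x := MonoidalSuperfunctor.hom_ext fun X => by
    simp only [MonoidalSuperfunctor.comp_app, eqToIso.hom, eqToIso.inv, eqToHom_app]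
    exact ((Category.id_comp _).trans (Category.comp_id _)).symm
  whiskerRight_comp x G H := MonoidalSuperfunctor.hom_ext fun X => by
    simp only [MonoidalSuperfunctor.comp_app, eqToIso.hom, eqToIso.inv, eqToHom_app]
    exact ((Category.id_comp _).trans (Category.comp_id _)).symm
  whisker_assoc F G G' x H := MonoidalSuperfunctor.hom_ext fun X => by
    simp only [MonoidalSuperfunctor.comp_app, eqToIso.hom, eqToIso.inv, eqToHom_app]
    exact ((Category.id_comp _).trans (Category.comp_id _)).symm
  whisker_exchange {A B C F G H I} x y := MonoidalSuperfunctor.hom_ext fun X =>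
    (y.naturality (x.app X)).symm
  pentagon F G H I := MonoidalSuperfunctor.hom_ext fun X => by
    simp only [MonoidalSuperfunctor.comp_app, eqToIso.hom, eqToHom_app,
      MonoidalSuperfunctor.whiskerLeft, MonoidalSuperfunctor.whiskerRight]
    simp only [eqToHom_map]
    exact (Category.id_comp _).trans rfl
  triangle F G := MonoidalSuperfunctor.hom_ext fun X => by
    simp only [MonoidalSuperfunctor.comp_app, eqToIso.hom, eqToHom_app,
      MonoidalSuperfunctor.whiskerLeft, MonoidalSuperfunctor.whiskerRight]
    simp only [eqToHom_map]
    exact Category.id_comp _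

instance : Bicategory.Strict (SMon.{w, v, u} k) where
  id_comp F := MonoidalSuperfunctor.id_comp' F
  comp_id F := MonoidalSuperfunctor.comp_id' F
  assoc F G H := comp_assoc k F G H
  leftUnitor_eqToIso _ := rfl
  rightUnitor_eqToIso _ := rfl
  associator_eqToIso _ _ _ := rfl

section

open Bicategory

variable {k} {A B C D : SMon.{w, v, u} k} (F : A ⟶ B) (G : B ⟶ C) (H : C ⟶ D)

theorem leftUnitor_hom_app (X : A.carrier) :
    (MonoidalNatTrans.toNatTrans (λ_ F).hom).app X = 𝟙 (F.obj X) :=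
  eqToHom_app k (MonoidalSuperfunctor.id_comp' F) X

theorem leftUnitor_inv_app (X : A.carrier) :
    (MonoidalNatTrans.toNatTrans (λ_ F).inv).app X = 𝟙 (F.obj X) :=
  eqToHom_app k (MonoidalSuperfunctor.id_comp' F).symm X

theorem rightUnitor_hom_app (X : A.carrier) :
    (MonoidalNatTrans.toNatTrans (ρ_ F).hom).app X = 𝟙 (F.obj X) :=
  eqToHom_app k (MonoidalSuperfunctor.comp_id' F) X

theorem rightUnitor_inv_app (X : A.carrier) :
    (MonoidalNatTrans.toNatTrans (ρ_ F).inv).app X = 𝟙 (F.obj X) :=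
  eqToHom_app k (MonoidalSuperfunctor.comp_id' F).symm X

theorem associator_hom_app (X : A.carrier) :
    (MonoidalNatTrans.toNatTrans (α_ F G H).hom).app X = 𝟙 (H.obj (G.obj (F.obj X))) :=
  eqToHom_app k (comp_assoc k F G H) X

theorem associator_inv_app (X : A.carrier) :
    (MonoidalNatTrans.toNatTrans (α_ F G H).inv).app X = 𝟙 (H.obj (G.obj (F.obj X))) :=
  eqToHom_app k (comp_assoc k F G H).symm X

end

end SMon

section

open Bicategory

namespace PiSMon

variable (k : Type w) [CommRing k]

/-- The strict 2-category of monoidal `Π`-supercategories: its 1- and 2-morphisms are those of the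
underlying monoidal supercategories. -/
instance : Bicategory (PiSMon.{w, v, u} k) where
  Hom A B := A.toSMon ⟶ B.toSMon
  id A := 𝟙 A.toSMon
  comp F G := CategoryStruct.comp (obj := SMon k) F G
  homCategory A B := inferInstanceAs (Category (A.toSMon ⟶ B.toSMon))
  whiskerLeft F _ _ x := Bicategory.whiskerLeft (B := SMon k) F x
  whiskerRight x G := Bicategory.whiskerRight (B := SMon k) x G
  associator F G H := Bicategory.associator (B := SMon k) F G H
  leftUnitor F := Bicategory.leftUnitor (B := SMon k) F
  rightUnitor F := Bicategory.rightUnitor (B := SMon k) F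
  whiskerLeft_id F G := Bicategory.whiskerLeft_id (B := SMon k) F G
  whiskerLeft_comp F _ _ _ x y := Bicategory.whiskerLeft_comp (B := SMon k) F x y
  id_whiskerLeft x := Bicategory.id_whiskerLeft (B := SMon k) x
  comp_whiskerLeft F G _ _ x := Bicategory.comp_whiskerLeft (B := SMon k) F G x
  id_whiskerRight F G := Bicategory.id_whiskerRight (B := SMon k) F G
  comp_whiskerRight x y G := Bicategory.comp_whiskerRight (B := SMon k) x y G
  whiskerRight_id x := Bicategory.whiskerRight_id (B := SMon k) x
  whiskerRight_comp x G H := Bicategory.whiskerRight_comp (B := SMon k) x G H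
  whisker_assoc F _ _ x H := Bicategory.whisker_assoc (B := SMon k) F x H
  whisker_exchange x y := Bicategory.whisker_exchange (B := SMon k) x y
  pentagon F G H I := Bicategory.pentagon (B := SMon k) F G H I
  triangle F G := Bicategory.triangle (B := SMon k) F G

instance : Bicategory.Strict (PiSMon.{w, v, u} k) where
  id_comp F := Bicategory.Strict.id_comp (B := SMon k) F
  comp_id F := Bicategory.Strict.comp_id (B := SMon k) F
  assoc F G H := Bicategory.Strict.assoc (B := SMon k) F G H
  leftUnitor_eqToIso _ := rfl
  rightUnitor_eqToIso _ := rfl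
  associator_eqToIso _ _ _ := rfl

end PiSMon

/-! ### The forgetful functor `ν` and the `Π`-envelope -/

section

variable (k : Type w) [CommRing k]

/-- The 2-functor `ν` which forgets `π` and `ζ`. -/
def forgetPi : StrictPseudofunctor (PiSMon.{w, v, u} k) (SMon.{w, v, u} k) :=
  StrictPseudofunctor.mk''
    { obj := fun A => A.toSMon
      map := fun F => F
      map₂ := fun x => x
      map₂_id := fun _ => rfl
      map₂_comp := fun _ _ => rfl
      map_id := fun _ => rfl
      map_comp := fun _ _ => rfl
      map₂_whisker_left := fun _ _ _ _ => ((Category.id_comp _).trans (Category.comp_id _)).symm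
      map₂_whisker_right := fun _ _ => ((Category.id_comp _).trans (Category.comp_id _)).symm }

end

namespace PiEnv

section

variable {k : Type w} [CommRing k]
  {C : Type u} [Category.{v} C] [Preadditive C] [Linear k C] [Supercategory k C]
  [MonoidalSupercategory k C]
  {D : Type u'} [Category.{v'} D] [Preadditive D] [Linear k D] [Supercategory k D]
  [MonoidalSupercategory k D]
  {E : Type u''} [Category.{v''} E] [Preadditive E] [Linear k E] [Supercategory k E]
  [MonoidalSupercategory k E]

theorem mapFunctor_map_add (F : MonoidalSuperfunctor k C D) {X Y : PiEnv C} (f g : X ⟶ Y) :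
    homMk (F.map (homOf (f + g))) X.deg Y.deg =
      homMk (F.map (homOf f)) X.deg Y.deg + homMk (F.map (homOf g)) X.deg Y.deg :=
  F.map_add (homOf f) (homOf g)

/-- The monoidal superfunctor `F_π` between `Π`-envelopes: `Π^a X ↦ Π^a (F X)` and
`f_a^b ↦ (F f)_a^b`, with the coherence maps of `F`. -/
def mapFunctor (F : MonoidalSuperfunctor k C D) : MonoidalSuperfunctor k (PiEnv C) (PiEnv D) where
  obj X := ⟨F.obj X.base, X.deg⟩
  map {X Y} f := homMk (F.map (homOf f)) X.deg Y.deg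
  map_id X := F.map_id X.base
  map_comp f g := F.map_comp (homOf f) (homOf g)
  map_add f g := F.map_add (homOf f) (homOf g)
  map_smul r f := F.map_smul r (homOf f)
  map_mem h := F.map_mem (hasParity_homOf h)
  c X Y := isoMk (F.c X.base Y.base) _ _
  i := isoMk F.i _ _
  c_mem X Y := homMk_even (F.c_mem X.base Y.base) rfl
  i_mem := homMk_even F.i_mem rfl
  c_naturality {X₁ Y₁ X₂ Y₂} f g := by
    refine homogeneous_induction k f (fun p f hf => ?_) (fun a b ha hb => ?_)
    swap
    · rw [add_tHom, mapFunctor_map_add, mapFunctor_map_add, add_tHom, Preadditive.add_comp,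
        Preadditive.comp_add, ha, hb]
    refine homogeneous_induction k g (fun q g hg => ?_) (fun a b ha hb => ?_)
    swap
    · rw [tHom_add, mapFunctor_map_add, mapFunctor_map_add, tHom_add, Preadditive.add_comp,
        Preadditive.comp_add, ha, hb]
    replace hf := hasParity_homOf hf
    replace hg := hasParity_homOf hg
    have e1 := tensorHom_apply (k := k) f g hf hg
    have e2 := tensorHom_apply (k := k) (homMk (F.map (homOf f)) X₁.deg Y₁.deg)
      (homMk (F.map (homOf g)) X₂.deg Y₂.deg) (F.map_mem hf) (F.map_mem hg)
    refine (congrArg (fun t => t ≫ (isoMk (F.c Y₁.base Y₂.base) _ _).hom) e2).trans ?_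
    refine Eq.trans ?_ (congrArg (fun t => (isoMk (F.c X₁.base X₂.base) _ _).hom ≫
      homMk (F.map (homOf t)) _ _) e1).symm
    change (_ • tHom k (F.map (homOf f)) (F.map (homOf g))) ≫ (F.c Y₁.base Y₂.base).hom =
      (F.c X₁.base X₂.base).hom ≫ F.map (_ • tHom k (homOf f) (homOf g))
    rw [Preadditive.zsmul_comp, F.map_zsmul, Preadditive.comp_zsmul, F.c_naturality]
  associativity X Y Z := by
    have e1 := tensorHom_even (k := k) (homMk (F.c X.base Y.base).hom (X.deg + Y.deg) (X.deg + Y.deg))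
      (𝟙 (⟨F.obj Z.base, Z.deg⟩ : PiEnv D)) (F.c_mem X.base Y.base) (HasParity.id (F.obj Z.base)) rfl
    have e2 := tensorHom_even (k := k) (𝟙 (⟨F.obj X.base, X.deg⟩ : PiEnv D))
      (homMk (F.c Y.base Z.base).hom (Y.deg + Z.deg) (Y.deg + Z.deg))
      (HasParity.id (F.obj X.base)) (F.c_mem Y.base Z.base) rfl
    refine (congrArg (fun t => t ≫ _) e1).trans ?_
    refine Eq.trans ?_ (congrArg (fun t => _ ≫ t ≫ _) e2).symm
    exact F.associativity X.base Y.base Z.base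
  left_unitality X := by
    have e1 := tensorHom_even (k := k) (homMk F.i.hom 0 0)
      (𝟙 (⟨F.obj X.base, X.deg⟩ : PiEnv D)) F.i_mem (HasParity.id (F.obj X.base)) rfl
    refine Eq.trans ?_ (congrArg (fun t => t ≫ _) e1).symm
    exact F.left_unitality X.base
  right_unitality X := by
    have e1 := tensorHom_even (k := k) (𝟙 (⟨F.obj X.base, X.deg⟩ : PiEnv D)) (homMk F.i.hom 0 0)
      (HasParity.id (F.obj X.base)) F.i_mem rfl
    refine Eq.trans ?_ (congrArg (fun t => t ≫ _) e1).symm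
    exact F.right_unitality X.base

/-- The monoidal natural transformation `x_π` with `(x_π)_{Π^a X} = (x_X)_a^a`. -/
def mapNatTrans {F G : MonoidalSuperfunctor k C D} (x : F ⟶ G) : mapFunctor F ⟶ mapFunctor G where
  app X := homMk (x.app X.base) X.deg X.deg
  naturality X Y f := x.naturality (homOf f)
  app_mem X := homMk_even (x.app_mem X.base) rfl
  app_tensor X Y := by
    have e := tensorHom_even (k := k) (homMk (x.app X.base) X.deg X.deg)
      (homMk (x.app Y.base) Y.deg Y.deg) (x.app_mem X.base) (x.app_mem Y.base) rfl
    refine Eq.trans ?_ (congrArg (fun t => t ≫ _) e).symm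
    exact x.app_tensor X.base Y.base
  app_unit := x.app_unit

theorem homMk_add {X Y : C} (f g : X ⟶ Y) (a b : ZMod 2) :
    homMk (f + g) a b = homMk f a b + homMk g a b := rfl

variable (k C) in
/-- The canonical monoidal superfunctor `J : C ⥤ C_π`, `X ↦ Π^0 X`, `f ↦ f_0^0`, whose coherence
maps are identities. -/
def incl : MonoidalSuperfunctor k C (PiEnv C) where
  obj X := ⟨X, 0⟩
  map f := homMk f 0 0
  map_id _ := rfl
  map_comp _ _ := rfl
  map_add _ _ := rfl
  map_smul _ _ := rfl
  map_mem {_ _ _ p} h := HasParity.of_eq (C := C) h (by simp)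
  c X Y := isoMk (Iso.refl _) _ _
  i := isoMk (Iso.refl _) _ _
  c_mem X Y := homMk_even (HasParity.id _) (zero_add _)
  i_mem := homMk_even (HasParity.id _) rfl
  c_naturality {X₁ Y₁ X₂ Y₂} f g := by
    have e : tensorHom k (homMk f 0 0) (homMk g 0 0) = homMk (tHom k f g) _ _ := by
      refine homogeneous_induction k f (fun p f hf => ?_) (fun a b ha hb => ?_)
      swap
      · rw [add_tHom, homMk_add, homMk_add, map_add, LinearMap.add_apply, ha, hb]
      refine homogeneous_induction k g (fun q g hg => ?_) (fun a b ha hb => ?_)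
      swap
      · rw [tHom_add, homMk_add, homMk_add, map_add, ha, hb]
      rw [tensorHom_apply (homMk f 0 0) (homMk g 0 0) hf hg,
        show sgn (0 * q + p * 0 + 0 * 0 + 0 * 0) = 1 by simp [sgn_zero], one_zsmul]
      rfl
    refine (congrArg (fun t => t ≫ _) e).trans ?_
    exact (Category.comp_id (tHom k f g)).trans (Category.id_comp (tHom k f g)).symm
  associativity X Y Z := by
    have e1 := tensorHom_even (k := k) (homMk (𝟙 (tObj k X Y)) (0 + 0) 0)
      (𝟙 (⟨Z, 0⟩ : PiEnv C)) (HasParity.id (tObj k X Y)) (HasParity.id Z) rfl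
    have e2 := tensorHom_even (k := k) (𝟙 (⟨X, 0⟩ : PiEnv C)) (homMk (𝟙 (tObj k Y Z)) (0 + 0) 0)
      (HasParity.id X) (HasParity.id (tObj k Y Z)) (zero_add 0)
    refine (congrArg (fun t => t ≫ _) e1).trans ?_
    refine Eq.trans ?_ (congrArg (fun t => _ ≫ t ≫ _) e2).symm
    change tHom k (𝟙 (tObj k X Y)) (𝟙 Z) ≫ 𝟙 (tObj k (tObj k X Y) Z) ≫
        (MonoidalSupercategory.associator X Y Z).hom =
      (MonoidalSupercategory.associator X Y Z).hom ≫ tHom k (𝟙 X) (𝟙 (tObj k Y Z)) ≫ 𝟙 (tObj k X (tObj k Y Z))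
    rw [tHom_id, tHom_id, Category.id_comp, Category.id_comp, Category.comp_id, Category.comp_id]
  left_unitality X := by
    have e1 := tensorHom_even (k := k) (homMk (𝟙 (tensorUnit k : C)) 0 0)
      (𝟙 (⟨X, 0⟩ : PiEnv C)) (HasParity.id (tensorUnit k : C)) (HasParity.id X) rfl
    refine Eq.trans ?_ (congrArg (fun t => t ≫ _) e1).symm
    change (MonoidalSupercategory.leftUnitor X).hom = tHom k (𝟙 (tensorUnit k : C)) (𝟙 X) ≫ 𝟙 (tObj k (tensorUnit k) X) ≫
      (MonoidalSupercategory.leftUnitor X).hom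
    rw [tHom_id, Category.id_comp, Category.id_comp]
  right_unitality X := by
    have e1 := tensorHom_even (k := k) (𝟙 (⟨X, 0⟩ : PiEnv C)) (homMk (𝟙 (tensorUnit k : C)) 0 0)
      (HasParity.id X) (HasParity.id (tensorUnit k : C)) rfl
    refine Eq.trans ?_ (congrArg (fun t => t ≫ _) e1).symm
    change (MonoidalSupercategory.rightUnitor X).hom = tHom k (𝟙 X) (𝟙 (tensorUnit k : C)) ≫
      𝟙 (tObj k X (tensorUnit k)) ≫ (MonoidalSupercategory.rightUnitor X).hom
    rw [tHom_id, Category.id_comp, Category.id_comp]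

end

end PiEnv

section

variable (k : Type w) [CommRing k]

/-- The `Π`-envelope of a monoidal supercategory, with `π = Π^1 𝟙` and `ζ = (id_𝟙)_1^0`. -/
def PiSMon.envelope (A : SMon.{w, v, u} k) : PiSMon.{w, v, u} k where
  carrier := PiEnv A.carrier
  pi := ⟨tensorUnit k, 1⟩
  zeta := PiEnv.isoMk (Iso.refl _) 1 0
  zeta_mem := HasParity.id (k := k) (C := A.carrier) _

/-- The 2-functor sending a monoidal supercategory to its `Π`-envelope. -/
def piEnvelope : StrictPseudofunctor (SMon.{w, v, u} k) (PiSMon.{w, v, u} k) :=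
  StrictPseudofunctor.mk''
    { obj := fun A => PiSMon.envelope k A
      map := fun F => PiEnv.mapFunctor F
      map₂ := fun x => PiEnv.mapNatTrans x
      map₂_id := fun _ => rfl
      map₂_comp := fun _ _ => rfl
      map_id := fun _ => rfl
      map_comp := fun _ _ => rfl
      map₂_whisker_left := fun _ _ _ _ => ((Category.id_comp _).trans (Category.comp_id _)).symm
      map₂_whisker_right := fun _ _ => ((Category.id_comp _).trans (Category.comp_id _)).symm }

/-- The identity transformation, as a 2-isomorphism `J_B ∘ F ≅ F_π ∘ J_A`. -/
def inclNaturality {A B : SMon.{w, v, u} k} (F : A ⟶ B) :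
    MonoidalSuperfunctor.comp F (PiEnv.incl k B.carrier) ≅
      (PiEnv.incl k A.carrier).comp (PiEnv.mapFunctor F) :=
  have hc (X Y : A.carrier) : (F.c X Y).hom ≫ F.map (𝟙 (tObj k X Y)) = 𝟙 _ ≫ (F.c X Y).hom := by
    rw [F.map_id, Category.comp_id, Category.id_comp]
  have hi : F.i.hom ≫ F.map (𝟙 (tensorUnit k)) = 𝟙 _ ≫ F.i.hom := by
    rw [F.map_id, Category.comp_id, Category.id_comp]
  { hom :=
      { app := fun X => 𝟙 (⟨F.obj X, 0⟩ : PiEnv B.carrier)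
        naturality := fun X Y f => (Category.comp_id _).trans (Category.id_comp _).symm
        app_mem := fun X => HasParity.id _
        app_tensor := fun X Y => by
          refine Eq.trans ?_ (congrArg (fun t => t ≫ _) (tHom_id (k := k) (C := PiEnv B.carrier)
            ⟨F.obj X, 0⟩ ⟨F.obj Y, 0⟩)).symm
          refine (Category.comp_id _).trans (Eq.trans ?_ (Category.id_comp _).symm)
          exact (hc X Y).symm
        app_unit := (Category.comp_id _).trans hi.symm }
    inv :=
      { app := fun X => 𝟙 (⟨F.obj X, 0⟩ : PiEnv B.carrier)
        naturality := fun X Y f => (Category.comp_id _).trans (Category.id_comp _).symm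
        app_mem := fun X => HasParity.id _
        app_tensor := fun X Y => by
          refine Eq.trans ?_ (congrArg (fun t => t ≫ _) (tHom_id (k := k) (C := PiEnv B.carrier)
            ⟨F.obj X, 0⟩ ⟨F.obj Y, 0⟩)).symm
          refine (Category.comp_id _).trans (Eq.trans ?_ (Category.id_comp _).symm)
          exact hc X Y
        app_unit := (Category.comp_id _).trans hi }
    hom_inv_id := MonoidalSuperfunctor.hom_ext fun _ => Category.id_comp _
    inv_hom_id := MonoidalSuperfunctor.hom_ext fun _ => Category.id_comp _ }

/-- The canonical 2-natural transformation `J : id ⟶ ν ∘ (-)_π`. -/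
def unitPi : Pseudofunctor.StrongTrans (Pseudofunctor.id (SMon.{w, v, u} k))
    ((piEnvelope k).comp (forgetPi k)).toPseudofunctor where
  app A := PiEnv.incl k A.carrier
  naturality F := inclNaturality k F
  naturality_naturality {A B F G} x := MonoidalSuperfunctor.hom_ext fun X =>
    (Category.comp_id _).trans (Category.id_comp _).symm
  naturality_id A := MonoidalSuperfunctor.hom_ext fun X => by
    have e1 := SMon.leftUnitor_hom_app (k := k) (A := A) (B := (PiSMon.envelope k A).toSMon)
      (PiEnv.incl k A.carrier) X
    have e2 := SMon.rightUnitor_inv_app (k := k) (A := A) (B := (PiSMon.envelope k A).toSMon)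
      (PiEnv.incl k A.carrier) X
    have e0 : (MonoidalNatTrans.toNatTrans
        (((piEnvelope k).comp (forgetPi k)).mapId A).hom).app ⟨X, 0⟩ =
        𝟙 (⟨X, 0⟩ : PiEnv A.carrier) := by
      rw [((piEnvelope k).comp (forgetPi k)).mapId_eq_eqToIso]
      exact SMon.eqToHom_app k (((piEnvelope k).comp (forgetPi k)).map_id A) _
    refine (Category.id_comp _).trans (e0.trans ?_)
    refine Eq.trans ?_ (Category.id_comp _).symm
    exact ((congrArg₂ (· ≫ ·) e1 e2).trans (Category.id_comp _)).symm
  naturality_comp {A B C} F G := MonoidalSuperfunctor.hom_ext fun X => by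
    have e1 := SMon.associator_hom_app (k := k) (A := A) (B := B) (C := C)
      (D := (PiSMon.envelope k C).toSMon) F G (PiEnv.incl k C.carrier) X
    have e2 := SMon.associator_inv_app (k := k) (A := A) (B := B)
      (C := (PiSMon.envelope k B).toSMon) (D := (PiSMon.envelope k C).toSMon) F
      (PiEnv.incl k B.carrier) (PiEnv.mapFunctor G) X
    have e3 := SMon.associator_hom_app (k := k) (A := A) (B := (PiSMon.envelope k A).toSMon)
      (C := (PiSMon.envelope k B).toSMon) (D := (PiSMon.envelope k C).toSMon)
      (PiEnv.incl k A.carrier) (PiEnv.mapFunctor F) (PiEnv.mapFunctor G) X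
    have e4 : G.map (𝟙 (F.obj X)) = 𝟙 (G.obj (F.obj X)) := G.map_id _
    have e0 : (MonoidalNatTrans.toNatTrans
        (((piEnvelope k).comp (forgetPi k)).mapComp F G).hom).app ⟨X, 0⟩ =
        𝟙 (⟨G.obj (F.obj X), 0⟩ : PiEnv C.carrier) := by
      rw [((piEnvelope k).comp (forgetPi k)).mapComp_eq_eqToIso]
      exact SMon.eqToHom_app k (((piEnvelope k).comp (forgetPi k)).map_comp F G) _
    refine (Category.id_comp _).trans (e0.trans ?_)
    refine Eq.trans ?_ (Category.id_comp _).symm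
    refine Eq.trans ?_ (congrArg₂ (· ≫ ·) e1 (congrArg₂ (· ≫ ·) rfl (congrArg₂ (· ≫ ·) e2
      (congrArg₂ (· ≫ ·) e4 e3)))).symm
    refine Eq.trans ?_ (Category.id_comp _).symm
    refine Eq.trans ?_ (Category.id_comp _).symm
    refine Eq.trans ?_ (Category.id_comp _).symm
    exact (Category.id_comp _).symm

/-- Restriction along `J`: the functor `Hom (A_π, B) ⥤ Hom (A, ν B)` sending `G` to `ν G ∘ J_A`. -/
def restriction (A : SMon.{w, v, u} k) (B : PiSMon.{w, v, u} k) :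
    ((piEnvelope k).obj A ⟶ B) ⥤ (A ⟶ (forgetPi k).obj B) where
  obj G := (unitPi k).app A ≫ (forgetPi k).map G
  map x := (unitPi k).app A ◁ (forgetPi k).map₂ x
  map_id _ := rfl
  map_comp _ _ := rfl

end

end

/-! ### Monoidal `Π`-categories -/

open MonoidalCategory Functor.LaxMonoidal Functor.OplaxMonoidal in
/-- A (bundled) monoidal `Π`-category: a `k`-linear monoidal category with an object `(π, β)` of
its Drinfeld center such that `β_π = -1`, and an isomorphism `ξ : π ⊗ π ≅ 𝟙` satisfying `xi_comm`. -/
structure PiMon (k : Type w) [CommRing k] where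
  carrier : Type u
  [category : Category.{v} carrier]
  [preadditive : Preadditive carrier]
  [linear : Linear k carrier]
  [monoidal : MonoidalCategory carrier]
  [monoidalPreadditive : MonoidalPreadditive carrier]
  [monoidalLinear : MonoidalLinear k carrier]
  /-- the object `π` -/
  pi : carrier
  /-- the half-braiding `β : π ⊗ - ≅ - ⊗ π` making `(π, β)` an object of the Drinfeld center -/
  β : HalfBraiding pi
  xi : pi ⊗ pi ≅ 𝟙_ carrier
  braiding_self : (β.β pi).hom = -𝟙 (pi ⊗ pi)
  xi_comm : ∀ X : carrier,
    (xi.hom ▷ X) ≫ (λ_ X).hom ≫ (ρ_ X).inv ≫ (X ◁ xi.inv) =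
      (α_ pi pi X).hom ≫ (pi ◁ (β.β X).hom) ≫ (α_ pi X pi).inv ≫
        ((β.β X).hom ▷ pi) ≫ (α_ X pi pi).hom

attribute [instance] PiMon.category PiMon.preadditive PiMon.linear PiMon.monoidal
  PiMon.monoidalPreadditive PiMon.monoidalLinear

section

open MonoidalCategory Functor.LaxMonoidal Functor.OplaxMonoidal

variable {k : Type w} [CommRing k]

/-- A monoidal `Π`-functor: a `k`-linear (strong) monoidal functor `F`, together with an
isomorphism `j : π ≅ F π` compatible with the `β`'s and the `ξ`'s. -/
structure PiMonFunctor (A : PiMon.{w, v, u} k) (B : PiMon.{w, v', u'} k) where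
  functor : A.carrier ⥤ B.carrier
  [additive : functor.Additive]
  [linear : functor.Linear k]
  [monoidal : functor.Monoidal]
  j : B.pi ≅ functor.obj A.pi
  j_braiding : ∀ X : A.carrier,
    (j.hom ▷ functor.obj X) ≫ μ functor A.pi X ≫ functor.map (A.β.β X).hom =
      (B.β.β (functor.obj X)).hom ≫ (functor.obj X ◁ j.hom) ≫ μ functor X A.pi
  j_xi : B.xi.hom ≫ ε functor =
    (j.hom ⊗ₘ j.hom) ≫ μ functor A.pi A.pi ≫ functor.map A.xi.hom

attribute [instance] PiMonFunctor.additive PiMonFunctor.linear PiMonFunctor.monoidal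

namespace PiMonFunctor

theorem monoidal_ext {C : Type u} [Category.{v} C] [MonoidalCategory C] {D : Type u'}
    [Category.{v'} D] [MonoidalCategory D] {F : C ⥤ D} (m m' : F.Monoidal) (hε : m.ε = m'.ε)
    (hμ : ∀ X Y, m.μ X Y = m'.μ X Y) : m = m' := by
  have eμ : m.μ = m'.μ := by funext X Y; exact hμ X Y
  refine Functor.Monoidal.ext hε eμ ?_ ?_
  · calc m.η = m.η ≫ m'.ε ≫ m'.η := by rw [m'.ε_η, Category.comp_id]
      _ = (m.η ≫ m.ε) ≫ m'.η := by rw [hε, Category.assoc]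
      _ = m'.η := by rw [m.η_ε, Category.id_comp]
  · funext X Y
    calc m.δ X Y = m.δ X Y ≫ m'.μ X Y ≫ m'.δ X Y := by rw [m'.μ_δ, Category.comp_id]
      _ = (m.δ X Y ≫ m.μ X Y) ≫ m'.δ X Y := by rw [hμ, Category.assoc]
      _ = m'.δ X Y := by rw [m.δ_μ, Category.id_comp]

theorem ext' {A : PiMon.{w, v, u} k} {B : PiMon.{w, v', u'} k} {F G : PiMonFunctor A B}
    (h : F.functor = G.functor) (hε : HEq (ε F.functor) (ε G.functor))
    (hμ : ∀ X Y, HEq (μ F.functor X Y) (μ G.functor X Y)) (hj : HEq F.j.hom G.j.hom) : F = G := by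
  obtain @⟨F, _, _, mF, j, _, _⟩ := F
  obtain @⟨G, _, _, mG, j', _, _⟩ := G
  obtain rfl : F = G := h
  obtain rfl : mF = mG := monoidal_ext mF mG (eq_of_heq hε) fun X Y => eq_of_heq (hμ X Y)
  obtain rfl : j = j' := Iso.ext (eq_of_heq hj)
  rfl

/-- The identity monoidal `Π`-functor. -/
def id (A : PiMon.{w, v, u} k) : PiMonFunctor A A where
  functor := 𝟭 A.carrier
  j := Iso.refl _
  j_braiding X := by simp
  j_xi := by simp

/-- The composite of two monoidal `Π`-functors. -/
def comp {A : PiMon.{w, v, u} k} {B : PiMon.{w, v', u'} k} {C : PiMon.{w, v'', u''} k}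
    (F : PiMonFunctor A B) (G : PiMonFunctor B C) : PiMonFunctor A C where
  functor := F.functor ⋙ G.functor
  j := G.j ≪≫ G.functor.mapIso F.j
  j_braiding X := by
    have h1 := G.j_braiding (F.functor.obj X)
    have h2 := congrArg (fun t => G.functor.map t) (F.j_braiding X)
    simp only [Functor.map_comp] at h2
    simp only [Functor.comp_obj, Functor.comp_map, Functor.LaxMonoidal.comp_μ, Iso.trans_hom,
      Functor.mapIso_hom, comp_whiskerRight, whiskerLeft_comp, Category.assoc]
    rw [μ_natural_left_assoc, h2, reassoc_of% h1, μ_natural_right_assoc]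
  j_xi := by
    have h1 := G.j_xi
    have h2 := congrArg (fun t => G.functor.map t) F.j_xi
    simp only [Functor.map_comp] at h2
    simp only [Functor.comp_obj, Functor.comp_map, Functor.LaxMonoidal.comp_μ,
      Functor.LaxMonoidal.comp_ε, Iso.trans_hom, Functor.mapIso_hom]
    rw [reassoc_of% h1, h2, ← tensorHom_comp_tensorHom]
    simp only [Category.assoc]
    rw [μ_natural_assoc]

end PiMonFunctor

/-- The category of monoidal `Π`-categories and monoidal `Π`-functors. -/
instance : Category (PiMon.{w, v, u} k) where
  Hom A B := PiMonFunctor A B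
  id A := PiMonFunctor.id A
  comp F G := PiMonFunctor.comp F G
  id_comp F := PiMonFunctor.ext' rfl
    (heq_of_eq ((congrArg (fun t => ε F.functor ≫ t) (F.functor.map_id _)).trans
      (Category.comp_id _)))
    (fun X Y => heq_of_eq ((congrArg (fun t => μ F.functor X Y ≫ t) (F.functor.map_id _)).trans
      (Category.comp_id _)))
    (heq_of_eq ((congrArg (fun t => F.j.hom ≫ t) (F.functor.map_id _)).trans (Category.comp_id _)))
  comp_id _ := PiMonFunctor.ext' rfl (heq_of_eq (Category.id_comp _))
    (fun _ _ => heq_of_eq (Category.id_comp _)) (heq_of_eq (Category.id_comp _))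
  assoc _ _ H := PiMonFunctor.ext' rfl
    (heq_of_eq ((congrArg (fun t => ε H.functor ≫ t) (H.functor.map_comp _ _)).trans
      (Category.assoc _ _ _).symm))
    (fun _ _ => heq_of_eq ((congrArg (fun t => μ H.functor _ _ ≫ t) (H.functor.map_comp _ _)).trans
      (Category.assoc _ _ _).symm))
    (heq_of_eq ((congrArg (fun t => H.j.hom ≫ t) (H.functor.map_comp _ _)).trans
      (Category.assoc _ _ _).symm))

end

/-! ### The monoidal `Π`-category underlying a monoidal `Π`-supercategory -/

namespace PiSMon

section

variable {k : Type w} [CommRing k] {C : Type u} [Category.{v} C] [Preadditive C] [Linear k C]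
  [Supercategory k C] [MonoidalSupercategory k C]

theorem tHom_comp_id {X Y Z W : C} (f : X ⟶ Y) (g : Y ⟶ Z) :
    tHom k (f ≫ g) (𝟙 W) = tHom k f (𝟙 W) ≫ tHom k g (𝟙 W) := by
  rw [tHom_comp_right_even _ _ _ (HasParity.id W), Category.comp_id]

theorem id_tHom_comp {X Y Z W : C} (f : X ⟶ Y) (g : Y ⟶ Z) :
    tHom k (𝟙 W) (f ≫ g) = tHom k (𝟙 W) f ≫ tHom k (𝟙 W) g := by
  rw [tHom_comp_left_even _ _ _ (HasParity.id W), Category.comp_id]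

theorem leftUnitor_tHom_id (X Y : C) : tHom k (leftUnitor (k := k) X).hom (𝟙 Y) =
    (associator (k := k) (tensorUnit k) X Y).hom ≫ (leftUnitor (k := k) (tObj k X Y)).hom :=
  congrArg Subtype.val (MonoidalCategory.leftUnitor_whiskerRight (⟨X⟩ : Underlying k C) ⟨Y⟩)

theorem id_tHom_rightUnitor (X Y : C) :
    (associator (k := k) X Y (tensorUnit k)).hom ≫ tHom k (𝟙 X) (rightUnitor (k := k) Y).hom =
      (rightUnitor (k := k) (tObj k X Y)).hom :=
  (congrArg Subtype.val (MonoidalCategory.rightUnitor_tensor_hom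
    (⟨X⟩ : Underlying k C) ⟨Y⟩)).symm

variable (k C) in
theorem leftUnitor_eq_rightUnitor : (leftUnitor (k := k) (tensorUnit k : C)).hom =
    (rightUnitor (k := k) (tensorUnit k : C)).hom :=
  congrArg Subtype.val (MonoidalCategory.unitors_equal (C := Underlying k C))

variable {P : C} (ζ : P ≅ (tensorUnit k : C))

/-- The isomorphism `l_X ∘ (ζ ⊗ 1_X) : π ⊗ X ≅ X`. -/
def zL (X : C) : tObj k P X ≅ X where
  hom := tHom k ζ.hom (𝟙 X) ≫ (leftUnitor X).hom
  inv := (leftUnitor X).inv ≫ tHom k ζ.inv (𝟙 X)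
  hom_inv_id := by
    rw [Category.assoc, Iso.hom_inv_id_assoc, ← tHom_comp_id, ζ.hom_inv_id, tHom_id]
  inv_hom_id := by
    rw [Category.assoc, ← Category.assoc (tHom k ζ.inv (𝟙 X)), ← tHom_comp_id, ζ.inv_hom_id,
      tHom_id, Category.id_comp, Iso.inv_hom_id]

/-- The isomorphism `r_X ∘ (1_X ⊗ ζ) : X ⊗ π ≅ X`. -/
def zR (X : C) : tObj k X P ≅ X where
  hom := tHom k (𝟙 X) ζ.hom ≫ (rightUnitor X).hom
  inv := (rightUnitor X).inv ≫ tHom k (𝟙 X) ζ.inv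
  hom_inv_id := by
    rw [Category.assoc, Iso.hom_inv_id_assoc, ← id_tHom_comp, ζ.hom_inv_id, tHom_id]
  inv_hom_id := by
    rw [Category.assoc, ← Category.assoc (tHom k (𝟙 X) ζ.inv), ← id_tHom_comp, ζ.inv_hom_id,
      tHom_id, Category.id_comp, Iso.inv_hom_id]

theorem zL_naturality {X Y : C} {f : X ⟶ Y} (hf : HasParity k f 0) :
    tHom k (𝟙 P) f ≫ (zL ζ Y).hom = (zL ζ X).hom ≫ f := by
  change _ ≫ _ ≫ _ = (_ ≫ _) ≫ _
  rw [Category.assoc, ← leftUnitor_naturality, ← Category.assoc, ← Category.assoc,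
    tHom_comp_left_even _ _ _ (HasParity.id P), tHom_comp_right_even _ _ _ hf, Category.id_comp,
    Category.comp_id, Category.comp_id, Category.id_comp]

theorem zR_naturality {X Y : C} {f : X ⟶ Y} (hf : HasParity k f 0) :
    tHom k f (𝟙 P) ≫ (zR ζ Y).hom = (zR ζ X).hom ≫ f := by
  change _ ≫ _ ≫ _ = (_ ≫ _) ≫ _
  rw [Category.assoc, ← rightUnitor_naturality, ← Category.assoc, ← Category.assoc,
    tHom_comp_left_even _ _ _ hf, tHom_comp_left_even _ _ _ (HasParity.id X), Category.id_comp,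
    Category.comp_id, Category.comp_id, Category.id_comp]

theorem zL_tHom_id (X Y : C) :
    tHom k (zL ζ X).hom (𝟙 Y) = (associator (k := k) P X Y).hom ≫ (zL ζ (tObj k X Y)).hom := by
  change tHom k (_ ≫ _) _ = _ ≫ _ ≫ _
  rw [tHom_comp_id, leftUnitor_tHom_id, ← Category.assoc, associator_naturality, tensorHom_id,
    Category.assoc]

theorem zR_tHom_id (X Y : C) :
    tHom k (zR ζ X).hom (𝟙 Y) =
      (associator (k := k) X P Y).hom ≫ tHom k (𝟙 X) (zL ζ Y).hom := by
  change tHom k (_ ≫ _) _ = _ ≫ tHom k _ (_ ≫ _)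
  have e : tHom k (rightUnitor (k := k) X).hom (𝟙 Y) =
      (associator (k := k) X (tensorUnit k) Y).hom ≫ tHom k (𝟙 X) (leftUnitor (k := k) Y).hom :=
    (triangle X Y).symm
  rw [tHom_comp_id, id_tHom_comp, e, ← Category.assoc, associator_naturality, Category.assoc]

theorem zR_tensor (X Y : C) :
    (zR ζ (tObj k X Y)).hom =
      (associator (k := k) X Y P).hom ≫ tHom k (𝟙 X) (zR ζ Y).hom := by
  change _ ≫ _ = _ ≫ tHom k _ (_ ≫ _)
  rw [id_tHom_comp, ← id_tHom_rightUnitor, ← Category.assoc, ← Category.assoc,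
    ← associator_naturality, tensorHom_id]

/-- The isomorphism `β_X = (1_X ⊗ ζ⁻¹) ∘ r_X⁻¹ ∘ l_X ∘ (ζ ⊗ 1_X) : π ⊗ X ≅ X ⊗ π`. -/
def braid (X : C) : tObj k P X ≅ tObj k X P := zL ζ X ≪≫ (zR ζ X).symm

theorem braid_zR (X : C) : (braid ζ X).hom ≫ (zR ζ X).hom = (zL ζ X).hom := by
  simp [braid]

theorem zR_zeta : (zR ζ P).hom ≫ ζ.hom =
    tHom k ζ.hom ζ.hom ≫ (leftUnitor (tensorUnit k)).hom := by
  change (_ ≫ _) ≫ _ = _ ≫ _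
  rw [leftUnitor_eq_rightUnitor, Category.assoc, ← rightUnitor_naturality, ← Category.assoc,
    tHom_comp_left_even _ _ _ (HasParity.id P), Category.id_comp, Category.comp_id]

/-- The isomorphism `ξ = l_𝟙 ∘ (ζ ⊗ ζ) : π ⊗ π ≅ 𝟙`. -/
def xiIso : tObj k P P ≅ (tensorUnit k : C) where
  hom := tHom k ζ.hom ζ.hom ≫ (leftUnitor (tensorUnit k)).hom
  inv := (zR ζ P ≪≫ ζ).inv
  hom_inv_id := by rw [← zR_zeta]; exact (zR ζ P ≪≫ ζ).hom_inv_id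
  inv_hom_id := by rw [← zR_zeta]; exact (zR ζ P ≪≫ ζ).inv_hom_id

theorem zR_zeta' : (zR ζ P).hom ≫ ζ.hom = (xiIso ζ).hom := zR_zeta ζ

variable {ζ}

theorem zL_mem (hζ : HasParity k ζ.hom 1) (X : C) : HasParity k (zL ζ X).hom 1 :=
  ((tensorHom_mem hζ (HasParity.id X)).of_eq (add_zero 1)).comp_even (leftUnitor_mem X)

theorem zR_mem (hζ : HasParity k ζ.hom 1) (X : C) : HasParity k (zR ζ X).hom 1 :=
  ((tensorHom_mem (HasParity.id X) hζ).of_eq (zero_add 1)).comp_even (rightUnitor_mem X)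

theorem braid_mem (hζ : HasParity k ζ.hom 1) (X : C) : HasParity k (braid ζ X).hom 0 :=
  ((zL_mem hζ X).comp (zR_mem hζ X).inv).of_eq (by decide)

theorem xiIso_mem (hζ : HasParity k ζ.hom 1) : HasParity k (xiIso ζ).hom 0 :=
  ((tensorHom_mem hζ hζ).comp_even (leftUnitor_mem _)).of_eq (by decide)

theorem zL_odd (hζ : HasParity k ζ.hom 1) {X Y : C} {f : X ⟶ Y} (hf : HasParity k f 1) :
    tHom k (𝟙 P) f ≫ (zL ζ Y).hom = -((zL ζ X).hom ≫ f) := by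
  have e1 : tHom k (𝟙 P) f ≫ tHom k ζ.hom (𝟙 Y) = tHom k ζ.hom f := by
    rw [tHom_comp_left_even _ _ _ (HasParity.id P), Category.id_comp, Category.comp_id]
  have e2 : tHom k ζ.hom (𝟙 X) ≫ tHom k (𝟙 (tensorUnit k)) f = -tHom k ζ.hom f := by
    have h := interchange ζ.hom (𝟙 X) (𝟙 (tensorUnit k : C)) f hζ hf
    rw [Category.id_comp, Category.comp_id] at h
    rw [h, show sgn (1 * 1) = -1 by decide, neg_one_zsmul]
  change _ ≫ _ ≫ _ = -((_ ≫ _) ≫ _)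
  rw [Category.assoc, ← leftUnitor_naturality, ← Category.assoc, ← Category.assoc, e1]
  refine Eq.trans ?_ (congrArg (fun t => -(t ≫ _)) e2).symm
  rw [Preadditive.neg_comp, neg_neg]

theorem zL_zeta (hζ : HasParity k ζ.hom 1) : (zL ζ P).hom ≫ ζ.hom = -(xiIso ζ).hom := by
  have e := zL_odd hζ hζ
  rw [← neg_eq_iff_eq_neg, ← e]
  change _ ≫ _ ≫ _ = _ ≫ _
  rw [← Category.assoc, tHom_comp_left_even _ _ _ (HasParity.id P), Category.id_comp,
    Category.comp_id]

theorem zL_eq_neg_zR (hζ : HasParity k ζ.hom 1) : (zL ζ P).hom = -(zR ζ P).hom := by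
  rw [← cancel_mono ζ.hom, zL_zeta hζ, Preadditive.neg_comp, zR_zeta']

theorem braid_self (hζ : HasParity k ζ.hom 1) : (braid ζ P).hom = -𝟙 (tObj k P P) := by
  rw [← cancel_mono (zR ζ P).hom, braid_zR, zL_eq_neg_zR hζ, Preadditive.neg_comp,
    Category.id_comp]

theorem braid_naturality {X Y : C} {f : X ⟶ Y} (hf : HasParity k f 0) :
    tHom k (𝟙 P) f ≫ (braid ζ Y).hom = (braid ζ X).hom ≫ tHom k f (𝟙 P) := by
  rw [← cancel_mono (zR ζ Y).hom, Category.assoc, Category.assoc, braid_zR,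
    zR_naturality ζ hf, zL_naturality ζ hf, ← braid_zR, Category.assoc]

theorem braid_tensor (X Y : C) : (braid ζ (tObj k X Y)).hom =
    (associator (k := k) P X Y).inv ≫ tHom k (braid ζ X).hom (𝟙 Y) ≫
      (associator (k := k) X P Y).hom ≫ tHom k (𝟙 X) (braid ζ Y).hom ≫
        (associator (k := k) X Y P).inv := by
  rw [← cancel_mono (zR ζ (tObj k X Y)).hom, braid_zR]
  simp only [Category.assoc]
  rw [zR_tensor, Iso.inv_hom_id_assoc, ← id_tHom_comp, braid_zR, ← zR_tHom_id, ← tHom_comp_id,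
    braid_zR, zL_tHom_id, Iso.inv_hom_id_assoc]

theorem braid_xi (hζ : HasParity k ζ.hom 1) (X : C) :
    tHom k (xiIso ζ).hom (𝟙 X) ≫ (leftUnitor (k := k) X).hom ≫ (rightUnitor (k := k) X).inv ≫
        tHom k (𝟙 X) (xiIso ζ).inv =
      (associator (k := k) P P X).hom ≫ tHom k (𝟙 P) (braid ζ X).hom ≫
        (associator (k := k) P X P).inv ≫ tHom k (braid ζ X).hom (𝟙 P) ≫
          (associator (k := k) X P P).hom := by
  have h2 : tHom k (𝟙 X) (xiIso ζ).hom ≫ tHom k (𝟙 X) (xiIso ζ).inv = 𝟙 _ := by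
    rw [← id_tHom_comp, Iso.hom_inv_id, tHom_id]
  have h3 : tHom k (𝟙 X) (xiIso ζ).hom ≫ (rightUnitor (k := k) X).hom =
      tHom k (𝟙 X) (zR ζ P).hom ≫ (zR ζ X).hom := by
    change _ = _ ≫ _ ≫ _
    rw [← zR_zeta', id_tHom_comp, Category.assoc]
  have h4 : tHom k (xiIso ζ).hom (𝟙 X) ≫ (leftUnitor (k := k) X).hom =
      (associator (k := k) P P X).hom ≫ tHom k (𝟙 P) (zL ζ X).hom ≫ (zL ζ X).hom := by
    rw [zL_odd hζ (zL_mem hζ X), Preadditive.comp_neg, ← Category.assoc, ← zL_tHom_id,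
      zL_eq_neg_zR hζ, ← zR_zeta', tHom_comp_id]
    change _ = -(_ ≫ _ ≫ _)
    have e : tHom k (-(zR ζ P).hom) (𝟙 X) = -tHom k (zR ζ P).hom (𝟙 X) :=
      LinearMap.map_neg₂ _ _ _
    rw [e, Preadditive.neg_comp, neg_neg, Category.assoc]
  have h5 := reassoc_of% (zR_tensor ζ X P)
  have h6 := zR_naturality ζ (braid_mem hζ X)
  have h7 := zR_tensor ζ P X
  have key : tHom k (xiIso ζ).hom (𝟙 X) ≫ (leftUnitor (k := k) X).hom =
      (associator (k := k) P P X).hom ≫ tHom k (𝟙 P) (braid ζ X).hom ≫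
        (associator (k := k) P X P).inv ≫ tHom k (braid ζ X).hom (𝟙 P) ≫
          (associator (k := k) X P P).hom ≫ tHom k (𝟙 X) (xiIso ζ).hom ≫
            (rightUnitor (k := k) X).hom := by
    rw [h3, ← h5, reassoc_of% h6, braid_zR, h7, Category.assoc, Iso.inv_hom_id_assoc,
      ← Category.assoc (tHom k (𝟙 P) (braid ζ X).hom), ← id_tHom_comp, braid_zR, h4]
  rw [← Category.assoc, key]
  simp only [Category.assoc, Iso.hom_inv_id_assoc]
  rw [h2, Category.comp_id]

end

open MonoidalCategory in
/-- The object `(π, β)` of the Drinfeld center of the underlying monoidal category. -/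
def halfBraiding {k : Type w} [CommRing k] (A : PiSMon.{w, v, u} k) :
    HalfBraiding (⟨A.pi⟩ : Underlying k A.carrier) where
  β X := Underlying.mkIso (braid A.zeta X.of) (braid_mem A.zeta_mem X.of)
  monoidal X Y := Underlying.hom_ext (braid_tensor X.of Y.of)
  naturality f := Underlying.hom_ext (braid_naturality f.2)

/-- The monoidal `Π`-category underlying a monoidal `Π`-supercategory. -/
def toPiMon {k : Type w} [CommRing k] (A : PiSMon.{w, v, u} k) : PiMon.{w, v, u} k where
  carrier := Underlying k A.carrier
  pi := ⟨A.pi⟩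
  β := halfBraiding A
  xi := Underlying.mkIso (xiIso A.zeta) (xiIso_mem A.zeta_mem)
  braiding_self := Underlying.hom_ext (braid_self A.zeta_mem)
  xi_comm X := Underlying.hom_ext (braid_xi A.zeta_mem X.of)

end PiSMon

namespace MonoidalSuperfunctor

section

variable {k : Type w} [CommRing k]
  {C : Type u} [Category.{v} C] [Preadditive C] [Linear k C] [Supercategory k C]
  [MonoidalSupercategory k C]
  {D : Type u'} [Category.{v'} D] [Preadditive D] [Linear k D] [Supercategory k D]
  [MonoidalSupercategory k D]

/-- The functor between underlying categories given by a superfunctor. -/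
def underlyingFunctor (F : MonoidalSuperfunctor k C D) : Underlying k C ⥤ Underlying k D where
  obj X := ⟨F.obj X.of⟩
  map f := Underlying.mkHom (F.map f.1) (F.map_mem f.2)
  map_id X := Underlying.hom_ext (F.map_id X.of)
  map_comp f g := Underlying.hom_ext (F.map_comp f.1 g.1)

instance (F : MonoidalSuperfunctor k C D) : F.underlyingFunctor.Additive where
  map_add := Underlying.hom_ext (F.map_add _ _)

instance (F : MonoidalSuperfunctor k C D) : F.underlyingFunctor.Linear k where
  map_smul f r := Underlying.hom_ext (F.map_smul r f.1)

/-- The coherence maps `i` and `c` of a monoidal superfunctor, on the underlying categories. -/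
def coreMonoidal (F : MonoidalSuperfunctor k C D) : F.underlyingFunctor.CoreMonoidal where
  εIso := Underlying.mkIso F.i F.i_mem
  μIso X Y := Underlying.mkIso (F.c X.of Y.of) (F.c_mem X.of Y.of)
  μIso_hom_natural_left f Z := Underlying.hom_ext (by
    have h := F.c_naturality f.1 (𝟙 Z.of)
    rw [F.map_id] at h
    exact h)
  μIso_hom_natural_right Z f := Underlying.hom_ext (by
    have h := F.c_naturality (𝟙 Z.of) f.1
    rw [F.map_id] at h
    exact h)
  associativity X Y Z := Underlying.hom_ext (F.associativity X.of Y.of Z.of)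
  left_unitality X := Underlying.hom_ext (F.left_unitality X.of)
  right_unitality X := Underlying.hom_ext (F.right_unitality X.of)

instance underlyingMonoidal (F : MonoidalSuperfunctor k C D) : F.underlyingFunctor.Monoidal :=
  F.coreMonoidal.toMonoidal

variable (F : MonoidalSuperfunctor k C D) {P : C} (ζ : P ≅ (tensorUnit k : C)) {Q : D}
  (θ : Q ≅ (tensorUnit k : D))

/-- The isomorphism `j = (F ζ)⁻¹ ∘ i ∘ ζ : π ≅ F π`. -/
def jIso : Q ≅ F.obj P := θ ≪≫ F.i ≪≫ (F.mapIso ζ).symm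

theorem jIso_hom_map : (F.jIso ζ θ).hom ≫ F.map ζ.hom = θ.hom ≫ F.i.hom := by
  simp [jIso]

theorem jIso_mem (hζ : HasParity k ζ.hom 1) (hθ : HasParity k θ.hom 1) :
    HasParity k (F.jIso ζ θ).hom 0 :=
  (hθ.comp (F.i_mem.even_comp (F.map_mem hζ.inv))).of_eq (by decide)

open PiSMon

theorem j_zL (X : C) : tHom k (F.jIso ζ θ).hom (𝟙 (F.obj X)) ≫ (F.c P X).hom ≫
    F.map (zL ζ X).hom = (zL θ (F.obj X)).hom := by
  have h := F.c_naturality ζ.hom (𝟙 X)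
  rw [F.map_id] at h
  change _ ≫ _ ≫ F.map (_ ≫ _) = _ ≫ _
  rw [F.map_comp, ← reassoc_of% h, F.left_unitality, ← Category.assoc, ← Category.assoc,
    ← tHom_comp_id, jIso_hom_map, tHom_comp_id]
  simp only [Category.assoc]

theorem j_zR (X : C) : tHom k (𝟙 (F.obj X)) (F.jIso ζ θ).hom ≫ (F.c X P).hom ≫
    F.map (zR ζ X).hom = (zR θ (F.obj X)).hom := by
  have h := F.c_naturality (𝟙 X) ζ.hom
  rw [F.map_id] at h
  change _ ≫ _ ≫ F.map (_ ≫ _) = _ ≫ _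
  rw [F.map_comp, ← reassoc_of% h, F.right_unitality, ← Category.assoc, ← Category.assoc,
    ← id_tHom_comp, jIso_hom_map, id_tHom_comp]
  simp only [Category.assoc]

theorem j_braid (X : C) : tHom k (F.jIso ζ θ).hom (𝟙 (F.obj X)) ≫ (F.c P X).hom ≫
    F.map (braid ζ X).hom = (braid θ (F.obj X)).hom ≫ tHom k (𝟙 (F.obj X)) (F.jIso ζ θ).hom ≫
      (F.c X P).hom := by
  rw [← cancel_mono (F.map (zR ζ X).hom)]
  simp only [Category.assoc]
  rw [← F.map_comp, braid_zR, j_zL, j_zR, braid_zR]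

theorem j_xi (hζ : HasParity k ζ.hom 1) (hθ : HasParity k θ.hom 1) :
    (xiIso θ).hom ≫ F.i.hom = tHom k (F.jIso ζ θ).hom (F.jIso ζ θ).hom ≫ (F.c P P).hom ≫
      F.map (xiIso ζ).hom := by
  have hj := F.jIso_mem ζ θ hζ hθ
  have e : tHom k (F.jIso ζ θ).hom (F.jIso ζ θ).hom =
      tHom k (F.jIso ζ θ).hom (𝟙 Q) ≫ tHom k (𝟙 (F.obj P)) (F.jIso ζ θ).hom := by
    rw [tHom_comp_left_even _ _ _ hj, Category.comp_id, Category.id_comp]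
  rw [e, ← zR_zeta', ← zR_zeta', F.map_comp, Category.assoc, Category.assoc,
    reassoc_of% (F.j_zR ζ θ P), reassoc_of% (zR_naturality θ hj), jIso_hom_map]

end

end MonoidalSuperfunctor

section

variable (k : Type w) [CommRing k]

/-- The monoidal `Π`-functor underlying a monoidal superfunctor. -/
def toPiMonFunctor {A B : PiSMon.{w, v, u} k} (F : A ⟶ B) : PiMonFunctor A.toPiMon B.toPiMon :=
  let F : MonoidalSuperfunctor k A.carrier B.carrier := F
  { functor := F.underlyingFunctor
    additive := inferInstanceAs F.underlyingFunctor.Additive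
    linear := inferInstanceAs (F.underlyingFunctor.Linear k)
    monoidal := F.underlyingMonoidal
    j := Underlying.mkIso (F.jIso A.zeta B.zeta) (F.jIso_mem A.zeta B.zeta A.zeta_mem B.zeta_mem)
    j_braiding := fun X => Underlying.hom_ext (F.j_braid A.zeta B.zeta X.of)
    j_xi := Underlying.hom_ext (F.j_xi A.zeta B.zeta A.zeta_mem B.zeta_mem) }

/-- The functor sending a monoidal `Π`-supercategory to its underlying monoidal `Π`-category. -/
def underlying : PiSMon.{w, v, u} k ⥤ PiMon.{w, v, u} k where
  obj A := A.toPiMon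
  map F := toPiMonFunctor k F
  map_id A := by
    refine PiMonFunctor.ext' rfl (heq_of_eq ?_) (fun X Y => heq_of_eq ?_) (heq_of_eq ?_)
    · rfl
    · rfl
    · refine Underlying.hom_ext ?_
      change A.zeta.hom ≫ 𝟙 _ ≫ A.zeta.inv = 𝟙 _
      rw [Category.id_comp, Iso.hom_inv_id]
  map_comp {A B C} F G := by
    refine PiMonFunctor.ext' rfl (heq_of_eq ?_) (fun X Y => heq_of_eq ?_) (heq_of_eq ?_)
    · rfl
    · rfl
    · refine Underlying.hom_ext ?_
      let F : MonoidalSuperfunctor k A.carrier B.carrier := F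
      let G : MonoidalSuperfunctor k B.carrier C.carrier := G
      change C.zeta.hom ≫ (G.i.hom ≫ G.map F.i.hom) ≫ G.map (F.map A.zeta.inv) =
        (C.zeta.hom ≫ G.i.hom ≫ G.map B.zeta.inv) ≫
          G.map (B.zeta.hom ≫ F.i.hom ≫ F.map A.zeta.inv)
      simp only [Functor.map_comp, Category.assoc]
      rw [← G.map_comp_assoc B.zeta.inv, Iso.inv_hom_id, G.map_id, Category.id_comp]

end

end PiSuper

end

noncomputable section

namespace PiSuper

section

open MonoidalSupercategory

/-! Both halves rest on one observation: an odd isomorphism `ζ : π → 𝟙` turns odd morphisms into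
even ones. In a monoidal `Π`-supercategory, `zL ζ X : π ⊗ X → X` is an odd isomorphism, so an odd `f
: X → Y` is the inverse of `zL ζ X` followed by the even morphism `zL ζ X ≫ f`. Even morphisms
together with the maps `zL` therefore generate everything.

The envelope. Each `Π^a X` is isomorphic to `Π^0 X` by a map of parity `a`. A transformation between
functors on the envelope is thus determined by its degree-zero components, and any compatible family
of such components extends by conjugation (`natTransOfIncl`); hence restriction along `J` is fully
faithful. A superfunctor `F` extends by sending `Π^0 X` to `F X` and `Π^1 X` to `π ⊗ F X`, with
morphisms and coherence maps conjugated by the identity or `zL` (`extend`). The coherence map at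
`Π^a X`, `Π^b Y` acquires the sign `(-1)^(ab)`, and the remaining work is to compare exponents
modulo 2. In degree zero nothing is changed, so the extension restricts to `F` strictly
(`incl_comp_extend`), and a fully faithful functor with a strict section on objects is an
equivalence with a strict section (`exists_strict_section`).

The underlying category, fully faithful. A `Π`-functor `Φ` is a functor on even morphisms. The map
`j` prescribes the image of `zL`, namely the odd map `z : F (π ⊗ X) → F X` obtained from `π ⊗ F X ≅
F (π ⊗ X)`, and with it the image of every odd morphism. Compatibility with `ξ` makes the extension
multiplicative on two odd morphisms (`map_zL_zL`). Compatibility with `β` gives the image of the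
right-handed map `zR : X ⊗ π → X` (`extMap_zR`), and thereby naturality of the coherence maps in the
second variable (`cNat_id_zL`). The extension has the prescribed `j` (`jIso_toSuperfunctor`) and is
the only one (`extMap_unique`).

The underlying category, essentially surjective. From a monoidal `Π`-category a supercategory is
built with the same objects, whose odd morphisms `X → Y` are the morphisms `π ⊗ X → Y`. Two odd
morphisms are composed by means of `ξ⁻¹`, with a minus sign; an odd morphism is tensored on the left
by an object by sliding `π` past that object with `β`. The axioms of a `Π`-category are used as
follows: associativity for three odd morphisms needs the `ξ`-`β` relation and `β_π = -1`
(`whiskerLeft_square`); functoriality of `X ⊗ -` needs the `ξ`-`β` relation (`slide_slide`); super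
interchange needs `β_π = -1` (`slide_pi`); naturality of the associator and of the left unitor needs
the half-braiding axioms (`slide_tensor`, `slide_unit`). The even part of the result is isomorphic
to the original `Π`-category, with identity coherence maps. -/

theorem tHom_comp_tHom {k : Type w} [CommRing k] {C : Type u} [Category.{v} C] [Preadditive C]
    [Linear k C] [Supercategory k C] [MonoidalSupercategory k C] {X₁ Y₁ Z₁ X₂ Y₂ Z₂ : C}
    {p q : ZMod 2} (f₁ : X₁ ⟶ Y₁) (f₂ : X₂ ⟶ Y₂) (g₁ : Y₁ ⟶ Z₁) (g₂ : Y₂ ⟶ Z₂)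
    (h₁ : HasParity k f₁ p) (h₂ : HasParity k g₂ q) :
    tHom k f₁ f₂ ≫ tHom k g₁ g₂ = sgn (q * p) • tHom k (f₁ ≫ g₁) (f₂ ≫ g₂) :=
  interchange f₁ f₂ g₁ g₂ h₁ h₂

/-! ### The universal property of the `Π`-envelope -/

namespace PiEnv

/-! ### Transformations out of the envelope are determined in degree zero. -/

section

variable {k : Type w} [CommRing k]
  {C : Type u} [Category.{v} C] [Preadditive C] [Linear k C] [Supercategory k C]
  [MonoidalSupercategory k C]
  {D : Type u'} [Category.{v'} D] [Preadditive D] [Linear k D] [Supercategory k D]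
  [MonoidalSupercategory k D]

/-- The isomorphism `(1_X)_a^0 : Π^a X ≅ Π^0 X`. -/
def toBase (X : PiEnv C) : X ≅ ⟨X.base, 0⟩ := isoMk (Iso.refl X.base) X.deg 0

omit [MonoidalSupercategory k C] in
theorem toBase_mem (X : PiEnv C) : HasParity k (toBase X).hom X.deg :=
  HasParity.of_eq (C := C) (HasParity.id (k := k) X.base)
    ((by decide : ∀ a : ZMod 2, 0 = a + a + 0) X.deg)

theorem toBase_naturality {X Y : PiEnv C} (f : X ⟶ Y) :
    f ≫ (toBase Y).hom = (toBase X).hom ≫ homMk (homOf f) 0 0 :=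
  (Category.comp_id (homOf f)).trans (Category.id_comp (homOf f)).symm

/-- The isomorphism `(1_X ⊗ 1_Y)_{a+b}^0 : Π^a X ⊗ Π^b Y ≅ Π^0 (X ⊗ Y)`. -/
def tensorToBase (X Y : PiEnv C) : tObj k X Y ≅ ⟨tObj k X.base Y.base, 0⟩ :=
  isoMk (Iso.refl (tObj k X.base Y.base)) (X.deg + Y.deg) 0

/-- With identities as underlying morphisms and both target degrees zero, only the term `ac`
survives in the sign exponent of the envelope. This is the origin of every `(-1)^(ab)` in the
universal property. -/
theorem toBase_tensor (X Y : PiEnv C) :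
    tHom k (toBase X).hom (toBase Y).hom ≫
        (tensorToBase (k := k) (⟨X.base, 0⟩ : PiEnv C) ⟨Y.base, 0⟩).hom =
      sgn (X.deg * Y.deg) • (tensorToBase (k := k) X Y).hom := by
  have e := tensorHom_apply (k := k) (toBase X).hom (toBase Y).hom (HasParity.id (k := k) X.base)
    (HasParity.id (k := k) Y.base)
  rw [show X.deg * 0 + 0 * (⟨Y.base, 0⟩ : PiEnv C).deg + X.deg * (⟨Y.base, 0⟩ : PiEnv C).deg +
    X.deg * Y.deg = X.deg * Y.deg by simp] at e
  refine (congrArg (fun t => t ≫ _) e).trans ?_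
  change (_ • tHom k (𝟙 X.base) (𝟙 Y.base)) ≫ 𝟙 (tObj k X.base Y.base) =
    _ • 𝟙 (tObj k X.base Y.base)
  rw [tHom_id, Category.comp_id]

/-- Naturality of `c` at the odd maps `toBase` expresses the coherence map in any degrees through
its value in degree zero, so tensor compatibility need only be known in degree zero. -/
theorem c_map_toBase (G : MonoidalSuperfunctor k (PiEnv C) D) (X Y : PiEnv C) :
    tHom k (G.map (toBase X).hom) (G.map (toBase Y).hom) ≫ (G.c ⟨X.base, 0⟩ ⟨Y.base, 0⟩).hom ≫
        G.map (tensorToBase (k := k) (⟨X.base, 0⟩ : PiEnv C) ⟨Y.base, 0⟩).hom =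
      sgn (X.deg * Y.deg) • ((G.c X Y).hom ≫ G.map (tensorToBase (k := k) X Y).hom) := by
  rw [← Preadditive.comp_zsmul, ← G.map_zsmul, ← toBase_tensor, G.map_comp,
    reassoc_of% (G.c_naturality (toBase X).hom (toBase Y).hom)]

section

variable {G H : MonoidalSuperfunctor k (PiEnv C) D} (y : ∀ X : C, G.obj ⟨X, 0⟩ ⟶ H.obj ⟨X, 0⟩)

/-- The component at `Π^a X` determined by a component `y_X` at `Π^0 X`. -/
def extendApp (X : PiEnv C) : G.obj X ⟶ H.obj X :=
  G.map (toBase X).hom ≫ y X.base ≫ H.map (toBase X).inv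

theorem extendApp_comp (X : PiEnv C) :
    extendApp y X ≫ H.map (toBase X).hom = G.map (toBase X).hom ≫ y X.base := by
  rw [extendApp, Category.assoc, Category.assoc, ← H.map_comp, Iso.inv_hom_id, H.map_id,
    Category.comp_id]

theorem extendApp_base (X : C) : extendApp y ⟨X, 0⟩ = y X := by
  change G.map (𝟙 _) ≫ y X ≫ H.map (𝟙 _) = _
  rw [G.map_id, H.map_id, Category.id_comp, Category.comp_id]

variable {y} in
theorem extendApp_mem (hy : ∀ X, HasParity k (y X) 0) (X : PiEnv C) :
    HasParity k (extendApp (k := k) y X) 0 :=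
  ((G.map_mem (toBase_mem X)).comp ((hy X.base).even_comp
    (H.map_mem (toBase_mem X).inv))).of_eq (CharTwo.add_self_eq_zero _)

variable {y} in
theorem extendApp_naturality (hy : ∀ {X Y : C} (f : X ⟶ Y),
    G.map (homMk f 0 0) ≫ y Y = y X ≫ H.map (homMk f 0 0)) {X Y : PiEnv C} (f : X ⟶ Y) :
    G.map f ≫ extendApp y Y = extendApp y X ≫ H.map f := by
  rw [← cancel_mono (H.mapIso (toBase Y)).hom]
  change _ ≫ H.map _ = _ ≫ H.map _
  rw [Category.assoc, extendApp_comp, Category.assoc, ← H.map_comp, ← Category.assoc, ← G.map_comp,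
    toBase_naturality, G.map_comp, H.map_comp, reassoc_of% (extendApp_comp y X), Category.assoc, hy]

variable {y} in
-- `c_map_toBase` moves both sides to degree zero at the cost of the same sign. The hypothesis `hy`
-- is tensor compatibility for the restrictions along `J`: in degree zero `tensorToBase` is the
-- coherence map of `J`. As the components are even, interchange contributes no further sign.
theorem extendApp_tensor (hm : ∀ X, HasParity k (y X) 0)
    (hy : ∀ X Y : C, (G.c ⟨X, 0⟩ ⟨Y, 0⟩).hom ≫
        G.map (tensorToBase (k := k) (⟨X, 0⟩ : PiEnv C) ⟨Y, 0⟩).hom ≫ y (tObj k X Y) =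
      tHom k (y X) (y Y) ≫ (H.c ⟨X, 0⟩ ⟨Y, 0⟩).hom ≫
        H.map (tensorToBase (k := k) (⟨X, 0⟩ : PiEnv C) ⟨Y, 0⟩).hom) (X Y : PiEnv C) :
    (G.c X Y).hom ≫ extendApp y (tObj k X Y) =
      tHom k (extendApp y X) (extendApp y Y) ≫ (H.c X Y).hom := by
  have e : extendApp y (tObj k X Y) ≫ H.map (tensorToBase (k := k) X Y).hom =
    G.map (tensorToBase (k := k) X Y).hom ≫ y (tObj k X.base Y.base) :=
    extendApp_comp y (tObj k X Y)
  have key : sgn (X.deg * Y.deg) • (((G.c X Y).hom ≫ extendApp y (tObj k X Y)) ≫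
        H.map (tensorToBase (k := k) X Y).hom) =
      sgn (X.deg * Y.deg) • ((tHom k (extendApp y X) (extendApp y Y) ≫ (H.c X Y).hom) ≫
        H.map (tensorToBase (k := k) X Y).hom) := by
    rw [Category.assoc, e, Category.assoc, ← Preadditive.comp_zsmul
        (tHom k (extendApp (k := k) y X) (extendApp (k := k) y Y)), ← c_map_toBase,
      ← Category.assoc (tHom k (extendApp y X) (extendApp y Y)),
      tHom_comp_left_even _ _ _ (extendApp_mem hm X), extendApp_comp, extendApp_comp,
      ← tHom_comp_right_even _ _ _ (hm Y.base), Category.assoc, ← hy, ← Category.assoc,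
      ← Preadditive.zsmul_comp, ← c_map_toBase, Category.assoc, Category.assoc]
  -- The common sign is its own inverse, so multiplying by it once more removes it from `key`.
  have hs : sgn (X.deg * Y.deg) * sgn (X.deg * Y.deg) = 1 := by
    rw [sgn_mul_sgn, CharTwo.add_self_eq_zero, sgn_zero]
  have key2 := congrArg (fun t => sgn (X.deg * Y.deg) • t) key
  simp only [smul_smul, hs, one_zsmul] at key2
  exact (cancel_mono (H.mapIso (tensorToBase (k := k) X Y)).hom).1 key2

end

variable {G H : MonoidalSuperfunctor k (PiEnv C) D}

/-- The extension to `C_π` of a monoidal natural transformation between restrictions along `J`. -/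
def natTransOfIncl (y : (incl k C).comp G ⟶ (incl k C).comp H) : G ⟶ H where
  app X := extendApp (fun X => y.app X) X
  naturality X Y f := extendApp_naturality (fun f => y.naturality f) f
  app_mem X := extendApp_mem (fun X => y.app_mem X) X
  app_tensor X Y := extendApp_tensor (fun X => y.app_mem X)
    (fun X Y => (Category.assoc _ _ _).symm.trans (y.app_tensor X Y)) X Y
  app_unit := by
    have h : (G.i.hom ≫ G.map (𝟙 _)) ≫ _ = H.i.hom ≫ H.map (𝟙 _) := y.app_unit
    rw [G.map_id, H.map_id, Category.comp_id, Category.comp_id] at h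
    exact (congrArg (fun t => _ ≫ t) (extendApp_base (fun X => y.app X) (tensorUnit k))).trans h

theorem whiskerLeft_natTransOfIncl (y : (incl k C).comp G ⟶ (incl k C).comp H) :
    MonoidalSuperfunctor.whiskerLeft (incl k C) (natTransOfIncl y) = y :=
  MonoidalSuperfunctor.hom_ext fun X => by
    change G.map (𝟙 _) ≫ _ ≫ H.map (𝟙 _) = _
    rw [G.map_id, H.map_id]
    exact (Category.id_comp _).trans (Category.comp_id _)

/-- Naturality of `x` at `toBase X` forces its component at `Π^a X`; this is the faithfulness of
restriction, while `whiskerLeft_natTransOfIncl` is its fullness. -/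
theorem natTransOfIncl_whiskerLeft (x : G ⟶ H) :
    natTransOfIncl (MonoidalSuperfunctor.whiskerLeft (incl k C) x) = x :=
  MonoidalSuperfunctor.hom_ext fun X => by
    change G.map (toBase X).hom ≫ x.app _ ≫ H.map (toBase X).inv = _
    rw [reassoc_of% (x.naturality (toBase X).hom), ← H.map_comp, Iso.hom_inv_id, H.map_id,
      Category.comp_id]

end

/-! ### Extending a superfunctor along `J`. -/

section

variable {k : Type w} [CommRing k]
  {C : Type u} [Category.{v} C] [Preadditive C] [Linear k C] [Supercategory k C]
  [MonoidalSupercategory k C]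
  {D : Type u'} [Category.{v'} D] [Preadditive D] [Linear k D] [Supercategory k D]
  [MonoidalSupercategory k D]
  {P : D} (ζ : P ≅ (tensorUnit k : D))

/-- The object `π^a ⊗ X`, for `a ∈ {0, 1}`, with its isomorphism to `X`. -/
def shift (a : ZMod 2) (X : D) : Σ Y : D, (Y ≅ X) :=
  -- Degree zero is left untouched, which makes the restriction of the extension strictly equal to
  -- `F`. Exponents are taken modulo 2, so `Π^1 X ⊗ Π^1 Y` has degree zero and no factor `π ⊗ π` is
  -- introduced.
  if a = 0 then ⟨X, Iso.refl X⟩ else ⟨tObj k P X, PiSMon.zL ζ X⟩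

variable {ζ} in
theorem shift_mem (hζ : HasParity k ζ.hom 1) (a : ZMod 2) (X : D) :
    HasParity k (shift ζ a X).2.hom a := by
  obtain rfl | rfl : a = 0 ∨ a = 1 := (by decide : ∀ p : ZMod 2, p = 0 ∨ p = 1) a
  · exact HasParity.id X
  · exact PiSMon.zL_mem hζ X

variable (F : MonoidalSuperfunctor k C D)

/-- The objects of the extension of `F` to `C_π`. -/
def extObj (X : PiEnv C) : D := (shift ζ X.deg (F.obj X.base)).1

/-- The isomorphism `F̃ (Π^a X) ≅ F X`, of parity `a`. -/
def extIso (X : PiEnv C) : extObj ζ F X ≅ F.obj X.base := (shift ζ X.deg (F.obj X.base)).2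

/-- The morphisms of the extension of `F` to `C_π`. -/
def extMap {X Y : PiEnv C} (f : X ⟶ Y) : extObj ζ F X ⟶ extObj ζ F Y :=
  (extIso ζ F X).hom ≫ F.map (homOf f) ≫ (extIso ζ F Y).inv

/-- The isomorphism `F̃ (Π^a X ⊗ Π^b Y) ≅ F (X ⊗ Y)`. -/
def extTensorIso (X Y : PiEnv C) : extObj ζ F (tObj k X Y) ≅ F.obj (tObj k X.base Y.base) :=
  extIso ζ F (tObj k X Y)

theorem extMap_comp_iso {X Y : PiEnv C} (f : X ⟶ Y) :
    extMap ζ F f ≫ (extIso ζ F Y).hom = (extIso ζ F X).hom ≫ F.map (homOf f) := by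
  rw [extMap, Category.assoc, Category.assoc, Iso.inv_hom_id, Category.comp_id]

variable {ζ} in
theorem extIso_mem (hζ : HasParity k ζ.hom 1) (X : PiEnv C) :
    HasParity k (extIso ζ F X).hom X.deg := shift_mem hζ _ _

variable {ζ} in
theorem extTensorIso_mem (hζ : HasParity k ζ.hom 1) (X Y : PiEnv C) :
    HasParity k (extTensorIso ζ F X Y).hom (X.deg + Y.deg) := shift_mem hζ _ _

variable {ζ} in
theorem extMap_mem (hζ : HasParity k ζ.hom 1) {X Y : PiEnv C} {f : X ⟶ Y} {p : ZMod 2}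
    (hf : HasParity k f p) : HasParity k (extMap ζ F f) p :=
  ((extIso_mem F hζ X).comp ((F.map_mem (hasParity_homOf hf)).comp
    (extIso_mem F hζ Y).inv)).of_eq
      ((by decide : ∀ p a b : ZMod 2, a + (p + a + b + b) = p) p X.deg Y.deg)


variable (hζ : HasParity k ζ.hom 1)

variable {ζ} in
/-- The coherence isomorphisms of the extension of `F` to `C_π`. -/
def extC (X Y : PiEnv C) : tObj k (extObj ζ F X) (extObj ζ F Y) ≅ extObj ζ F (tObj k X Y) where
  -- The sign is forced: the extension is to send `toBase` to `extIso`, and then naturality of `c`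
  -- at `toBase` reads as in `c_map_toBase`.
  hom := sgn (X.deg * Y.deg) • (tHom k (extIso ζ F X).hom (extIso ζ F Y).hom ≫
    (F.c X.base Y.base).hom ≫ (extTensorIso ζ F X Y).inv)
  -- No sign here: the interchange law for the two tensor products of `extIso` and its inverse
  -- already produces a `(-1)^(ab)`, which cancels the one in `hom`.
  inv := (extTensorIso ζ F X Y).hom ≫ (F.c X.base Y.base).inv ≫
    tHom k (extIso ζ F X).inv (extIso ζ F Y).inv
  hom_inv_id := by
    have h := tHom_comp_tHom (extIso ζ F X).hom (extIso ζ F Y).hom (extIso ζ F X).inv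
      (extIso ζ F Y).inv (extIso_mem F hζ X) (extIso_mem F hζ Y).inv
    rw [Preadditive.zsmul_comp]
    simp only [Category.assoc, Iso.inv_hom_id_assoc, Iso.hom_inv_id_assoc]
    rw [h, Iso.hom_inv_id, Iso.hom_inv_id, tHom_id, smul_smul, sgn_mul_sgn, mul_comm Y.deg,
      CharTwo.add_self_eq_zero, sgn_zero, one_zsmul]
  inv_hom_id := by
    have h := tHom_comp_tHom (extIso ζ F X).inv (extIso ζ F Y).inv (extIso ζ F X).hom
      (extIso ζ F Y).hom (extIso_mem F hζ X).inv (extIso_mem F hζ Y)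
    rw [Preadditive.comp_zsmul]
    simp only [Category.assoc]
    rw [reassoc_of% h, Iso.inv_hom_id, Iso.inv_hom_id, tHom_id, Preadditive.zsmul_comp,
      Preadditive.comp_zsmul, Preadditive.comp_zsmul, smul_smul, sgn_mul_sgn, mul_comm Y.deg,
      CharTwo.add_self_eq_zero, sgn_zero, one_zsmul, Category.id_comp, Iso.inv_hom_id_assoc,
      Iso.hom_inv_id]

variable {ζ} in
theorem extC_comp_iso (X Y : PiEnv C) :
    (extC F hζ X Y).hom ≫ (extTensorIso ζ F X Y).hom =
      sgn (X.deg * Y.deg) • (tHom k (extIso ζ F X).hom (extIso ζ F Y).hom ≫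
        (F.c X.base Y.base).hom) := by
  change (_ • (_ ≫ _ ≫ _)) ≫ _ = _
  rw [Preadditive.zsmul_comp, Category.assoc, Category.assoc, Iso.inv_hom_id, Category.comp_id]

variable {ζ} in
theorem extC_mem (X Y : PiEnv C) : HasParity k (extC F hζ X Y).hom 0 :=
  (((MonoidalSupercategory.tensorHom_mem (extIso_mem F hζ X) (extIso_mem F hζ Y)).comp
    ((F.c_mem _ _).even_comp
    (extTensorIso_mem F hζ X Y).inv)).zsmul _).of_eq (CharTwo.add_self_eq_zero _)

theorem extMap_add {X Y : PiEnv C} (f g : X ⟶ Y) :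
    extMap ζ F (f + g) = extMap ζ F f + extMap ζ F g := by
  have e : F.map (homOf (f + g)) = F.map (homOf f) + F.map (homOf g) := F.map_add _ _
  rw [extMap, e, Preadditive.add_comp, Preadditive.comp_add]
  rfl

variable {ζ} in
-- After conjugation this is naturality of `F.c`. The signs come from the coherence maps, from
-- interchange past `extIso`, and from the tensor product of the envelope.
theorem extC_naturality {X₁ Y₁ X₂ Y₂ : PiEnv C} (f : X₁ ⟶ Y₁) (g : X₂ ⟶ Y₂) :
    tHom k (extMap ζ F f) (extMap ζ F g) ≫ (extC F hζ Y₁ Y₂).hom =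
      (extC F hζ X₁ X₂).hom ≫ extMap ζ F (tHom k f g) := by
  refine homogeneous_induction k f (fun p f hf => ?_) (fun a b ha hb => ?_)
  swap
  · rw [add_tHom, extMap_add, extMap_add, add_tHom, Preadditive.add_comp, Preadditive.comp_add,
      ha, hb]
  refine homogeneous_induction k g (fun q g hg => ?_) (fun a b ha hb => ?_)
  swap
  · rw [tHom_add, extMap_add, extMap_add, tHom_add, Preadditive.add_comp, Preadditive.comp_add,
      ha, hb]
  have e : extMap ζ F (tHom k f g) ≫ (extTensorIso ζ F Y₁ Y₂).hom =
      (extTensorIso ζ F X₁ X₂).hom ≫ F.map (homOf (tHom k f g)) := extMap_comp_iso ζ F (tHom k f g)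
  have e1 : F.map (homOf (tHom k f g)) = sgn (X₁.deg * (q + X₂.deg + Y₂.deg) +
      (p + X₁.deg + Y₁.deg) * Y₂.deg + X₁.deg * Y₂.deg + X₁.deg * X₂.deg) •
        F.map (tHom k (homOf f) (homOf g)) := by
    rw [← F.map_zsmul]
    exact congrArg F.map (tensorHom_apply (k := k) f g (hasParity_homOf hf) (hasParity_homOf hg))
  have e2 := tHom_comp_tHom (extMap ζ F f) (extMap ζ F g) (extIso ζ F Y₁).hom (extIso ζ F Y₂).hom
    (extMap_mem F hζ hf) (extIso_mem F hζ Y₂)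
  have e3 := tHom_comp_tHom (extIso ζ F X₁).hom (extIso ζ F X₂).hom (F.map (homOf f))
    (F.map (homOf g)) (extIso_mem F hζ X₁) (F.map_mem (hasParity_homOf hg))
  have e4 : tHom k ((extIso ζ F X₁).hom ≫ F.map (homOf f))
      ((extIso ζ F X₂).hom ≫ F.map (homOf g)) = sgn ((q + X₂.deg + Y₂.deg) * X₁.deg) •
      (tHom k (extIso ζ F X₁).hom (extIso ζ F X₂).hom ≫
        tHom k (F.map (homOf f)) (F.map (homOf g))) := by
    rw [e3, smul_smul, sgn_mul_sgn, CharTwo.add_self_eq_zero, sgn_zero, one_zsmul]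
  rw [← cancel_mono (extTensorIso ζ F Y₁ Y₂).hom, Category.assoc, Category.assoc, extC_comp_iso, e,
    reassoc_of% (extC_comp_iso F hζ X₁ X₂), e1]
  simp only [Preadditive.zsmul_comp, Preadditive.comp_zsmul, smul_smul, sgn_mul_sgn,
    Category.assoc]
  rw [reassoc_of% e2, extMap_comp_iso, extMap_comp_iso, e4]
  simp only [Preadditive.zsmul_comp, smul_smul, sgn_mul_sgn, Category.assoc]
  rw [F.c_naturality]
  congr 2
  -- Modulo 2 the terms `X₁.deg * X₂.deg` and `X₁.deg * Y₂.deg` each occur twice on the right and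
  -- drop out, leaving the exponent on the left.
  grind

variable {ζ} in
-- By naturality of the associator at the three maps `extIso`, this is `F.associativity` conjugated.
-- The signs agree because `ab + (a + b)c = a(b + c) + bc`, so `(-1)^(ab)` is a 2-cocycle.
theorem extC_associativity (X Y Z : PiEnv C) :
    tHom k (extC F hζ X Y).hom (𝟙 (extObj ζ F Z)) ≫ (extC F hζ (tObj k X Y) Z).hom ≫
        extMap ζ F (associator (k := k) X Y Z).hom =
      (associator (k := k) (extObj ζ F X) (extObj ζ F Y) (extObj ζ F Z)).hom ≫
        tHom k (𝟙 (extObj ζ F X)) (extC F hζ Y Z).hom ≫ (extC F hζ X (tObj k Y Z)).hom := by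
  have e1 : tHom k (extC F hζ X Y).hom (𝟙 (extObj ζ F Z)) ≫
      tHom k (extTensorIso ζ F X Y).hom (extIso ζ F Z).hom = sgn (X.deg * Y.deg) •
        (tHom k (tHom k (extIso ζ F X).hom (extIso ζ F Y).hom) (extIso ζ F Z).hom ≫
          tHom k (F.c X.base Y.base).hom (𝟙 (F.obj Z.base))) := by
    rw [tHom_comp_left_even _ _ _ (extC_mem F hζ X Y), extC_comp_iso, zsmul_tHom,
      tHom_comp_right_even _ _ _ (HasParity.id (F.obj Z.base)), Category.id_comp, Category.comp_id]
  have e2 : tHom k (𝟙 (extObj ζ F X)) (extC F hζ Y Z).hom ≫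
      tHom k (extIso ζ F X).hom (extTensorIso ζ F Y Z).hom = sgn (Y.deg * Z.deg) •
        (tHom k (extIso ζ F X).hom (tHom k (extIso ζ F Y).hom (extIso ζ F Z).hom) ≫
          tHom k (𝟙 (F.obj X.base)) (F.c Y.base Z.base).hom) := by
    rw [tHom_comp_left_even _ _ _ (HasParity.id _), extC_comp_iso, tHom_zsmul,
      tHom_comp_right_even _ _ _ (F.c_mem Y.base Z.base), Category.id_comp, Category.comp_id]
  have e3 : extMap ζ F (associator (k := k) X Y Z).hom ≫ (extTensorIso ζ F X (tObj k Y Z)).hom =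
      (extTensorIso ζ F (tObj k X Y) Z).hom ≫
        F.map (associator (k := k) X.base Y.base Z.base).hom := extMap_comp_iso ζ F _
  have e4 : (extC F hζ (tObj k X Y) Z).hom ≫ (extTensorIso ζ F (tObj k X Y) Z).hom =
      sgn ((X.deg + Y.deg) * Z.deg) • (tHom k (extTensorIso ζ F X Y).hom (extIso ζ F Z).hom ≫
        (F.c (tObj k X.base Y.base) Z.base).hom) := extC_comp_iso F hζ (tObj k X Y) Z
  have e5 : (extC F hζ X (tObj k Y Z)).hom ≫ (extTensorIso ζ F X (tObj k Y Z)).hom =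
      sgn (X.deg * (Y.deg + Z.deg)) • (tHom k (extIso ζ F X).hom (extTensorIso ζ F Y Z).hom ≫
        (F.c X.base (tObj k Y.base Z.base)).hom) := extC_comp_iso F hζ X (tObj k Y Z)
  have e6 := MonoidalSupercategory.associator_naturality (k := k) (extIso ζ F X).hom
    (extIso ζ F Y).hom (extIso ζ F Z).hom
  rw [← cancel_mono (extTensorIso ζ F X (tObj k Y Z)).hom]
  simp only [Category.assoc]
  rw [e3, reassoc_of% e4, e5, Preadditive.zsmul_comp, Category.assoc, Preadditive.comp_zsmul,
    reassoc_of% e1, Preadditive.zsmul_comp, smul_smul, sgn_mul_sgn, Category.assoc,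
    F.associativity, Preadditive.comp_zsmul, reassoc_of% e2, Preadditive.zsmul_comp,
    Preadditive.comp_zsmul, Preadditive.comp_zsmul, smul_smul, sgn_mul_sgn, Category.assoc,
    ← reassoc_of% e6]
  congr 2
  ring

variable {ζ} in
-- The unit has degree zero, so no sign occurs and naturality of the unitor at `extIso` reduces the
-- claim to that for `F`.
theorem extC_left_unitality (X : PiEnv C) : (leftUnitor (k := k) (extObj ζ F X)).hom =
    tHom k F.i.hom (𝟙 (extObj ζ F X)) ≫ (extC F hζ (tensorUnit k) X).hom ≫
      extMap ζ F (leftUnitor (k := k) X).hom := by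
  have e1 : extMap ζ F (leftUnitor (k := k) X).hom ≫ (extIso ζ F X).hom =
      (extTensorIso ζ F (tensorUnit k) X).hom ≫ F.map (leftUnitor (k := k) X.base).hom :=
    extMap_comp_iso ζ F _
  have e2 : (extC F hζ (tensorUnit k) X).hom ≫ (extTensorIso ζ F (tensorUnit k) X).hom =
      sgn (0 * X.deg) • (tHom k (𝟙 (F.obj (tensorUnit k))) (extIso ζ F X).hom ≫
        (F.c (tensorUnit k) X.base).hom) := extC_comp_iso F hζ (tensorUnit k) X
  have e3 : tHom k F.i.hom (𝟙 (extObj ζ F X)) ≫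
      tHom k (𝟙 (F.obj (tensorUnit k))) (extIso ζ F X).hom =
      tHom k (𝟙 (tensorUnit k)) (extIso ζ F X).hom ≫ tHom k F.i.hom (𝟙 (F.obj X.base)) := by
    rw [tHom_comp_left_even _ _ _ F.i_mem, tHom_comp_left_even _ _ _ (HasParity.id _)]
    simp only [Category.id_comp, Category.comp_id]
  rw [zero_mul, sgn_zero, one_zsmul] at e2
  have e4 : ((extC F hζ (tensorUnit k) X).hom ≫ extMap ζ F (leftUnitor (k := k) X).hom) ≫
      (extIso ζ F X).hom =
      tHom k (𝟙 (F.obj (tensorUnit k))) (extIso ζ F X).hom ≫ (F.c (tensorUnit k) X.base).hom ≫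
        F.map (leftUnitor (k := k) X.base).hom :=
    (Category.assoc _ _ _).trans ((congrArg
      (fun t => (extC F hζ (tensorUnit k) X).hom ≫ t) e1).trans
      ((Category.assoc _ _ _).symm.trans ((congrArg (fun t => t ≫ _) e2).trans
        (Category.assoc _ _ _))))
  have e5 : (leftUnitor (k := k) (extObj ζ F X)).hom ≫ (extIso ζ F X).hom =
      tHom k F.i.hom (𝟙 (extObj ζ F X)) ≫
      tHom k (𝟙 (F.obj (tensorUnit k))) (extIso ζ F X).hom ≫ (F.c (tensorUnit k) X.base).hom ≫
        F.map (leftUnitor (k := k) X.base).hom := by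
    rw [reassoc_of% e3, ← F.left_unitality, MonoidalSupercategory.leftUnitor_naturality]
  rw [← cancel_mono (extIso ζ F X).hom]
  exact e5.trans ((Category.assoc _ _ _).trans (congrArg (fun t => _ ≫ t) e4)).symm

variable {ζ} in
theorem extC_right_unitality (X : PiEnv C) : (rightUnitor (k := k) (extObj ζ F X)).hom =
    tHom k (𝟙 (extObj ζ F X)) F.i.hom ≫ (extC F hζ X (tensorUnit k)).hom ≫
      extMap ζ F (rightUnitor (k := k) X).hom := by
  have e1 : extMap ζ F (rightUnitor (k := k) X).hom ≫ (extIso ζ F X).hom =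
      (extTensorIso ζ F X (tensorUnit k)).hom ≫ F.map (rightUnitor (k := k) X.base).hom :=
    extMap_comp_iso ζ F _
  have e2 : (extC F hζ X (tensorUnit k)).hom ≫ (extTensorIso ζ F X (tensorUnit k)).hom =
      sgn (X.deg * 0) • (tHom k (extIso ζ F X).hom (𝟙 (F.obj (tensorUnit k))) ≫
        (F.c X.base (tensorUnit k)).hom) := extC_comp_iso F hζ X (tensorUnit k)
  have e3 : tHom k (𝟙 (extObj ζ F X)) F.i.hom ≫
      tHom k (extIso ζ F X).hom (𝟙 (F.obj (tensorUnit k))) =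
      tHom k (extIso ζ F X).hom (𝟙 (tensorUnit k)) ≫ tHom k (𝟙 (F.obj X.base)) F.i.hom := by
    rw [tHom_comp_left_even _ _ _ (HasParity.id _), tHom_comp_right_even _ _ _ F.i_mem]
    simp only [Category.id_comp, Category.comp_id]
  rw [mul_zero, sgn_zero, one_zsmul] at e2
  have e4 : ((extC F hζ X (tensorUnit k)).hom ≫ extMap ζ F (rightUnitor (k := k) X).hom) ≫
      (extIso ζ F X).hom =
      tHom k (extIso ζ F X).hom (𝟙 (F.obj (tensorUnit k))) ≫ (F.c X.base (tensorUnit k)).hom ≫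
        F.map (rightUnitor (k := k) X.base).hom :=
    (Category.assoc _ _ _).trans ((congrArg
      (fun t => (extC F hζ X (tensorUnit k)).hom ≫ t) e1).trans
      ((Category.assoc _ _ _).symm.trans ((congrArg (fun t => t ≫ _) e2).trans
        (Category.assoc _ _ _))))
  have e5 : (rightUnitor (k := k) (extObj ζ F X)).hom ≫ (extIso ζ F X).hom =
      tHom k (𝟙 (extObj ζ F X)) F.i.hom ≫
      tHom k (extIso ζ F X).hom (𝟙 (F.obj (tensorUnit k))) ≫ (F.c X.base (tensorUnit k)).hom ≫
        F.map (rightUnitor (k := k) X.base).hom := by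
    rw [reassoc_of% e3, ← F.right_unitality, MonoidalSupercategory.rightUnitor_naturality]
  rw [← cancel_mono (extIso ζ F X).hom]
  exact e5.trans ((Category.assoc _ _ _).trans (congrArg (fun t => _ ≫ t) e4)).symm

variable {ζ} in
/-- The extension of `F` to `C_π`. -/
def extend : MonoidalSuperfunctor k (PiEnv C) D where
  obj := extObj ζ F
  map f := extMap ζ F f
  map_id X := by
    change _ ≫ F.map (𝟙 _) ≫ _ = _
    rw [F.map_id, Category.id_comp, Iso.hom_inv_id]
  map_comp {X Y Z} f g := by
    change _ ≫ F.map (homOf f ≫ homOf g) ≫ _ = (_ ≫ _ ≫ _) ≫ _ ≫ _ ≫ _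
    simp only [F.map_comp, Category.assoc, Iso.inv_hom_id_assoc]
  map_add f g := extMap_add ζ F f g
  map_smul {X Y} r f := by
    have e : F.map (homOf (r • f)) = r • F.map (homOf f) := F.map_smul _ _
    rw [extMap, e, Linear.smul_comp, Linear.comp_smul]
    rfl
  map_mem h := extMap_mem F hζ h
  c X Y := extC F hζ X Y
  i := F.i
  c_mem X Y := extC_mem F hζ X Y
  i_mem := F.i_mem
  c_naturality f g := extC_naturality F hζ f g
  associativity X Y Z := extC_associativity F hζ X Y Z
  left_unitality X := extC_left_unitality F hζ X
  right_unitality X := extC_right_unitality F hζ X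

variable {ζ} in
-- In degree zero the conjugating isomorphisms are identities and the sign is `sgn (0 * 0) = 1`;
-- objects therefore agree definitionally, and morphisms and coherence maps after deleting
-- identities.
theorem incl_comp_extend : (incl k C).comp (extend F hζ) = F := by
  refine MonoidalSuperfunctor.ext' (CategoryTheory.Functor.ext (fun X => rfl) fun X Y f => ?_)
    (fun X Y => heq_of_eq ?_) (heq_of_eq ?_)
  · refine Eq.trans ?_ ((Category.id_comp _).trans (Category.comp_id _)).symm
    exact (Category.id_comp _).trans (Category.comp_id _)
  · have e : tHom k (𝟙 (F.obj X)) (𝟙 (F.obj Y)) ≫ (F.c X Y).hom = (F.c X Y).hom := by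
      rw [tHom_id, Category.id_comp]
    change (sgn (0 * 0) • (tHom k (𝟙 (F.obj X)) (𝟙 (F.obj Y)) ≫ (F.c X Y).hom ≫ 𝟙 _)) ≫
      𝟙 _ ≫ F.map (𝟙 _) ≫ 𝟙 _ = _
    rw [F.map_id]
    refine (congrArg (fun t => _ ≫ t) ((Category.id_comp _).trans (Category.id_comp _))).trans ?_
    refine (Category.comp_id _).trans ?_
    rw [mul_zero, sgn_zero, one_zsmul]
    exact (congrArg (fun t => _ ≫ t) (Category.comp_id _)).trans e
  · change F.i.hom ≫ 𝟙 _ ≫ F.map (𝟙 _) ≫ 𝟙 _ = _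
    rw [F.map_id]
    exact (congrArg (fun t => _ ≫ t)
      ((Category.id_comp _).trans (Category.id_comp _))).trans (Category.comp_id _)

end

end PiEnv

/-- A fully faithful functor with a strict section on objects has a strict section, and both are
equivalences. -/
theorem exists_strict_section {C : Type*} [Category* C] {D : Type*} [Category* D] (R : C ⥤ D)
    [R.Full] [R.Faithful] (s : D → C) (hs : ∀ Y, R.obj (s Y) = Y) :
    R.IsEquivalence ∧ ∃ E : D ⥤ C, E.IsEquivalence ∧ E ⋙ R = 𝟭 D := by
  have : R.EssSurj := ⟨fun Y => ⟨s Y, ⟨eqToIso (hs Y)⟩⟩⟩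
  have hR : R.IsEquivalence := {}
  let E : D ⥤ C :=
    { obj := s
      -- Since `R.obj (s Y)` is only propositionally `Y`, the morphism is transported before its
      -- preimage is taken; faithfulness then gives functoriality.
      map := fun {X Y} f => R.preimage (eqToHom (hs X) ≫ f ≫ eqToHom (hs Y).symm)
      map_id := fun X => R.map_injective (by simp)
      map_comp := fun f g => R.map_injective (by simp) }
  have hE : E ⋙ R = 𝟭 D := CategoryTheory.Functor.ext hs fun X Y f => R.map_preimage _
  refine ⟨hR, E, ?_, hE⟩
  have : (E ⋙ R).IsEquivalence := hE ▸ inferInstance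
  exact Functor.isEquivalence_of_comp_right E R

theorem restriction_universal (k : Type w) [CommRing k] (A : SMon.{w, v, u} k)
    (B : PiSMon.{w, v, u} k) : (restriction k A B).IsEquivalence ∧
      ∃ extension : (A ⟶ (forgetPi k).obj B) ⥤ ((piEnvelope k).obj A ⟶ B),
        extension.IsEquivalence ∧ extension ⋙ restriction k A B = 𝟭 _ := by
  have : (restriction k A B).Full :=
    ⟨fun y => ⟨PiEnv.natTransOfIncl y, PiEnv.whiskerLeft_natTransOfIncl y⟩⟩
  have : (restriction k A B).Faithful := ⟨fun {G H x x'} h =>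
    (PiEnv.natTransOfIncl_whiskerLeft x).symm.trans
      ((congrArg PiEnv.natTransOfIncl h).trans (PiEnv.natTransOfIncl_whiskerLeft x'))⟩
  exact exists_strict_section _ (fun F => PiEnv.extend F B.zeta_mem)
    (fun F => PiEnv.incl_comp_extend F B.zeta_mem)

end

section

open MonoidalSupercategory

/-! ### Extending even monoidal functors to superfunctors -/

open PiSMon

section

variable {k : Type w} [CommRing k] {C : Type u} [Category.{v} C] [Preadditive C] [Linear k C]
  [Supercategory k C] [MonoidalSupercategory k C]

variable (k) in
/-- The isomorphism `e ⊗ 1_W`. -/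
def tIsoId {X Y : C} (e : X ≅ Y) (W : C) : tObj k X W ≅ tObj k Y W where
  hom := tHom k e.hom (𝟙 W)
  inv := tHom k e.inv (𝟙 W)
  hom_inv_id := by rw [← tHom_comp_id, e.hom_inv_id, tHom_id]
  inv_hom_id := by rw [← tHom_comp_id, e.inv_hom_id, tHom_id]

variable (k) in
/-- The isomorphism `1_W ⊗ e`. -/
def idTIso {X Y : C} (W : C) (e : X ≅ Y) : tObj k W X ≅ tObj k W Y where
  hom := tHom k (𝟙 W) e.hom
  inv := tHom k (𝟙 W) e.inv
  hom_inv_id := by rw [← id_tHom_comp, e.hom_inv_id, tHom_id]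
  inv_hom_id := by rw [← id_tHom_comp, e.inv_hom_id, tHom_id]

theorem tHom_associator {X₁ Y₁ X₂ Y₂ X₃ Y₃ : C} (f₁ : X₁ ⟶ Y₁) (f₂ : X₂ ⟶ Y₂) (f₃ : X₃ ⟶ Y₃) :
    tHom k (tHom k f₁ f₂) f₃ ≫ (associator (k := k) Y₁ Y₂ Y₃).hom =
      (associator (k := k) X₁ X₂ X₃).hom ≫ tHom k f₁ (tHom k f₂ f₃) :=
  associator_naturality f₁ f₂ f₃

theorem tHom_eq_of_left_even {X Y X' Y' : C} {f : X ⟶ Y} (hf : HasParity k f 0) (g : X' ⟶ Y') :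
    tHom k f g = tHom k f (𝟙 X') ≫ tHom k (𝟙 Y) g := by
  rw [tHom_comp_left_even _ _ _ hf, Category.comp_id, Category.id_comp]

theorem tHom_eq_id_comp {X Y X' Y' : C} (f : X ⟶ Y) (g : X' ⟶ Y') :
    tHom k f g = tHom k (𝟙 X) g ≫ tHom k f (𝟙 Y') := by
  rw [tHom_comp_left_even _ _ _ (HasParity.id X), Category.comp_id, Category.id_comp]

theorem tHom_even_exchange {X Y X' Y' : C} {f : X ⟶ Y} (hf : HasParity k f 0) (g : X' ⟶ Y') :
    tHom k f (𝟙 X') ≫ tHom k (𝟙 Y) g = tHom k (𝟙 X) g ≫ tHom k f (𝟙 Y') := by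
  rw [← tHom_eq_of_left_even hf, tHom_eq_id_comp]

variable {P : C} {ζ : P ≅ (tensorUnit k : C)}

/-- Contracting two copies of `π` one after the other is contracting them by `ξ`, up to the sign in
`zL ζ P = -zR ζ P`. The same sign governs the composition of odd morphisms in `Superize`. -/
theorem zL_zL (hζ : HasParity k ζ.hom 1) (X : C) :
    (associator (k := k) P P X).hom ≫ (zL ζ (tObj k P X)).hom ≫ (zL ζ X).hom =
      -(tHom k (xiIso ζ).hom (𝟙 X) ≫ (leftUnitor (k := k) X).hom) := by
  rw [← Category.assoc, ← zL_tHom_id, zL_eq_neg_zR hζ, ← zR_zeta', tHom_comp_id,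
    show tHom k (-(zR ζ P).hom) (𝟙 X) = -tHom k (zR ζ P).hom (𝟙 X) from
      LinearMap.map_neg₂ _ _ _, Preadditive.neg_comp, Category.assoc]
  rfl

end

/-! ### Extending an even functor to odd morphisms. -/

section

variable {k : Type w} [CommRing k]
  {C : Type u} [Category.{v} C] [Preadditive C] [Linear k C] [Supercategory k C]
  [MonoidalSupercategory k C]
  {D : Type u'} [Category.{v'} D] [Preadditive D] [Linear k D] [Supercategory k D]
  [MonoidalSupercategory k D]
  {P : C} {Q : D}

/-- A monoidal `Π`-functor between the underlying categories of two monoidal `Π`-supercategories,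
given by its values on the even parts of all morphisms. -/
structure EvenFunctor (ζ : P ≅ (tensorUnit k : C)) (θ : Q ≅ (tensorUnit k : D)) where
  obj : C → D
  map : ∀ {X Y : C}, (X ⟶ Y) →ₗ[k] (obj X ⟶ obj Y)
  map_odd : ∀ {X Y : C} {f : X ⟶ Y}, HasParity k f 1 → map f = 0
  map_mem : ∀ {X Y : C} {f : X ⟶ Y}, HasParity k f 0 → HasParity k (map f) 0
  map_id : ∀ X : C, map (𝟙 X) = 𝟙 (obj X)
  map_comp : ∀ {X Y Z : C} {f : X ⟶ Y} {g : Y ⟶ Z}, HasParity k f 0 → HasParity k g 0 →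
    map (f ≫ g) = map f ≫ map g
  c : ∀ X Y : C, tObj k (obj X) (obj Y) ≅ obj (tObj k X Y)
  i : (tensorUnit k : D) ≅ obj (tensorUnit k)
  c_mem : ∀ X Y : C, HasParity k (c X Y).hom 0
  i_mem : HasParity k i.hom 0
  c_naturality : ∀ {X₁ Y₁ X₂ Y₂ : C} {f : X₁ ⟶ Y₁} {g : X₂ ⟶ Y₂}, HasParity k f 0 →
    HasParity k g 0 → tHom k (map f) (map g) ≫ (c Y₁ Y₂).hom = (c X₁ X₂).hom ≫ map (tHom k f g)
  associativity : ∀ X Y Z : C,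
    tHom k (c X Y).hom (𝟙 (obj Z)) ≫ (c (tObj k X Y) Z).hom ≫ map (associator (k := k) X Y Z).hom =
      (associator (k := k) (obj X) (obj Y) (obj Z)).hom ≫ tHom k (𝟙 (obj X)) (c Y Z).hom ≫
        (c X (tObj k Y Z)).hom
  left_unitality : ∀ X : C, (leftUnitor (k := k) (obj X)).hom =
    tHom k i.hom (𝟙 (obj X)) ≫ (c (tensorUnit k) X).hom ≫ map (leftUnitor (k := k) X).hom
  right_unitality : ∀ X : C, (rightUnitor (k := k) (obj X)).hom =
    tHom k (𝟙 (obj X)) i.hom ≫ (c X (tensorUnit k)).hom ≫ map (rightUnitor (k := k) X).hom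
  j : Q ≅ obj P
  j_mem : HasParity k j.hom 0
  j_braiding : ∀ X : C, tHom k j.hom (𝟙 (obj X)) ≫ (c P X).hom ≫ map (braid ζ X).hom =
    (braid θ (obj X)).hom ≫ tHom k (𝟙 (obj X)) j.hom ≫ (c X P).hom
  j_xi : (xiIso θ).hom ≫ i.hom = tHom k j.hom j.hom ≫ (c P P).hom ≫ map (xiIso ζ).hom

namespace EvenFunctor

variable {ζ : P ≅ (tensorUnit k : C)} {θ : Q ≅ (tensorUnit k : D)} (F : EvenFunctor ζ θ)

/-- The isomorphism `c ∘ (j ⊗ 1) : π ⊗ F X ≅ F (π ⊗ X)`. -/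
def jc (X : C) : tObj k Q (F.obj X) ≅ F.obj (tObj k P X) := tIsoId k F.j (F.obj X) ≪≫ F.c P X

theorem jc_hom (X : C) : (F.jc X).hom = tHom k F.j.hom (𝟙 (F.obj X)) ≫ (F.c P X).hom := rfl

theorem jc_mem (X : C) : HasParity k (F.jc X).hom 0 :=
  ((tensorHom_mem F.j_mem (HasParity.id _)).of_eq (zero_add 0)).comp_even (F.c_mem P X)

/-- The image `F (π ⊗ X) ≅ F X` of the odd isomorphism `π ⊗ X ≅ X`. -/
def z (X : C) : F.obj (tObj k P X) ≅ F.obj X := (F.jc X).symm ≪≫ zL θ (F.obj X)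

theorem jc_z (X : C) : (F.jc X).hom ≫ (F.z X).hom = (zL θ (F.obj X)).hom := by simp [z]

theorem jc_naturality {X Y : C} {f : X ⟶ Y} (hf : HasParity k f 0) :
    (F.jc X).hom ≫ F.map (tHom k (𝟙 P) f) = tHom k (𝟙 Q) (F.map f) ≫ (F.jc Y).hom := by
  have h := F.c_naturality (HasParity.id P) hf
  rw [F.map_id] at h
  rw [jc_hom, jc_hom, Category.assoc, ← h, reassoc_of% (tHom_even_exchange F.j_mem (F.map f))]

theorem z_naturality {X Y : C} {f : X ⟶ Y} (hf : HasParity k f 0) :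
    F.map (tHom k (𝟙 P) f) ≫ (F.z Y).hom = (F.z X).hom ≫ F.map f := by
  rw [← cancel_epi (F.jc X).hom, reassoc_of% (F.jc_z X), ← zL_naturality θ (F.map_mem hf),
    reassoc_of% (F.jc_naturality hf), jc_z]

/-- Moving two copies of `π` inside `F` one at a time, or together as `π ⊗ π`, is the same by
associativity of `F.c`. The second form is the one to which `j_xi` applies. -/
theorem jc_jc (X : C) : tHom k (𝟙 Q) (F.jc X).hom ≫ (F.jc (tObj k P X)).hom =
    (associator (k := k) Q Q (F.obj X)).inv ≫
      tHom k (tHom k F.j.hom F.j.hom ≫ (F.c P P).hom) (𝟙 (F.obj X)) ≫ (F.c (tObj k P P) X).hom ≫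
        F.map (associator (k := k) P P X).hom := by
  have h := tHom_associator (k := k) F.j.hom F.j.hom (𝟙 (F.obj X))
  rw [tHom_comp_id, Category.assoc, F.associativity, reassoc_of% h, Iso.inv_hom_id_assoc,
    tHom_eq_of_left_even F.j_mem, Category.assoc, jc_hom, jc_hom, id_tHom_comp, Category.assoc,
    ← reassoc_of% (tHom_even_exchange F.j_mem (F.c P X).hom),
    ← reassoc_of% (tHom_even_exchange F.j_mem (tHom k F.j.hom (𝟙 (F.obj X))))]

variable (hζ : HasParity k ζ.hom 1) (hθ : HasParity k θ.hom 1)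

include hζ hθ in
-- By `zL_zL` the composite of two odd contractions is `-ξ ⊗ 1` followed by the left unitor, an even
-- map on which `F` is already defined; `j_xi` carries `ξ` in the source to `ξ` in the target. This
-- is multiplicativity for the basic pair of odd maps.
theorem map_zL_zL (X : C) : F.map ((zL ζ (tObj k P X)).hom ≫ (zL ζ X).hom) =
    (F.z (tObj k P X)).hom ≫ (F.z X).hom := by
  have e1 : (zL ζ (tObj k P X)).hom ≫ (zL ζ X).hom = (associator (k := k) P P X).inv ≫
      (-(tHom k (xiIso ζ).hom (𝟙 X) ≫ (leftUnitor (k := k) X).hom)) := by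
    rw [← zL_zL hζ, Iso.inv_hom_id_assoc]
  have m1 : HasParity k (tHom k (xiIso ζ).hom (𝟙 X)) 0 :=
    (tensorHom_mem (xiIso_mem hζ) (HasParity.id X)).of_eq (zero_add 0)
  have m2 := m1.comp_even (leftUnitor_mem X)
  have m3 : HasParity k (-(tHom k (xiIso ζ).hom (𝟙 X) ≫ (leftUnitor (k := k) X).hom)) 0 :=
    neg_mem (S := Submodule k _) m2
  have h := F.c_naturality (xiIso_mem hζ) (HasParity.id X)
  rw [F.map_id] at h
  have e2 : F.map (associator (k := k) P P X).hom ≫ F.map (associator (k := k) P P X).inv =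
      𝟙 _ := by
    rw [← F.map_comp (associator_mem _ _ _) (associator_mem _ _ _).inv, Iso.hom_inv_id, F.map_id]
  have e3 := zL_naturality θ (F.jc_mem X)
  have e5 : tHom k (tHom k F.j.hom F.j.hom ≫ (F.c P P).hom) (𝟙 (F.obj X)) ≫
      (F.c (tObj k P P) X).hom ≫ F.map (tHom k (xiIso ζ).hom (𝟙 X)) ≫
        F.map (leftUnitor (k := k) X).hom =
      tHom k (xiIso θ).hom (𝟙 (F.obj X)) ≫ (leftUnitor (k := k) (F.obj X)).hom := by
    rw [← reassoc_of% h, ← Category.assoc (tHom k _ _) (tHom k _ _), ← tHom_comp_id,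
      Category.assoc, ← F.j_xi, tHom_comp_id, Category.assoc, ← F.left_unitality]
  rw [← cancel_epi (idTIso k Q (F.jc X) ≪≫ F.jc (tObj k P X)).hom]
  change (tHom k (𝟙 Q) (F.jc X).hom ≫ (F.jc (tObj k P X)).hom) ≫ _ =
    (tHom k (𝟙 Q) (F.jc X).hom ≫ (F.jc (tObj k P X)).hom) ≫ _
  -- After moving both copies of `π` out of `F`, each side becomes the double contraction in the
  -- target.
  trans (zL θ (tObj k Q (F.obj X))).hom ≫ (zL θ (F.obj X)).hom
  · rw [jc_jc, e1, F.map_comp (associator_mem _ _ _).inv m3, map_neg, F.map_comp m1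
      (leftUnitor_mem X)]
    simp only [Category.assoc]
    rw [reassoc_of% e2, Preadditive.comp_neg, Preadditive.comp_neg, Preadditive.comp_neg, e5,
      ← Preadditive.comp_neg, ← zL_zL hθ, Iso.inv_hom_id_assoc]
  · rw [Category.assoc, reassoc_of% (F.jc_z (tObj k P X)), reassoc_of% e3, jc_z]

/-- The extension of `F` to all morphisms. -/
def extMap {X Y : C} (f : X ⟶ Y) : F.obj X ⟶ F.obj Y :=
  -- As `F.map` kills odd morphisms, the first term sees only the even part of `f`. The second sees
  -- only its odd part `f₁`, because `zL ≫ f₁` is even while `zL` followed by the even part is odd;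
  -- `z` is the intended image of `zL`.
  F.map f + (F.z X).inv ≫ F.map ((zL ζ X).hom ≫ f)

theorem z_mem (hθ : HasParity k θ.hom 1) (X : C) : HasParity k (F.z X).hom 1 :=
  (F.jc_mem X).inv.even_comp (zL_mem hθ (F.obj X))

theorem extMap_add {X Y : C} (f g : X ⟶ Y) : F.extMap (f + g) = F.extMap f + F.extMap g := by
  simp only [extMap, map_add, Preadditive.comp_add]
  abel

theorem extMap_smul {X Y : C} (r : k) (f : X ⟶ Y) : F.extMap (r • f) = r • F.extMap f := by
  simp only [extMap, map_smul, Linear.comp_smul, smul_add]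

section

include hζ

theorem extMap_even {X Y : C} {f : X ⟶ Y} (hf : HasParity k f 0) : F.extMap f = F.map f := by
  rw [extMap, F.map_odd ((zL_mem hζ X).comp_even hf), Limits.comp_zero, add_zero]

omit hζ in
theorem z_extMap_odd {X Y : C} {f : X ⟶ Y} (hf : HasParity k f 1) :
    (F.z X).hom ≫ F.extMap f = F.map ((zL ζ X).hom ≫ f) := by
  rw [extMap, F.map_odd hf, zero_add, Iso.hom_inv_id_assoc]

theorem zL_odd_mem {X Y : C} {f : X ⟶ Y} (hf : HasParity k f 1) :
    HasParity k ((zL ζ X).hom ≫ f) 0 := ((zL_mem hζ X).comp hf).of_eq (by decide)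

include hθ in
theorem extMap_mem {X Y : C} {f : X ⟶ Y} {p : ZMod 2} (hf : HasParity k f p) :
    HasParity k (F.extMap f) p := by
  obtain rfl | rfl : p = 0 ∨ p = 1 := (by decide : ∀ p : ZMod 2, p = 0 ∨ p = 1) p
  · rw [F.extMap_even hζ hf]
    exact F.map_mem hf
  · rw [extMap, F.map_odd hf, zero_add]
    exact ((F.z_mem hθ X).inv.comp (F.map_mem (zL_odd_mem hζ hf))).of_eq (by decide)

include hθ in
-- Bilinearity leaves four parity cases. Precomposition with one `z` for each odd factor makes
-- everything even; even followed by odd needs naturality of `z` and `zL`, and only odd followed by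
-- odd needs `ξ`, through `map_zL_zL`.
theorem extMap_comp {X Y Z : C} (f : X ⟶ Y) (g : Y ⟶ Z) :
    F.extMap (f ≫ g) = F.extMap f ≫ F.extMap g := by
  obtain ⟨f₀, f₁, hf₀, hf₁, rfl⟩ := exists_decomp k f
  obtain ⟨g₀, g₁, hg₀, hg₁, rfl⟩ := exists_decomp k g
  have e00 : F.extMap (f₀ ≫ g₀) = F.extMap f₀ ≫ F.extMap g₀ := by
    rw [F.extMap_even hζ hf₀, F.extMap_even hζ hg₀, F.extMap_even hζ (hf₀.comp_even hg₀),
      F.map_comp hf₀ hg₀]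
  have e10 : F.extMap (f₁ ≫ g₀) = F.extMap f₁ ≫ F.extMap g₀ := by
    rw [← cancel_epi (F.z X).hom, F.z_extMap_odd (hf₁.comp_even hg₀),
      reassoc_of% (F.z_extMap_odd hf₁), F.extMap_even hζ hg₀,
      ← F.map_comp (zL_odd_mem hζ hf₁) hg₀, Category.assoc]
  have e01 : F.extMap (f₀ ≫ g₁) = F.extMap f₀ ≫ F.extMap g₁ := by
    rw [← cancel_epi (F.z X).hom, F.z_extMap_odd (hf₀.even_comp hg₁), F.extMap_even hζ hf₀,
      ← reassoc_of% (F.z_naturality hf₀), F.z_extMap_odd hg₁, ← F.map_comp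
      ((tensorHom_mem (HasParity.id P) hf₀).of_eq (zero_add 0)) (zL_odd_mem hζ hg₁),
      reassoc_of% (zL_naturality ζ hf₀)]
  have e11 : F.extMap (f₁ ≫ g₁) = F.extMap f₁ ≫ F.extMap g₁ := by
    have m := zL_odd_mem hζ hf₁
    have m' : HasParity k ((zL ζ (tObj k P X)).hom ≫ (zL ζ X).hom) 0 :=
      zL_odd_mem hζ (zL_mem hζ X)
    have m'' : HasParity k (f₁ ≫ g₁) 0 := (hf₁.comp hg₁).of_eq (by decide)
    rw [← cancel_epi (F.z X).hom, ← cancel_epi (F.z (tObj k P X)).hom,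
      reassoc_of% (F.z_extMap_odd hf₁), ← reassoc_of% (F.z_naturality m),
      F.z_extMap_odd hg₁, ← F.map_comp ((tensorHom_mem (HasParity.id P) m).of_eq (zero_add 0))
      (zL_odd_mem hζ hg₁), reassoc_of% (zL_naturality ζ m), F.extMap_even hζ m'',
      ← reassoc_of% (F.map_zL_zL hζ hθ X), ← F.map_comp m' m'', Category.assoc]
  simp only [extMap_add, Preadditive.add_comp, Preadditive.comp_add, e00, e01, e10, e11]

include hθ in
theorem extMap_zL (X : C) : F.extMap (zL ζ X).hom = (F.z X).hom := by
  rw [← cancel_epi (F.z (tObj k P X)).hom, F.z_extMap_odd (zL_mem hζ X), F.map_zL_zL hζ hθ]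

theorem extMap_id (X : C) : F.extMap (𝟙 X) = 𝟙 (F.obj X) := by
  rw [F.extMap_even hζ (HasParity.id X), F.map_id]

include hθ in
-- Here compatibility with `β` enters: `zR` is the inverse of the even braiding followed by `zL`,
-- and `j_braiding` says how `F` treats that braiding.
theorem extMap_zR (X : C) : tHom k (𝟙 (F.obj X)) F.j.hom ≫ (F.c X P).hom ≫
    F.extMap (zR ζ X).hom = (zR θ (F.obj X)).hom := by
  have h := F.j_braiding X
  have e : (zR ζ X).hom = (braid ζ X).inv ≫ (zL ζ X).hom := by rw [← braid_zR, Iso.inv_hom_id_assoc]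
  have e' : F.map (braid ζ X).hom ≫ F.map (braid ζ X).inv = 𝟙 _ := by
    rw [← F.map_comp (braid_mem hζ X) (braid_mem hζ X).inv, Iso.hom_inv_id, F.map_id]
  rw [← cancel_epi (braid θ (F.obj X)).hom, ← reassoc_of% h, braid_zR, e, F.extMap_comp hζ hθ,
    F.extMap_zL hζ hθ, F.extMap_even hζ (braid_mem hζ X).inv, reassoc_of% e', ← F.jc_z, jc_hom,
    Category.assoc]

/-- The condition `hz` fixes `M` on `zL`, and an odd morphism is the inverse of `zL` followed by an
even one. This gives faithfulness. -/
theorem extMap_unique (M : ∀ {X Y : C}, (X ⟶ Y) → (F.obj X ⟶ F.obj Y))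
    (hadd : ∀ {X Y : C} (f g : X ⟶ Y), M (f + g) = M f + M g)
    (hcomp : ∀ {X Y Z : C} (f : X ⟶ Y) (g : Y ⟶ Z), M (f ≫ g) = M f ≫ M g)
    (heven : ∀ {X Y : C} {f : X ⟶ Y}, HasParity k f 0 → F.map f = M f)
    (hz : ∀ X : C, (F.jc X).hom ≫ M (zL ζ X).hom = (zL θ (F.obj X)).hom) {X Y : C} (f : X ⟶ Y) :
    F.extMap f = M f := by
  have hz' : (F.z X).hom = M (zL ζ X).hom := by rw [← cancel_epi (F.jc X).hom, jc_z, hz]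
  obtain ⟨f₀, f₁, hf₀, hf₁, rfl⟩ := exists_decomp k f
  have h₁ : F.extMap f₁ = M f₁ := by
    rw [← cancel_epi (F.z X).hom, F.z_extMap_odd hf₁, heven (zL_odd_mem hζ hf₁), hcomp, hz']
  rw [extMap_add, F.extMap_even hζ hf₀, h₁, heven hf₀, hadd]

/-! ### Naturality of the coherence maps at odd morphisms. -/

/-- The compatibility of `c` with a pair of morphisms. -/
def CNat {X₁ Y₁ X₂ Y₂ : C} (f : X₁ ⟶ Y₁) (g : X₂ ⟶ Y₂) : Prop :=
  tHom k (F.extMap f) (F.extMap g) ≫ (F.c Y₁ Y₂).hom =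
    (F.c X₁ X₂).hom ≫ F.extMap (tHom k f g)

theorem cNat_even {X₁ Y₁ X₂ Y₂ : C} {f : X₁ ⟶ Y₁} {g : X₂ ⟶ Y₂} (hf : HasParity k f 0)
    (hg : HasParity k g 0) : F.CNat f g := by
  rw [CNat, F.extMap_even hζ hf, F.extMap_even hζ hg,
    F.extMap_even hζ ((tensorHom_mem hf hg).of_eq (zero_add 0)), F.c_naturality hf hg]

include hθ

/-- With an identity in one slot, the morphisms satisfying `CNat` are closed under composition and
inverses. They include the even ones, so checking `zL` suffices. -/
theorem CNat.comp_id {F : EvenFunctor ζ θ} {X Y Z W : C} {f : X ⟶ Y} {g : Y ⟶ Z}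
    (hf : F.CNat f (𝟙 W)) (hg : F.CNat g (𝟙 W)) : F.CNat (f ≫ g) (𝟙 W) := by
  rw [CNat, F.extMap_id hζ] at *
  rw [F.extMap_comp hζ hθ, tHom_comp_id, Category.assoc, hg, reassoc_of% hf, tHom_comp_id,
    F.extMap_comp hζ hθ]

theorem CNat.id_comp {F : EvenFunctor ζ θ} {X Y Z W : C} {f : X ⟶ Y} {g : Y ⟶ Z}
    (hf : F.CNat (𝟙 W) f) (hg : F.CNat (𝟙 W) g) : F.CNat (𝟙 W) (f ≫ g) := by
  rw [CNat, F.extMap_id hζ] at *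
  rw [F.extMap_comp hζ hθ, id_tHom_comp, Category.assoc, hg, reassoc_of% hf, id_tHom_comp,
    F.extMap_comp hζ hθ]

theorem extMap_hom_inv {X Y : C} (e : X ≅ Y) : F.extMap e.hom ≫ F.extMap e.inv = 𝟙 _ := by
  rw [← F.extMap_comp hζ hθ, e.hom_inv_id, F.extMap_id hζ]

theorem extMap_inv_hom {X Y : C} (e : X ≅ Y) : F.extMap e.inv ≫ F.extMap e.hom = 𝟙 _ := by
  rw [← F.extMap_comp hζ hθ, e.inv_hom_id, F.extMap_id hζ]

theorem CNat.inv_id {F : EvenFunctor ζ θ} {X Y W : C} {e : X ≅ Y} (h : F.CNat e.hom (𝟙 W)) :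
    F.CNat e.inv (𝟙 W) := by
  rw [CNat, F.extMap_id hζ] at *
  have e1 := F.extMap_hom_inv hζ hθ (tIsoId k e W)
  have e2 : F.extMap e.inv ≫ F.extMap e.hom = 𝟙 _ := F.extMap_inv_hom hζ hθ e
  calc _ = tHom k (F.extMap e.inv) (𝟙 _) ≫ (F.c X W).hom ≫
        F.extMap (tHom k e.hom (𝟙 W)) ≫ F.extMap (tHom k e.inv (𝟙 W)) := by
        refine congrArg (fun t => _ ≫ t) ?_
        exact ((congrArg (fun t => _ ≫ t) e1).trans (Category.comp_id _)).symm
    _ = _ := by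
        rw [← reassoc_of% h, ← Category.assoc, ← tHom_comp_id, e2, tHom_id, Category.id_comp]

theorem CNat.id_inv {F : EvenFunctor ζ θ} {X Y W : C} {e : X ≅ Y} (h : F.CNat (𝟙 W) e.hom) :
    F.CNat (𝟙 W) e.inv := by
  rw [CNat, F.extMap_id hζ] at *
  have e1 := F.extMap_hom_inv hζ hθ (idTIso k W e)
  have e2 : F.extMap e.inv ≫ F.extMap e.hom = 𝟙 _ := F.extMap_inv_hom hζ hθ e
  calc _ = tHom k (𝟙 _) (F.extMap e.inv) ≫ (F.c W X).hom ≫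
        F.extMap (tHom k (𝟙 W) e.hom) ≫ F.extMap (tHom k (𝟙 W) e.inv) := by
        refine congrArg (fun t => _ ≫ t) ?_
        exact ((congrArg (fun t => _ ≫ t) e1).trans (Category.comp_id _)).symm
    _ = _ := by
        rw [← reassoc_of% h, ← Category.assoc, ← id_tHom_comp, e2, tHom_id, Category.id_comp]

/-- Since `zL ζ X ⊗ 1_Y` is the associator followed by `zL ζ (X ⊗ Y)`, the claim follows from
associativity of `F.c` at `P`, `X`, `Y`. -/
theorem cNat_zL_id (X Y : C) : F.CNat (zL ζ X).hom (𝟙 Y) := by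
  rw [CNat, F.extMap_id hζ, F.extMap_zL hζ hθ, zL_tHom_id, F.extMap_comp hζ hθ,
    F.extMap_even hζ (associator_mem _ _ _), F.extMap_zL hζ hθ]
  have h1 := tHom_associator (k := k) F.j.hom (𝟙 (F.obj X)) (𝟙 (F.obj Y))
  rw [tHom_id] at h1
  have h2 := zL_naturality θ (F.c_mem X Y)
  rw [← cancel_epi (tIsoId k (F.jc X) (F.obj Y)).hom]
  change tHom k (F.jc X).hom (𝟙 _) ≫ _ = tHom k (F.jc X).hom (𝟙 _) ≫ _
  rw [← Category.assoc, ← tHom_comp_id, jc_z, zL_tHom_id, Category.assoc, ← h2, jc_hom,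
    tHom_comp_id, Category.assoc, reassoc_of% (F.associativity P X Y), reassoc_of% h1,
    reassoc_of% (tHom_even_exchange F.j_mem (F.c X Y).hom), ← jc_z, jc_hom, Category.assoc]

theorem cNat_zR_id (X Y : C) : F.CNat (zR ζ X).hom (𝟙 Y) := by
  have e : (zR ζ X).hom = (braid ζ X).inv ≫ (zL ζ X).hom := by rw [← braid_zR, Iso.inv_hom_id_assoc]
  rw [e]
  exact CNat.comp_id hζ hθ (F.cNat_even hζ (braid_mem hζ X).inv (HasParity.id Y))
    (F.cNat_zL_id hζ hθ X Y)

/-- The triangle axiom makes `zR ζ X ⊗ 1_Y` the associator followed by `1_X ⊗ zL ζ Y`. The result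
for the first slot, applied to `zR`, thus transfers to the second slot. -/
theorem cNat_id_zL (X Y : C) : F.CNat (𝟙 X) (zL ζ Y).hom := by
  have h := F.cNat_zR_id hζ hθ X Y
  have h1 := tHom_associator (k := k) (𝟙 (F.obj X)) F.j.hom (𝟙 (F.obj Y))
  have h2 := F.extMap_zR hζ hθ X
  have h3 := F.associativity X P Y
  rw [CNat, F.extMap_id hζ] at *
  rw [zR_tHom_id, F.extMap_comp hζ hθ, F.extMap_even hζ (associator_mem _ _ _)] at h
  rw [F.extMap_zL hζ hθ, ← cancel_epi (idTIso k (F.obj X) (F.jc Y)).hom,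
    ← cancel_epi (associator (k := k) (F.obj X) Q (F.obj Y)).hom]
  change _ ≫ tHom k (𝟙 _) (F.jc Y).hom ≫ _ = _ ≫ tHom k (𝟙 _) (F.jc Y).hom ≫ _
  rw [← Category.assoc (tHom k _ _), ← id_tHom_comp, jc_z, ← Category.assoc, ← zR_tHom_id, ← h2,
    jc_hom, id_tHom_comp, Category.assoc, ← reassoc_of% h1, ← reassoc_of% h3, ← h, tHom_comp_id,
    tHom_comp_id]
  simp only [Category.assoc]

theorem cNat_id {X Y : C} (f : X ⟶ Y) (W : C) : F.CNat f (𝟙 W) := by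
  obtain ⟨f₀, f₁, hf₀, hf₁, rfl⟩ := exists_decomp k f
  have h₀ : F.CNat f₀ (𝟙 W) := F.cNat_even hζ hf₀ (HasParity.id W)
  have h₁ : F.CNat f₁ (𝟙 W) := by
    have h := CNat.comp_id hζ hθ (CNat.inv_id hζ hθ (F.cNat_zL_id hζ hθ X W))
      (F.cNat_even hζ (zL_odd_mem hζ hf₁) (HasParity.id W))
    rwa [Iso.inv_hom_id_assoc] at h
  rw [CNat] at *
  simp only [extMap_add, add_tHom, Preadditive.add_comp, Preadditive.comp_add, h₀, h₁]

theorem id_cNat (W : C) {X Y : C} (f : X ⟶ Y) : F.CNat (𝟙 W) f := by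
  obtain ⟨f₀, f₁, hf₀, hf₁, rfl⟩ := exists_decomp k f
  have h₀ : F.CNat (𝟙 W) f₀ := F.cNat_even hζ (HasParity.id W) hf₀
  have h₁ : F.CNat (𝟙 W) f₁ := by
    have h := CNat.id_comp hζ hθ (CNat.id_inv hζ hθ (F.cNat_id_zL hζ hθ W X))
      (F.cNat_even hζ (HasParity.id W) (zL_odd_mem hζ hf₁))
    rwa [Iso.inv_hom_id_assoc] at h
  rw [CNat] at *
  simp only [extMap_add, tHom_add, Preadditive.add_comp, Preadditive.comp_add, h₀, h₁]

/-- The tensor product is `1 ⊗ g` followed by `f ⊗ 1`, an order of factors that costs no sign in any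
parity. -/
theorem cNat {X₁ Y₁ X₂ Y₂ : C} (f : X₁ ⟶ Y₁) (g : X₂ ⟶ Y₂) : F.CNat f g := by
  have h1 := F.cNat_id hζ hθ f Y₂
  have h2 := F.id_cNat hζ hθ X₁ g
  rw [CNat, F.extMap_id hζ] at h1 h2
  rw [CNat, tHom_eq_id_comp, Category.assoc, h1, reassoc_of% h2, tHom_eq_id_comp f g,
    F.extMap_comp hζ hθ]

end

/-- The monoidal superfunctor extending `F`. -/
def toSuperfunctor : MonoidalSuperfunctor k C D where
  obj := F.obj
  map f := F.extMap f
  map_id X := F.extMap_id hζ X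
  map_comp f g := F.extMap_comp hζ hθ f g
  map_add f g := F.extMap_add f g
  map_smul r f := F.extMap_smul r f
  map_mem h := F.extMap_mem hζ hθ h
  c := F.c
  i := F.i
  c_mem := F.c_mem
  i_mem := F.i_mem
  c_naturality f g := F.cNat hζ hθ f g
  associativity X Y Z := by
    rw [F.extMap_even hζ (associator_mem _ _ _), F.associativity]
  left_unitality X := by rw [F.extMap_even hζ (leftUnitor_mem _), F.left_unitality]
  right_unitality X := by rw [F.extMap_even hζ (rightUnitor_mem _), F.right_unitality]

/-- The `j` attached to a superfunctor is characterized by `j ≫ F ζ = θ ≫ i`. Precomposed with `zR`,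
the odd isomorphisms at the end become `ξ`, and the equation becomes `j_xi`. -/
theorem jIso_toSuperfunctor : ((F.toSuperfunctor hζ hθ).jIso ζ θ).hom = F.j.hom := by
  have h1 := F.extMap_zR hζ hθ P
  have h2 := F.j_xi
  have h3 := zR_naturality θ F.j_mem
  have key : F.j.hom ≫ F.extMap ζ.hom = θ.hom ≫ F.i.hom := by
    rw [← cancel_epi (zR θ Q).hom, ← reassoc_of% h3, ← h1, ← Category.assoc (zR θ Q).hom,
      zR_zeta', h2, tHom_eq_of_left_even F.j_mem F.j.hom, ← F.extMap_even hζ (xiIso_mem hζ),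
        ← zR_zeta',
      F.extMap_comp hζ hθ]
    simp only [Category.assoc]
  have h := (F.toSuperfunctor hζ hθ).jIso_hom_map ζ θ
  exact (cancel_mono ((F.toSuperfunctor hζ hθ).mapIso ζ).hom).1 (h.trans key.symm)

end EvenFunctor

end

/-! ### Full faithfulness on monoidal superfunctors. -/

section

variable {k : Type w} [CommRing k] {C : Type u} [Category.{v} C] [Preadditive C] [Linear k C]
  [Supercategory k C]

variable (k) in
/-- The even part of a morphism. -/
def evenPart (X Y : C) : (X ⟶ Y) →ₗ[k] ((⟨X⟩ : Underlying k C) ⟶ (⟨Y⟩ : Underlying k C)) :=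
  Submodule.projectionOnto _ _ (Supercategory.isCompl (k := k) X Y)

theorem evenPart_even {X Y : C} {f : X ⟶ Y} (hf : HasParity k f 0) :
    evenPart k X Y f = Underlying.mkHom f hf :=
  Submodule.projectionOnto_apply_left _ ⟨f, hf⟩

theorem evenPart_odd {X Y : C} {f : X ⟶ Y} (hf : HasParity k f 1) : evenPart k X Y f = 0 :=
  (Submodule.projectionOnto_apply_eq_zero_iff _).2 hf

/-- The isomorphism of the supercategory given by an isomorphism of the underlying category. -/
def Underlying.toIso {X Y : Underlying k C} (e : X ≅ Y) : X.of ≅ Y.of where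
  hom := e.hom.1
  inv := e.inv.1
  hom_inv_id := congrArg Subtype.val e.hom_inv_id
  inv_hom_id := congrArg Subtype.val e.inv_hom_id

end

section

variable {k : Type w} [CommRing k] {A B : PiSMon.{w, v, u} k}
  (Φ : PiMonFunctor A.toPiMon B.toPiMon)

/-- The action of `Φ` on the even parts of morphisms. -/
def PiMonFunctor.evenMap {X Y : A.carrier} :
    (X ⟶ Y) →ₗ[k] ((Φ.functor.obj ⟨X⟩).of ⟶ (Φ.functor.obj ⟨Y⟩).of) where
  toFun f := (Φ.functor.map (evenPart k X Y f)).1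
  map_add' f g := congrArg Subtype.val
    ((congrArg Φ.functor.map (map_add (evenPart k X Y) f g)).trans Φ.functor.map_add)
  map_smul' r f := congrArg Subtype.val
    ((congrArg Φ.functor.map (map_smul (evenPart k X Y) r f)).trans (Φ.functor.map_smul r _))

theorem PiMonFunctor.evenMap_even {X Y : A.carrier} {f : X ⟶ Y} (hf : HasParity k f 0) :
    Φ.evenMap f = (Φ.functor.map (Underlying.mkHom f hf)).1 :=
  congrArg (fun t => (Φ.functor.map t).1) (evenPart_even hf)

open Functor.LaxMonoidal in
/-- A monoidal `Π`-functor between underlying categories, as an `EvenFunctor`. -/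
def PiMonFunctor.toEvenFunctor : EvenFunctor A.zeta B.zeta where
  obj X := (Φ.functor.obj ⟨X⟩).of
  map := Φ.evenMap
  map_odd {X Y f} hf := by
    exact congrArg Subtype.val ((congrArg Φ.functor.map (evenPart_odd hf)).trans
      (Φ.functor.map_zero _ _))
  map_mem {X Y f} hf := (Φ.functor.map (evenPart k X Y f)).2
  map_id X := by
    rw [Φ.evenMap_even (HasParity.id X)]
    exact congrArg Subtype.val (Φ.functor.map_id ⟨X⟩)
  map_comp {X Y Z f g} hf hg := by
    rw [Φ.evenMap_even hf, Φ.evenMap_even hg, Φ.evenMap_even (hf.comp_even hg)]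
    exact congrArg Subtype.val (Φ.functor.map_comp (Underlying.mkHom f hf) (Underlying.mkHom g hg))
  c X Y := Underlying.toIso (Functor.Monoidal.μIso Φ.functor ⟨X⟩ ⟨Y⟩)
  i := Underlying.toIso (Functor.Monoidal.εIso Φ.functor)
  c_mem X Y := (μ Φ.functor ⟨X⟩ ⟨Y⟩).2
  i_mem := (ε Φ.functor).2
  c_naturality {X₁ Y₁ X₂ Y₂ f g} hf hg := by
    rw [Φ.evenMap_even hf, Φ.evenMap_even hg,
      Φ.evenMap_even ((tensorHom_mem hf hg).of_eq (zero_add 0))]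
    exact congrArg Subtype.val
      (Functor.LaxMonoidal.μ_natural Φ.functor (Underlying.mkHom f hf) (Underlying.mkHom g hg))
  associativity X Y Z := by
    rw [Φ.evenMap_even (associator_mem X Y Z)]
    exact congrArg Subtype.val (Functor.LaxMonoidal.associativity Φ.functor ⟨X⟩ ⟨Y⟩ ⟨Z⟩)
  left_unitality X := by
    rw [Φ.evenMap_even (leftUnitor_mem X)]
    exact congrArg Subtype.val (Functor.LaxMonoidal.left_unitality Φ.functor ⟨X⟩)
  right_unitality X := by
    rw [Φ.evenMap_even (rightUnitor_mem X)]
    exact congrArg Subtype.val (Functor.LaxMonoidal.right_unitality Φ.functor ⟨X⟩)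
  j := Underlying.toIso Φ.j
  j_mem := Φ.j.hom.2
  j_braiding X := by
    rw [Φ.evenMap_even (braid_mem A.zeta_mem X)]
    exact congrArg Subtype.val (Φ.j_braiding ⟨X⟩)
  j_xi := by
    rw [Φ.evenMap_even (xiIso_mem A.zeta_mem)]
    exact congrArg Subtype.val Φ.j_xi

/-- The monoidal superfunctor extending a monoidal `Π`-functor between underlying categories. -/
def PiMonFunctor.toSuperfunctor : MonoidalSuperfunctor k A.carrier B.carrier :=
  Φ.toEvenFunctor.toSuperfunctor A.zeta_mem B.zeta_mem

theorem toPiMonFunctor_toSuperfunctor :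
    toPiMonFunctor k (A := A) (B := B) Φ.toSuperfunctor = Φ := by
  refine PiMonFunctor.ext' (CategoryTheory.Functor.ext (fun X => rfl) fun X Y f => ?_)
    (heq_of_eq ?_) (fun X Y => heq_of_eq ?_) (heq_of_eq ?_)
  · refine Eq.trans ?_ ((Category.id_comp _).trans (Category.comp_id _)).symm
    exact Underlying.hom_ext ((Φ.toEvenFunctor.extMap_even A.zeta_mem f.2).trans
      (Φ.evenMap_even f.2))
  · rfl
  · rfl
  · exact Underlying.hom_ext (Φ.toEvenFunctor.jIso_toSuperfunctor A.zeta_mem B.zeta_mem)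

/-- By `j_zL`, the action of `F` on `zL` is the one prescribed by its own `j`, so `extMap_unique`
identifies `F` with the extension of its restriction. -/
theorem toSuperfunctor_toPiMonFunctor (F : MonoidalSuperfunctor k A.carrier B.carrier) :
    (toPiMonFunctor k (A := A) (B := B) F).toSuperfunctor = F := by
  let E := (toPiMonFunctor k (A := A) (B := B) F).toEvenFunctor
  have hext {X Y : A.carrier} (f : X ⟶ Y) : E.extMap f = F.map f :=
    E.extMap_unique A.zeta_mem (fun f => F.map f) F.map_add F.map_comp
      (fun hf => PiMonFunctor.evenMap_even (toPiMonFunctor k (A := A) (B := B) F) hf)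
      (fun X => (Category.assoc _ _ _).trans (F.j_zL A.zeta B.zeta X)) f
  refine MonoidalSuperfunctor.ext' (CategoryTheory.Functor.ext (fun X => rfl) fun X Y f => ?_)
    (fun X Y => heq_of_eq ?_) (heq_of_eq ?_)
  · refine Eq.trans ?_ ((Category.id_comp _).trans (Category.comp_id _)).symm
    exact hext f
  · rfl
  · rfl

end

instance underlying_full (k : Type w) [CommRing k] : (underlying.{w, v, u} k).Full :=
  ⟨fun Φ => ⟨PiMonFunctor.toSuperfunctor Φ, toPiMonFunctor_toSuperfunctor Φ⟩⟩

instance underlying_faithful (k : Type w) [CommRing k] : (underlying.{w, v, u} k).Faithful :=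
  ⟨fun {A B F G} h => (toSuperfunctor_toPiMonFunctor (A := A) (B := B) F).symm.trans
    ((congrArg PiMonFunctor.toSuperfunctor h).trans (toSuperfunctor_toPiMonFunctor G))⟩

end

/-! ### Coherence for an object of the Drinfeld center -/

section

open MonoidalCategory

variable {C : Type u} [Category.{v} C] [MonoidalCategory C] {P : C} (b : HalfBraiding P)

/-- The half-braiding with the second factor: `P ⊗ (X ⊗ Y) ⟶ X ⊗ (P ⊗ Y)`. -/
def slide (X Y : C) : P ⊗ (X ⊗ Y) ⟶ X ⊗ (P ⊗ Y) :=
  (α_ P X Y).inv ≫ (b.β X).hom ▷ Y ≫ (α_ X P Y).hom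

theorem slide_naturality_left {X X' : C} (f : X ⟶ X') (Y : C) :
    P ◁ (f ▷ Y) ≫ slide b X' Y = slide b X Y ≫ f ▷ (P ⊗ Y) := by
  simp only [slide, Category.assoc]
  rw [associator_inv_naturality_middle_assoc, ← comp_whiskerRight_assoc, b.naturality,
    comp_whiskerRight_assoc, associator_naturality_left]

theorem slide_naturality_right (X : C) {Y Y' : C} (f : Y ⟶ Y') :
    P ◁ (X ◁ f) ≫ slide b X Y' = slide b X Y ≫ X ◁ (P ◁ f) := by
  simp only [slide, Category.assoc]
  rw [associator_inv_naturality_right_assoc, whisker_exchange_assoc, associator_naturality_right]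

theorem slide_tensor (X Y Z : C) : slide b (X ⊗ Y) Z ≫ (α_ X Y (P ⊗ Z)).hom =
    P ◁ (α_ X Y Z).hom ≫ slide b X (Y ⊗ Z) ≫ X ◁ slide b Y Z := by
  simp only [slide, b.monoidal]
  monoidal

theorem slide_whiskerRight (X Y Z : C) : (α_ P (X ⊗ Y) Z).inv ≫ slide b X Y ▷ Z ≫
    (α_ X (P ⊗ Y) Z).hom = P ◁ (α_ X Y Z).hom ≫ slide b X (Y ⊗ Z) ≫ X ◁ (α_ P Y Z).inv := by
  simp only [slide]
  monoidal

/-- Naturality along `λ_ (𝟙_ C)` compares `β` at `𝟙 ⊗ 𝟙` with `β` at `𝟙`; monoidality splits the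
former into two copies of the latter. Cancelling one invertible copy leaves the formula whiskered by
the unit. -/
theorem braid_unit : (b.β (𝟙_ C)).hom = (ρ_ P).hom ≫ (λ_ P).inv := by
  have h := b.monoidal (𝟙_ C) (𝟙_ C)
  have n := b.naturality (λ_ (𝟙_ C)).hom
  have e : (α_ P (𝟙_ C) (𝟙_ C)).inv ≫ (b.β (𝟙_ C)).hom ▷ 𝟙_ C ≫ (α_ (𝟙_ C) P (𝟙_ C)).hom ≫
      𝟙_ C ◁ (b.β (𝟙_ C)).hom ≫ (α_ (𝟙_ C) (𝟙_ C) P).inv ≫ (λ_ (𝟙_ C)).hom ▷ P =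
      (α_ P (𝟙_ C) (𝟙_ C)).inv ≫ ((b.β (𝟙_ C)).hom ≫ (λ_ P).hom) ▷ 𝟙_ C ≫ (b.β (𝟙_ C)).hom := by
    rw [leftUnitor_whiskerRight, Iso.inv_hom_id_assoc, leftUnitor_naturality, comp_whiskerRight,
      leftUnitor_whiskerRight]
    simp only [Category.assoc]
  rw [h] at n
  simp only [Category.assoc] at n
  rw [e, ← Category.assoc, cancel_mono, Iso.eq_inv_comp, triangle] at n
  rw [Iso.eq_comp_inv]
  exact ((whiskerRight_iff _ _).1 n).symm

theorem slide_unit (X : C) : slide b (𝟙_ C) X ≫ (λ_ (P ⊗ X)).hom = P ◁ (λ_ X).hom := by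
  simp only [slide, braid_unit]
  monoidal

/-! ### Contracting two copies of `π` by `ξ`. -/

variable (ξ : P ⊗ P ≅ 𝟙_ C)

/-- The isomorphism `P ⊗ (P ⊗ X) ≅ X` given by `ξ : P ⊗ P ≅ 𝟙`. -/
def square (X : C) : P ⊗ (P ⊗ X) ≅ X := (α_ P P X).symm ≪≫ whiskerRightIso ξ X ≪≫ λ_ X

theorem square_hom (X : C) : (square ξ X).hom = (α_ P P X).inv ≫ ξ.hom ▷ X ≫ (λ_ X).hom := rfl

theorem square_naturality {X Y : C} (f : X ⟶ Y) :
    P ◁ (P ◁ f) ≫ (square ξ Y).hom = (square ξ X).hom ≫ f := by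
  simp only [square_hom, Category.assoc]
  rw [associator_inv_naturality_right_assoc, whisker_exchange_assoc, leftUnitor_naturality]

theorem square_inv_naturality {X Y : C} (f : X ⟶ Y) :
    f ≫ (square ξ Y).inv = (square ξ X).inv ≫ P ◁ (P ◁ f) := by
  rw [Iso.comp_inv_eq, Category.assoc, square_naturality, Iso.inv_hom_id_assoc]

theorem square_whiskerRight (X Y : C) : (square ξ (X ⊗ Y)).hom =
    P ◁ (α_ P X Y).inv ≫ (α_ P (P ⊗ X) Y).inv ≫ (square ξ X).hom ▷ Y := by
  simp only [square_hom]
  monoidal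

variable (hξ : ∀ X : C,
    (ξ.hom ▷ X) ≫ (λ_ X).hom ≫ (ρ_ X).inv ≫ (X ◁ ξ.inv) =
      (α_ P P X).hom ≫ (P ◁ (b.β X).hom) ≫ (α_ P X P).inv ≫
        ((b.β X).hom ▷ P) ≫ (α_ X P P).hom)

include hξ

/-- The defining relation of `ξ` and `β`, solved for the contraction: `P ⊗ P` may be contracted in
front of `X`, or behind it after both copies have slid past. -/
theorem square_braid (X : C) :
    (square ξ X).hom = P ◁ (b.β X).hom ≫ slide b X P ≫ X ◁ ξ.hom ≫ (ρ_ X).hom := by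
  have h := congrArg (fun t => (α_ P P X).inv ≫ t ≫ X ◁ ξ.hom ≫ (ρ_ X).hom) (hξ X)
  simp only [Category.assoc, Iso.inv_hom_id_assoc] at h
  rw [← whiskerLeft_comp_assoc, ξ.inv_hom_id] at h
  simpa [square_hom, slide] using h

/-- This is `square_braid` with a spectator `Y`; it yields functoriality of `X ⊗ -` on two odd
morphisms. -/
theorem slide_slide (X Y : C) : P ◁ slide b X Y ≫ slide b X (P ⊗ Y) ≫ X ◁ (square ξ Y).hom =
    (square ξ (X ⊗ Y)).hom := by
  rw [square_whiskerRight, square_braid b ξ hξ X, square_hom ξ Y]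
  simp only [slide]
  monoidal

variable [Preadditive C] [MonoidalPreadditive C]

omit hξ in
theorem whiskerLeft_neg' (X : C) {Y Z : C} (f : Y ⟶ Z) : X ◁ (-f) = -(X ◁ f) :=
  (tensorLeft X).map_neg

omit hξ in
theorem neg_whiskerRight' {Y Z : C} (f : Y ⟶ Z) (X : C) : (-f) ▷ X = -(f ▷ X) :=
  (tensorRight X).map_neg

variable (hP : (b.β P).hom = -𝟙 (P ⊗ P))

include hP

/-- In `P ⊗ (P ⊗ (P ⊗ X))` the first two or the last two copies of `P` may be contracted.
`square_braid` at `P` relates the choices by two braidings, and their two signs cancel. This is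
associativity for three odd morphisms. -/
theorem whiskerLeft_square (X : C) : P ◁ (square ξ X).hom = (square ξ (P ⊗ X)).hom := by
  rw [square_whiskerRight, square_braid b ξ hξ P, square_hom ξ X]
  simp only [slide, hP]
  simp only [whiskerLeft_neg', neg_whiskerRight', Preadditive.neg_comp, Preadditive.comp_neg,
    neg_neg]
  monoidal

omit hξ in
-- Sliding past `P ⊗ X` splits into `β` at `P`, which is `-1`, and `β` at `X`. The single sign left
-- over is that of super interchange.
theorem slide_pi (X Y : C) : P ◁ (α_ P X Y).inv ≫ slide b (P ⊗ X) Y =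
    -(P ◁ slide b X Y ≫ (α_ P X (P ⊗ Y)).inv) := by
  simp only [slide, b.monoidal, hP]
  simp only [neg_whiskerRight', Preadditive.neg_comp, Preadditive.comp_neg]
  refine congrArg Neg.neg ?_
  monoidal

end

/-! ### The monoidal `Π`-supercategory of a monoidal `Π`-category -/

/-- The objects of the monoidal `Π`-supercategory with underlying monoidal `Π`-category `A`. -/
structure Superize {k : Type w} [CommRing k] (A : PiMon.{w, v, u} k) where
  /-- the object of `A` -/
  of : A.carrier

namespace Superize

open MonoidalCategory

section

variable {k : Type w} [CommRing k] {A : PiMon.{w, v, u} k}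

/-- The morphisms `X ⟶ Y`: an even one is a morphism `X ⟶ Y`, an odd one is a morphism
`π ⊗ X ⟶ Y`. -/
@[ext]
structure Hom (X Y : Superize A) where
  even : X.of ⟶ Y.of
  odd : A.pi ⊗ X.of ⟶ Y.of

namespace Hom

variable {X Y : Superize A}

/-- A morphism is a pair consisting of its even part and its odd part. -/
def equiv (X Y : Superize A) : Hom X Y ≃ (X.of ⟶ Y.of) × (A.pi ⊗ X.of ⟶ Y.of) where
  toFun f := (f.even, f.odd)
  invFun f := ⟨f.1, f.2⟩

instance : AddCommGroup (Hom X Y) := (equiv X Y).addCommGroup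

instance : Module k (Hom X Y) := (equiv X Y).module k

end Hom

theorem whiskerLeft_squareInv (X : A.carrier) :
    A.pi ◁ (square A.xi X).inv = (square A.xi (A.pi ⊗ X)).inv := by
  rw [← cancel_mono (square A.xi (A.pi ⊗ X)).hom, Iso.inv_hom_id,
    ← whiskerLeft_square A.β A.xi A.xi_comm A.braiding_self, ← whiskerLeft_comp, Iso.inv_hom_id,
    whiskerLeft_id]

instance : Category (Superize A) where
  Hom X Y := Hom X Y
  id X := ⟨𝟙 X.of, 0⟩
  -- An odd morphism is stored as its composite with `zL`, that is, `f` stands for the inverse of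
  -- `zL` followed by `f.odd`. Moving the second inverse of `zL` past `f.odd` leaves the inverse of
  -- a double `zL`, which by `zL_zL` is `-(square ξ X)⁻¹`; hence the minus sign.
  comp {X Y Z} f g := ⟨f.even ≫ g.even - (square A.xi X.of).inv ≫ A.pi ◁ f.odd ≫ g.odd,
    f.odd ≫ g.even + A.pi ◁ f.even ≫ g.odd⟩
  id_comp f := by ext <;> simp
  comp_id f := by ext <;> simp
  assoc {W X Y Z} f g h := by
    ext
    · simp only [Preadditive.sub_comp, Preadditive.comp_sub, Preadditive.comp_add,
        Preadditive.add_comp, MonoidalPreadditive.whiskerLeft_add, whiskerLeft_comp,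
        Category.assoc, reassoc_of% (square_inv_naturality A.xi f.even)]
      abel
    · simp only [Preadditive.comp_add, Preadditive.add_comp,
        MonoidalPreadditive.whiskerLeft_add, whiskerLeft_comp, Category.assoc, sub_eq_add_neg,
        whiskerLeft_neg', Preadditive.neg_comp,
        Preadditive.comp_neg, whiskerLeft_squareInv,
        reassoc_of% (square_inv_naturality A.xi f.odd)]
      abel

theorem hom_ext {X Y : Superize A} {f g : X ⟶ Y} (h₀ : Hom.even f = Hom.even g)
    (h₁ : Hom.odd f = Hom.odd g) : f = g := Hom.ext h₀ h₁

@[simp] theorem id_even (X : Superize A) : Hom.even (𝟙 X) = 𝟙 X.of := rfl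
@[simp] theorem id_odd (X : Superize A) : Hom.odd (𝟙 X) = 0 := rfl

@[simp] theorem comp_even {X Y Z : Superize A} (f : X ⟶ Y) (g : Y ⟶ Z) : Hom.even (f ≫ g) =
    Hom.even f ≫ Hom.even g - (square A.xi X.of).inv ≫ A.pi ◁ Hom.odd f ≫ Hom.odd g := rfl

@[simp] theorem comp_odd {X Y Z : Superize A} (f : X ⟶ Y) (g : Y ⟶ Z) : Hom.odd (f ≫ g) =
    Hom.odd f ≫ Hom.even g + A.pi ◁ Hom.even f ≫ Hom.odd g := rfl

instance : Preadditive (Superize A) where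
  homGroup X Y := inferInstanceAs (AddCommGroup (Hom X Y))
  add_comp X Y Z f f' g := by
    refine hom_ext ?_ ?_
    · change (Hom.even f + Hom.even f') ≫ _ - _ ≫ _ ◁ (Hom.odd f + Hom.odd f') ≫ _ =
        (_ - _) + (_ - _)
      simp only [Preadditive.add_comp, Preadditive.comp_add, MonoidalPreadditive.whiskerLeft_add]
      abel
    · change (Hom.odd f + Hom.odd f') ≫ _ + _ ◁ (Hom.even f + Hom.even f') ≫ _ =
        (_ + _) + (_ + _)
      simp only [Preadditive.add_comp, MonoidalPreadditive.whiskerLeft_add]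
      abel
  comp_add X Y Z f g g' := by
    refine hom_ext ?_ ?_
    · change _ ≫ (Hom.even g + Hom.even g') - _ ≫ _ ≫ (Hom.odd g + Hom.odd g') =
        (_ - _) + (_ - _)
      simp only [Preadditive.comp_add]
      abel
    · change _ ≫ (Hom.even g + Hom.even g') + _ ≫ (Hom.odd g + Hom.odd g') =
        (_ + _) + (_ + _)
      simp only [Preadditive.comp_add]
      abel

instance : Linear k (Superize A) where
  homModule X Y := inferInstanceAs (Module k (Hom X Y))
  smul_comp X Y Z r f g := by
    refine hom_ext ?_ ?_
    · change (r • Hom.even f) ≫ _ - _ ≫ _ ◁ (r • Hom.odd f) ≫ _ = r • (_ - _)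
      simp only [Linear.smul_comp, Linear.comp_smul, MonoidalLinear.whiskerLeft_smul, smul_sub]
    · change (r • Hom.odd f) ≫ _ + _ ◁ (r • Hom.even f) ≫ _ = r • (_ + _)
      simp only [Linear.smul_comp, MonoidalLinear.whiskerLeft_smul, smul_add]
  comp_smul X Y Z f r g := by
    refine hom_ext ?_ ?_
    · change _ ≫ (r • Hom.even g) - _ ≫ _ ≫ (r • Hom.odd g) = r • (_ - _)
      simp only [Linear.comp_smul, smul_sub]
    · change _ ≫ (r • Hom.even g) + _ ≫ (r • Hom.odd g) = r • (_ + _)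
      simp only [Linear.comp_smul, smul_add]

@[simp] theorem add_even {X Y : Superize A} (f g : X ⟶ Y) :
    Hom.even (f + g) = Hom.even f + Hom.even g := rfl
@[simp] theorem add_odd {X Y : Superize A} (f g : X ⟶ Y) :
    Hom.odd (f + g) = Hom.odd f + Hom.odd g := rfl
@[simp] theorem neg_even {X Y : Superize A} (f : X ⟶ Y) : Hom.even (-f) = -Hom.even f := rfl
@[simp] theorem neg_odd {X Y : Superize A} (f : X ⟶ Y) : Hom.odd (-f) = -Hom.odd f := rfl
@[simp] theorem zero_even {X Y : Superize A} : Hom.even (0 : X ⟶ Y) = 0 := rfl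
@[simp] theorem zero_odd {X Y : Superize A} : Hom.odd (0 : X ⟶ Y) = 0 := rfl
@[simp] theorem smul_even {X Y : Superize A} (r : k) (f : X ⟶ Y) :
    Hom.even (r • f) = r • Hom.even f := rfl
@[simp] theorem smul_odd {X Y : Superize A} (r : k) (f : X ⟶ Y) :
    Hom.odd (r • f) = r • Hom.odd f := rfl

/-- The space of morphisms of parity `p`. -/
def paritySubmodule (X Y : Superize A) (p : ZMod 2) : Submodule k (X ⟶ Y) where
  carrier := {f | (p = 0 → Hom.odd f = 0) ∧ (p = 1 → Hom.even f = 0)}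
  add_mem' {f g} hf hg := ⟨fun h => by rw [add_odd, hf.1 h, hg.1 h, add_zero],
    fun h => by rw [add_even, hf.2 h, hg.2 h, add_zero]⟩
  zero_mem' := ⟨fun _ => rfl, fun _ => rfl⟩
  smul_mem' r f hf := ⟨fun h => by rw [smul_odd, hf.1 h, smul_zero],
    fun h => by rw [smul_even, hf.2 h, smul_zero]⟩

theorem mem_parity_zero {X Y : Superize A} {f : X ⟶ Y} :
    f ∈ paritySubmodule X Y 0 ↔ Hom.odd f = 0 :=
  ⟨fun h => h.1 rfl, fun h => ⟨fun _ => h, fun e => absurd e (by decide)⟩⟩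

theorem mem_parity_one {X Y : Superize A} {f : X ⟶ Y} :
    f ∈ paritySubmodule X Y 1 ↔ Hom.even f = 0 :=
  ⟨fun h => h.2 rfl, fun h => ⟨fun e => absurd e (by decide), fun _ => h⟩⟩

instance : Supercategory k (Superize A) where
  parity := paritySubmodule
  isCompl X Y := by
    refine IsCompl.of_eq ?_ ?_
    · refine (Submodule.eq_bot_iff _).2 fun f hf => hom_ext ?_ ?_
      · exact mem_parity_one.1 hf.2
      · exact mem_parity_zero.1 hf.1
    · refine (Submodule.eq_top_iff').2 fun f => Submodule.mem_sup.2
        ⟨(⟨Hom.even f, 0⟩ : Hom X Y), mem_parity_zero.2 rfl,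
          (⟨0, Hom.odd f⟩ : Hom X Y), mem_parity_one.2 rfl, hom_ext ?_ ?_⟩
      · exact add_zero (Hom.even f)
      · exact zero_add (Hom.odd f)
  id_mem X := mem_parity_zero.2 rfl
  comp_mem {X Y Z p q f g} hf hg := by
    have h2 : ∀ p : ZMod 2, p = 0 ∨ p = 1 := by decide
    obtain rfl | rfl := h2 p <;> obtain rfl | rfl := h2 q <;>
      simp only [mem_parity_zero, mem_parity_one] at hf hg
    · refine mem_parity_zero.2 ?_
      simp [hf, hg]
    · refine mem_parity_one.2 ?_
      simp [hf, hg]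
    · refine mem_parity_one.2 ?_
      simp [hf, hg]
    · refine mem_parity_zero.2 ?_
      simp [hf, hg]

theorem hasParity_zero {X Y : Superize A} {f : X ⟶ Y} : HasParity k f 0 ↔ Hom.odd f = 0 :=
  mem_parity_zero

theorem hasParity_one {X Y : Superize A} {f : X ⟶ Y} : HasParity k f 1 ↔ Hom.even f = 0 :=
  mem_parity_one

/-- An isomorphism of `A`, as an even isomorphism. -/
def evenIso {X Y : Superize A} (e : X.of ≅ Y.of) : X ≅ Y where
  hom := (⟨e.hom, 0⟩ : Hom X Y)
  inv := (⟨e.inv, 0⟩ : Hom Y X)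
  hom_inv_id := hom_ext (by simp) (by simp)
  inv_hom_id := hom_ext (by simp) (by simp)

@[simp] theorem evenIso_hom_even {X Y : Superize A} (e : X.of ≅ Y.of) :
    Hom.even (evenIso e).hom = e.hom := rfl
@[simp] theorem evenIso_hom_odd {X Y : Superize A} (e : X.of ≅ Y.of) :
    Hom.odd (evenIso e).hom = 0 := rfl

/-- The morphism `f ⊗ 1_Z`. -/
def whiskerR {X Y : Superize A} (f : X ⟶ Y) (Z : Superize A) :
    (⟨X.of ⊗ Z.of⟩ : Superize A) ⟶ ⟨Y.of ⊗ Z.of⟩ :=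
  (⟨Hom.even f ▷ Z.of, (α_ A.pi X.of Z.of).inv ≫ Hom.odd f ▷ Z.of⟩ : Hom _ _)

/-- The morphism `1_Z ⊗ f`. -/
def whiskerL (Z : Superize A) {X Y : Superize A} (f : X ⟶ Y) :
    (⟨Z.of ⊗ X.of⟩ : Superize A) ⟶ ⟨Z.of ⊗ Y.of⟩ :=
  -- The odd part of `f` expects `π` next to `X`, so `π` first slides past `Z`; for `f ⊗ 1_Z`
  -- reassociating is enough.
  (⟨Z.of ◁ Hom.even f, slide A.β Z.of X.of ≫ Z.of ◁ Hom.odd f⟩ : Hom _ _)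

@[simp] theorem whiskerR_even {X Y : Superize A} (f : X ⟶ Y) (Z : Superize A) :
    Hom.even (whiskerR f Z) = Hom.even f ▷ Z.of := rfl
@[simp] theorem whiskerR_odd {X Y : Superize A} (f : X ⟶ Y) (Z : Superize A) :
    Hom.odd (whiskerR f Z) = (α_ A.pi X.of Z.of).inv ≫ Hom.odd f ▷ Z.of := rfl
@[simp] theorem whiskerL_even (Z : Superize A) {X Y : Superize A} (f : X ⟶ Y) :
    Hom.even (whiskerL Z f) = Z.of ◁ Hom.even f := rfl
@[simp] theorem whiskerL_odd (Z : Superize A) {X Y : Superize A} (f : X ⟶ Y) :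
    Hom.odd (whiskerL Z f) = slide A.β Z.of X.of ≫ Z.of ◁ Hom.odd f := rfl

theorem whiskerR_add {X Y : Superize A} (f g : X ⟶ Y) (Z : Superize A) :
    whiskerR (f + g) Z = whiskerR f Z + whiskerR g Z :=
  hom_ext (by simp) (by simp)

theorem whiskerL_add (Z : Superize A) {X Y : Superize A} (f g : X ⟶ Y) :
    whiskerL Z (f + g) = whiskerL Z f + whiskerL Z g :=
  hom_ext (by simp) (by simp)

theorem whiskerR_smul {X Y : Superize A} (r : k) (f : X ⟶ Y) (Z : Superize A) :
    whiskerR (r • f) Z = r • whiskerR f Z :=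
  hom_ext (by simp) (by simp)

theorem whiskerL_smul (Z : Superize A) {X Y : Superize A} (r : k) (f : X ⟶ Y) :
    whiskerL Z (r • f) = r • whiskerL Z f :=
  hom_ext (by simp) (by simp)

theorem whiskerR_id (X Z : Superize A) : whiskerR (𝟙 X) Z = 𝟙 _ :=
  hom_ext (by simp) (by simp)

theorem whiskerL_id (Z X : Superize A) : whiskerL Z (𝟙 X) = 𝟙 _ :=
  hom_ext (by simp) (by simp)

theorem squareInv_whiskerRight (X Y : A.carrier) : (square A.xi X).inv ▷ Y =
    (square A.xi (X ⊗ Y)).inv ≫ A.pi ◁ (α_ A.pi X Y).inv ≫ (α_ A.pi (A.pi ⊗ X) Y).inv := by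
  rw [Iso.eq_inv_comp, square_whiskerRight]
  simp only [Category.assoc]
  rw [← comp_whiskerRight, Iso.hom_inv_id, id_whiskerRight, Category.comp_id]

theorem whiskerLeft_squareInv' (X Y : A.carrier) : X ◁ (square A.xi Y).inv =
    (square A.xi (X ⊗ Y)).inv ≫ A.pi ◁ slide A.β X Y ≫ slide A.β X (A.pi ⊗ Y) := by
  rw [Iso.eq_inv_comp, ← slide_slide A.β A.xi A.xi_comm]
  simp only [Category.assoc]
  rw [← whiskerLeft_comp, Iso.hom_inv_id, whiskerLeft_id, Category.comp_id]

theorem whiskerR_comp {X Y Z : Superize A} (f : X ⟶ Y) (g : Y ⟶ Z) (W : Superize A) :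
    whiskerR (f ≫ g) W = whiskerR f W ≫ whiskerR g W := by
  refine hom_ext ?_ ?_
  · simp only [whiskerR_even, whiskerR_odd, comp_even, sub_eq_add_neg,
      MonoidalPreadditive.add_whiskerRight, neg_whiskerRight', comp_whiskerRight,
      squareInv_whiskerRight, whiskerLeft_comp, Category.assoc]
    rw [associator_inv_naturality_middle_assoc]
  · simp only [whiskerR_even, whiskerR_odd, comp_odd, MonoidalPreadditive.add_whiskerRight,
      comp_whiskerRight, Preadditive.comp_add, Category.assoc]
    rw [associator_inv_naturality_middle_assoc]

/-- For two odd factors both copies of `π` must pass `W` before `ξ` relates to the composite;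
`whiskerLeft_squareInv'`, a form of `slide_slide`, says the order is immaterial. -/
theorem whiskerL_comp (W : Superize A) {X Y Z : Superize A} (f : X ⟶ Y) (g : Y ⟶ Z) :
    whiskerL W (f ≫ g) = whiskerL W f ≫ whiskerL W g := by
  refine hom_ext ?_ ?_
  · simp only [whiskerL_even, whiskerL_odd, comp_even, sub_eq_add_neg,
      MonoidalPreadditive.whiskerLeft_add, whiskerLeft_neg', whiskerLeft_comp,
      whiskerLeft_squareInv', Category.assoc]
    rw [reassoc_of% (slide_naturality_right A.β W.of (Hom.odd f))]
  · simp only [whiskerL_even, whiskerL_odd, comp_odd, MonoidalPreadditive.whiskerLeft_add,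
      whiskerLeft_comp, Preadditive.comp_add, Category.assoc]
    rw [reassoc_of% (slide_naturality_right A.β W.of (Hom.even f))]

/-- Only the odd-odd case carries a sign. There the two orders differ by sliding one `π` past the
other, which is `-1` by `slide_pi`. -/
theorem whisker_exchange {X₁ Y₁ X₂ Y₂ : Superize A} {p q : ZMod 2} (f : X₁ ⟶ Y₁) (g : X₂ ⟶ Y₂)
    (hf : HasParity k f p) (hg : HasParity k g q) : whiskerR f X₂ ≫ whiskerL Y₁ g =
      sgn (q * p) • (whiskerL X₁ g ≫ whiskerR f Y₂) := by
  have h2 : ∀ p : ZMod 2, p = 0 ∨ p = 1 := by decide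
  obtain rfl | rfl := h2 p <;> obtain rfl | rfl := h2 q <;>
    simp only [hasParity_zero, hasParity_one] at hf hg
  · rw [mul_zero, sgn_zero, one_zsmul]
    refine hom_ext ?_ ?_
    · simp [hf, hg, MonoidalCategory.whisker_exchange]
    · simp [hf, hg]
  · rw [mul_zero, sgn_zero, one_zsmul]
    refine hom_ext ?_ ?_
    · simp [hf, hg]
    · simp [hf, hg, reassoc_of% (slide_naturality_left A.β (Hom.even f)),
        MonoidalCategory.whisker_exchange]
  · rw [zero_mul, sgn_zero, one_zsmul]
    refine hom_ext ?_ ?_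
    · simp [hf, hg]
    · simp [hf, hg, ← MonoidalCategory.whisker_exchange]
  · rw [show sgn (1 * 1) = -1 by decide, neg_one_zsmul]
    have h := slide_pi A.β A.braiding_self X₁.of X₂.of
    have key : A.pi ◁ ((α_ A.pi X₁.of X₂.of).inv ≫ Hom.odd f ▷ X₂.of) ≫
        slide A.β Y₁.of X₂.of ≫ Y₁.of ◁ Hom.odd g =
        -(A.pi ◁ (slide A.β X₁.of X₂.of ≫ X₁.of ◁ Hom.odd g) ≫
          (α_ A.pi X₁.of Y₂.of).inv ≫ Hom.odd f ▷ Y₂.of) := by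
      rw [whiskerLeft_comp_assoc, reassoc_of% (slide_naturality_left A.β (Hom.odd f)),
        ← MonoidalCategory.whisker_exchange, ← Category.assoc (A.pi ◁ _), h, whiskerLeft_comp_assoc,
        associator_inv_naturality_right_assoc, Preadditive.neg_comp, Category.assoc]
    refine hom_ext ?_ ?_
    · simp only [neg_even, comp_even, whiskerR_even, whiskerL_even, whiskerR_odd, whiskerL_odd, hf,
        hg, key]
      simp
    · simp [hf, hg]

/-- The tensor product of morphisms, as a bilinear map. -/
def tensorHom {X₁ Y₁ X₂ Y₂ : Superize A} : (X₁ ⟶ Y₁) →ₗ[k] (X₂ ⟶ Y₂) →ₗ[k]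
    ((⟨X₁.of ⊗ X₂.of⟩ : Superize A) ⟶ ⟨Y₁.of ⊗ Y₂.of⟩) :=
  LinearMap.mk₂ k (fun f g => whiskerL X₁ g ≫ whiskerR f Y₂)
    (fun f f' g => by rw [whiskerR_add, Preadditive.comp_add])
    (fun r f g => by rw [whiskerR_smul, Linear.comp_smul])
    -- The factor `1 ⊗ g` comes first, since super interchange splits `f ⊗ g` without a sign only in
    -- this order.
    (fun f g g' => by rw [whiskerL_add, Preadditive.add_comp])
    (fun r f g => by rw [whiskerL_smul, Linear.smul_comp])

theorem tensorHom_def {X₁ Y₁ X₂ Y₂ : Superize A} (f : X₁ ⟶ Y₁) (g : X₂ ⟶ Y₂) :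
    tensorHom f g = whiskerL X₁ g ≫ whiskerR f Y₂ := rfl

theorem tensorHom_id {X₁ Y₁ : Superize A} (f : X₁ ⟶ Y₁) (Z : Superize A) :
    tensorHom f (𝟙 Z) = whiskerR f Z := by
  rw [tensorHom_def, whiskerL_id, Category.id_comp]

theorem id_tensorHom (Z : Superize A) {X₁ Y₁ : Superize A} (f : X₁ ⟶ Y₁) :
    tensorHom (𝟙 Z) f = whiskerL Z f := by
  rw [tensorHom_def, whiskerR_id, Category.comp_id]

theorem whiskerR_mem {X Y : Superize A} {p : ZMod 2} {f : X ⟶ Y} (hf : HasParity k f p)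
    (Z : Superize A) : HasParity k (whiskerR f Z) p := by
  obtain rfl | rfl := (by decide : ∀ p : ZMod 2, p = 0 ∨ p = 1) p
  · exact hasParity_zero.2 (by simp [hasParity_zero.1 hf])
  · exact hasParity_one.2 (by simp [hasParity_one.1 hf])

theorem whiskerL_mem (Z : Superize A) {X Y : Superize A} {p : ZMod 2} {f : X ⟶ Y}
    (hf : HasParity k f p) : HasParity k (whiskerL Z f) p := by
  obtain rfl | rfl := (by decide : ∀ p : ZMod 2, p = 0 ∨ p = 1) p
  · exact hasParity_zero.2 (by simp [hasParity_zero.1 hf])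
  · exact hasParity_one.2 (by simp [hasParity_one.1 hf])

/-- The associator. -/
def assoc (X Y Z : Superize A) :
    (⟨(X.of ⊗ Y.of) ⊗ Z.of⟩ : Superize A) ≅ ⟨X.of ⊗ (Y.of ⊗ Z.of)⟩ :=
  evenIso (α_ X.of Y.of Z.of)

theorem assoc_naturality_left {X X' : Superize A} (f : X ⟶ X') (Y Z : Superize A) :
    whiskerR (whiskerR f Y) Z ≫ (assoc X' Y Z).hom =
      (assoc X Y Z).hom ≫ whiskerR f ⟨Y.of ⊗ Z.of⟩ :=
  hom_ext (by simp [assoc]) (by simp [assoc])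

theorem assoc_naturality_middle (X : Superize A) {Y Y' : Superize A} (f : Y ⟶ Y')
    (Z : Superize A) : whiskerR (whiskerL X f) Z ≫ (assoc X Y' Z).hom =
      (assoc X Y Z).hom ≫ whiskerL X (whiskerR f Z) :=
  hom_ext (by simp [assoc]) (by
    have h := slide_whiskerRight A.β X.of Y.of Z.of
    simp [assoc, ← reassoc_of% h])

/-- Sliding `π` past `X ⊗ Y` at once or past `X` and then `Y` is the same because the half-braiding
is monoidal. -/
theorem assoc_naturality_right (X Y : Superize A) {Z Z' : Superize A} (f : Z ⟶ Z') :
    whiskerL (⟨X.of ⊗ Y.of⟩ : Superize A) f ≫ (assoc X Y Z').hom =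
      (assoc X Y Z).hom ≫ whiskerL X (whiskerL Y f) :=
  hom_ext (by simp [assoc]) (by
    have h := slide_tensor A.β X.of Y.of Z.of
    simp [assoc, ← reassoc_of% h])

variable (A) in
/-- The unit object. -/
abbrev unit : Superize A := ⟨𝟙_ A.carrier⟩

/-- The left unitor. -/
def lUnitor (X : Superize A) : (⟨(unit A).of ⊗ X.of⟩ : Superize A) ≅ X := evenIso (λ_ X.of)

/-- The right unitor. -/
def rUnitor (X : Superize A) : (⟨X.of ⊗ (unit A).of⟩ : Superize A) ≅ X := evenIso (ρ_ X.of)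

theorem lUnitor_naturality {X Y : Superize A} (f : X ⟶ Y) :
    whiskerL (unit A) f ≫ (lUnitor Y).hom = (lUnitor X).hom ≫ f :=
  hom_ext (by simp [lUnitor, unit]) (by
    have h := slide_unit A.β X.of
    simp [lUnitor, unit, ← reassoc_of% h])

theorem rUnitor_naturality {X Y : Superize A} (f : X ⟶ Y) :
    whiskerR f (unit A) ≫ (rUnitor Y).hom = (rUnitor X).hom ≫ f :=
  hom_ext (by simp [rUnitor, unit]) (by simp [rUnitor, unit])

theorem tensorHom_assoc {X₁ Y₁ X₂ Y₂ X₃ Y₃ : Superize A} (f₁ : X₁ ⟶ Y₁) (f₂ : X₂ ⟶ Y₂)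
    (f₃ : X₃ ⟶ Y₃) : tensorHom (tensorHom f₁ f₂) f₃ ≫ (assoc Y₁ Y₂ Y₃).hom =
      (assoc X₁ X₂ X₃).hom ≫ tensorHom f₁ (tensorHom f₂ f₃) := by
  have e₁ : tensorHom (tensorHom f₁ f₂) f₃ = whiskerL (⟨X₁.of ⊗ X₂.of⟩ : Superize A) f₃ ≫
      whiskerR (whiskerL X₁ f₂) Y₃ ≫ whiskerR (whiskerR f₁ Y₂) Y₃ := by
    rw [← whiskerR_comp]
    rfl
  have e₂ : tensorHom f₁ (tensorHom f₂ f₃) = whiskerL X₁ (whiskerL X₂ f₃) ≫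
      whiskerL X₁ (whiskerR f₂ Y₃) ≫ whiskerR f₁ (⟨Y₂.of ⊗ Y₃.of⟩ : Superize A) := by
    rw [← Category.assoc, ← whiskerL_comp]
    rfl
  rw [e₁, e₂]
  simp only [Category.assoc]
  rw [assoc_naturality_left, reassoc_of% (assoc_naturality_middle X₁ f₂ Y₃),
    reassoc_of% (assoc_naturality_right X₁ X₂ f₃)]

theorem assoc_pentagon (W X Y Z : Superize A) :
    whiskerR (assoc W X Y).hom Z ≫ (assoc W ⟨X.of ⊗ Y.of⟩ Z).hom ≫ whiskerL W (assoc X Y Z).hom =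
      (assoc ⟨W.of ⊗ X.of⟩ Y Z).hom ≫ (assoc W X ⟨Y.of ⊗ Z.of⟩).hom :=
  hom_ext (by simp [assoc]) (by simp [assoc])

theorem assoc_triangle (X Y : Superize A) :
    (assoc X (unit A) Y).hom ≫ whiskerL X (lUnitor Y).hom = whiskerR (rUnitor X).hom Y :=
  hom_ext (by simp [assoc, lUnitor, rUnitor]) (by simp [assoc, lUnitor, rUnitor])

instance : MonoidalSupercategory k (Superize A) where
  tensorObj X Y := ⟨X.of ⊗ Y.of⟩
  tensorHom := tensorHom
  tensorHom_mem {_ _ _ _ p q _ _} hf hg :=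
    ((whiskerL_mem _ hg).comp (whiskerR_mem hf _)).of_eq (add_comm q p)
  tensorHom_id X Y := by rw [tensorHom_id, whiskerR_id]
  interchange f₁ f₂ g₁ g₂ hf hg := by
    rw [tensorHom_def, tensorHom_def, tensorHom_def, whiskerL_comp, whiskerR_comp, Category.assoc,
      reassoc_of% (whisker_exchange f₁ g₂ hf hg)]
    simp only [Preadditive.zsmul_comp, Preadditive.comp_zsmul, Category.assoc]
  tensorUnit := unit A
  associator := assoc
  leftUnitor := lUnitor
  rightUnitor := rUnitor
  associator_mem _ _ _ := hasParity_zero.2 rfl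
  leftUnitor_mem _ := hasParity_zero.2 rfl
  rightUnitor_mem _ := hasParity_zero.2 rfl
  associator_naturality := tensorHom_assoc
  leftUnitor_naturality f := by rw [id_tensorHom, lUnitor_naturality]
  rightUnitor_naturality f := by rw [tensorHom_id, rUnitor_naturality]
  pentagon W X Y Z := by
    rw [tensorHom_id, id_tensorHom]
    exact assoc_pentagon W X Y Z
  triangle X Y := by
    rw [tensorHom_id, id_tensorHom]
    exact assoc_triangle X Y

end

/-! ### The odd isomorphism between `π` and the unit. -/

theorem square_unit {k : Type w} [CommRing k] (A : PiMon.{w, v, u} k) :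
    (square A.xi (𝟙_ A.carrier)).hom = A.pi ◁ (ρ_ A.pi).hom ≫ A.xi.hom := by
  rw [square_hom]
  monoidal

/-- Among three copies of `π`, contracting the first two or the last two gives the same map:
`square_braid` at `π` involves `β_π = -1` twice. -/
theorem square_pi {k : Type w} [CommRing k] (A : PiMon.{w, v, u} k) :
    (square A.xi A.pi).hom = A.pi ◁ A.xi.hom ≫ (ρ_ A.pi).hom := by
  rw [square_braid A.β A.xi A.xi_comm, slide, A.braiding_self]
  simp only [whiskerLeft_neg', neg_whiskerRight', Preadditive.neg_comp, Preadditive.comp_neg,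
    neg_neg]
  monoidal

/-- The odd isomorphism `π ≅ 𝟙`. -/
def zeta {k : Type w} [CommRing k] (A : PiMon.{w, v, u} k) :
    (⟨A.pi⟩ : Superize A) ≅ MonoidalSupercategory.tensorUnit k where
  -- The odd component of `ζ` should be `zL ζ π ≫ ζ`, which is `-ξ` by `zL_zeta`; the sign cancels
  -- the one in the composition rule.
  hom := (⟨0, -A.xi.hom⟩ : Hom _ (unit A))
  inv := (⟨0, (ρ_ A.pi).hom⟩ : Hom (unit A) _)
  hom_inv_id := by
    refine hom_ext ?_ ?_
    · change 0 ≫ 0 - (square A.xi A.pi).inv ≫ A.pi ◁ (-A.xi.hom) ≫ (ρ_ A.pi).hom = 𝟙 A.pi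
      rw [whiskerLeft_neg', Preadditive.neg_comp, Preadditive.comp_neg, sub_neg_eq_add,
        Limits.zero_comp, zero_add, ← square_pi, Iso.inv_hom_id]
    · change (-A.xi.hom) ≫ 0 + A.pi ◁ 0 ≫ (ρ_ A.pi).hom = 0
      simp
  inv_hom_id := by
    refine hom_ext ?_ ?_
    · change 0 ≫ 0 - (square A.xi (𝟙_ A.carrier)).inv ≫ A.pi ◁ (ρ_ A.pi).hom ≫ (-A.xi.hom) =
        𝟙 (𝟙_ A.carrier)
      rw [Preadditive.comp_neg, Preadditive.comp_neg, sub_neg_eq_add,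
        Limits.zero_comp, zero_add, ← square_unit, Iso.inv_hom_id]
    · change (ρ_ A.pi).hom ≫ 0 + A.pi ◁ 0 ≫ (-A.xi.hom) = 0
      simp

end Superize

/-- The monoidal `Π`-supercategory with underlying monoidal `Π`-category `A`. -/
def PiMon.superize {k : Type w} [CommRing k] (A : PiMon.{w, v, u} k) : PiSMon.{w, v, u} k where
  carrier := Superize A
  pi := ⟨A.pi⟩
  zeta := Superize.zeta A
  zeta_mem := Superize.hasParity_one.2 rfl

/-! ### Recovering the original `Π`-category. -/

section

open MonoidalCategory MonoidalSupercategory PiSMon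

namespace Superize

variable {k : Type w} [CommRing k] (A : PiMon.{w, v, u} k)

theorem zL_zeta_even (X : Superize A) : Hom.even (zL (k := k) (zeta A) X).hom = 0 :=
  hasParity_one.1 (zL_mem (hasParity_one.2 rfl) X)

theorem zR_zeta_even (X : Superize A) : Hom.even (zR (k := k) (zeta A) X).hom = 0 :=
  hasParity_one.1 (zR_mem (hasParity_one.2 rfl) X)

theorem zL_zeta_odd (X : Superize A) :
    Hom.odd (zL (k := k) (zeta A) X).hom = -(square A.xi X.of).hom := by
  change Hom.odd (tensorHom (zeta A).hom (𝟙 X) ≫ (lUnitor X).hom) = _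
  rw [tensorHom_id, comp_odd]
  change ((α_ A.pi A.pi X.of).inv ≫ (-A.xi.hom) ▷ X.of) ≫ (λ_ X.of).hom + _ ≫ 0 = _
  rw [Limits.comp_zero, add_zero, neg_whiskerRight', Preadditive.comp_neg, Preadditive.neg_comp,
    Category.assoc, square_hom]

theorem zR_zeta_odd (X : Superize A) : Hom.odd (zR (k := k) (zeta A) X).hom =
    -(slide A.β X.of A.pi ≫ X.of ◁ A.xi.hom ≫ (ρ_ X.of).hom) := by
  change Hom.odd (tensorHom (𝟙 X) (zeta A).hom ≫ (rUnitor X).hom) = _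
  rw [id_tensorHom, comp_odd]
  change (slide A.β X.of A.pi ≫ X.of ◁ (-A.xi.hom)) ≫ (ρ_ X.of).hom + _ ≫ 0 = _
  rw [Limits.comp_zero, add_zero, whiskerLeft_neg', Preadditive.comp_neg, Preadditive.neg_comp,
    Category.assoc]

/-- Both `zL` and `zR` are purely odd here, with odd parts the negatives of contraction in front of
`X` and of contraction behind it; `square_braid` says that `A.β` takes one to the other. -/
theorem braid_zeta (X : Superize A) :
    (braid (k := k) (zeta A) X).hom = (⟨(A.β.β X.of).hom, 0⟩ : Hom _ _) := by
  rw [← cancel_mono (zR (k := k) (zeta A) X).hom, braid_zR]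
  refine hom_ext ?_ ?_
  · rw [comp_even, zL_zeta_even, zR_zeta_even]
    simp
  · rw [comp_odd, zR_zeta_even, zL_zeta_odd, zR_zeta_odd, Limits.comp_zero, zero_add,
      Preadditive.comp_neg, square_braid A.β A.xi A.xi_comm]

/-- Written as `zR` followed by `ζ`, the map collects four signs that cancel: one from `-ξ` inside
`zR`, one from `ζ` itself, one from the composition rule and one from `β_π = -1`. -/
theorem xiIso_zeta : (xiIso (k := k) (zeta A)).hom = (⟨A.xi.hom, 0⟩ : Hom _ _) := by
  rw [← zR_zeta']
  refine hom_ext ?_ ?_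
  · rw [comp_even, zR_zeta_even, zR_zeta_odd]
    change 0 ≫ _ - (square A.xi (A.pi ⊗ A.pi)).inv ≫
      A.pi ◁ (-(slide A.β A.pi A.pi ≫ A.pi ◁ A.xi.hom ≫ (ρ_ A.pi).hom)) ≫ (-A.xi.hom) = A.xi.hom
    have h : -(slide A.β A.pi A.pi ≫ A.pi ◁ A.xi.hom ≫ (ρ_ A.pi).hom) =
        A.pi ◁ A.xi.hom ≫ (ρ_ A.pi).hom := by
      simp [slide, A.braiding_self, neg_whiskerRight']
    rw [h, whiskerLeft_comp_assoc, Preadditive.comp_neg, Preadditive.comp_neg,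
      Preadditive.comp_neg, sub_neg_eq_add, Limits.zero_comp, zero_add,
      Iso.inv_comp_eq, ← square_naturality, square_unit]
  · rw [comp_odd, zR_zeta_even]
    change _ ≫ 0 + A.pi ◁ 0 ≫ _ = 0
    simp

/-- Taking the even part of an even morphism. -/
def evenPart : Underlying k (Superize A) ⥤ A.carrier where
  obj X := X.of.of
  map f := Hom.even f.1
  map_comp {X Y Z} f g := by
    change Hom.even f.1 ≫ Hom.even g.1 - _ ≫ _ ◁ Hom.odd f.1 ≫ _ = _
    rw [hasParity_zero.1 f.2]
    simp

/-- A morphism of `A`, as an even morphism. -/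
def ofEven : A.carrier ⥤ Underlying k (Superize A) where
  obj X := ⟨⟨X⟩⟩
  map {X Y} f := Underlying.mkHom (⟨f, 0⟩ : Hom (⟨X⟩ : Superize A) ⟨Y⟩) (hasParity_zero.2 rfl)
  map_comp {X Y Z} f g := Underlying.hom_ext (hom_ext (by
    change f ≫ g = f ≫ g - _ ≫ _ ◁ 0 ≫ 0
    simp) (by
    change 0 = 0 ≫ g + _ ◁ f ≫ 0
    simp))

instance : (evenPart A).Additive where
instance : (evenPart A).Linear k where
instance : (ofEven A).Additive where
  map_add := Underlying.hom_ext (hom_ext rfl (add_zero 0).symm)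
instance : (ofEven A).Linear k where
  map_smul _ r := Underlying.hom_ext (hom_ext rfl (smul_zero (M := k) (A := A.pi ⊗ _ ⟶ _) r).symm)

theorem underlying_hom_ext {X Y : Underlying k (Superize A)} {f g : X ⟶ Y}
    (h : Hom.even f.1 = Hom.even g.1) : f = g :=
  Underlying.hom_ext (hom_ext h ((hasParity_zero.1 f.2).trans (hasParity_zero.1 g.2).symm))

theorem evenPart_whiskerRight {X Y : Underlying k (Superize A)} (f : X ⟶ Y)
    (Z : Underlying k (Superize A)) :
    (evenPart A).map (f ▷ Z) = (evenPart A).map f ▷ (evenPart A).obj Z :=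
  congrArg Hom.even (tensorHom_id f.1 Z.of)

theorem evenPart_whiskerLeft (Z : Underlying k (Superize A)) {X Y : Underlying k (Superize A)}
    (f : X ⟶ Y) : (evenPart A).map (Z ◁ f) = (evenPart A).obj Z ◁ (evenPart A).map f :=
  congrArg Hom.even (id_tensorHom Z.of f.1)

/-- Tensor products and unit have the same underlying objects definitionally, so identities serve as
coherence maps, here and for `ofEven`; the two functors are then strictly inverse `Π`-functors. -/
instance evenPartMonoidal : (evenPart A).Monoidal := Functor.CoreMonoidal.toMonoidal
  { εIso := Iso.refl _
    μIso := fun _ _ => Iso.refl _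
    μIso_hom_natural_left := fun f Z => by
      refine Eq.trans (Category.comp_id _) (Eq.trans ?_ (Category.id_comp _).symm)
      exact (evenPart_whiskerRight A f Z).symm
    μIso_hom_natural_right := fun Z f => by
      refine Eq.trans (Category.comp_id _) (Eq.trans ?_ (Category.id_comp _).symm)
      exact (evenPart_whiskerLeft A Z f).symm
    associativity := fun X Y Z => by
      change 𝟙 (X.of.of ⊗ Y.of.of) ▷ Z.of.of ≫ 𝟙 _ ≫ (α_ X.of.of Y.of.of Z.of.of).hom =
        (α_ X.of.of Y.of.of Z.of.of).hom ≫ _ ◁ 𝟙 _ ≫ 𝟙 _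
      simp
    left_unitality := fun X => by
      change (λ_ X.of.of).hom = 𝟙 _ ▷ _ ≫ 𝟙 _ ≫ (λ_ X.of.of).hom
      simp
    right_unitality := fun X => by
      change (ρ_ X.of.of).hom = _ ◁ 𝟙 _ ≫ 𝟙 _ ≫ (ρ_ X.of.of).hom
      simp }

instance ofEvenMonoidal : (ofEven A).Monoidal := Functor.CoreMonoidal.toMonoidal
  { εIso := Iso.refl _
    μIso := fun _ _ => Iso.refl _
    μIso_hom_natural_left := fun f Z => by
      refine Eq.trans (Category.comp_id _) (Eq.trans ?_ (Category.id_comp _).symm)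
      exact underlying_hom_ext A (evenPart_whiskerRight A _ _)
    μIso_hom_natural_right := fun Z f => by
      refine Eq.trans (Category.comp_id _) (Eq.trans ?_ (Category.id_comp _).symm)
      exact underlying_hom_ext A (evenPart_whiskerLeft A _ _)
    associativity := fun X Y Z => by
      refine Eq.trans (congrArg (· ≫ _) (id_whiskerRight _ _)) ?_
      refine Eq.trans (Category.id_comp _) (Eq.trans (Category.id_comp _) ?_)
      refine Eq.trans ?_ (congrArg (_ ≫ · ≫ _) (whiskerLeft_id _ _)).symm
      refine Eq.trans ?_ (congrArg (_ ≫ ·) (Category.comp_id _)).symm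
      exact (Category.comp_id _).symm
    left_unitality := fun X => by
      refine Eq.trans ?_ (congrArg (· ≫ _) (id_whiskerRight _ _)).symm
      exact ((Category.id_comp _).trans (Category.id_comp _)).symm
    right_unitality := fun X => by
      refine Eq.trans ?_ (congrArg (· ≫ _) (whiskerLeft_id _ _)).symm
      exact ((Category.id_comp _).trans (Category.id_comp _)).symm }

/-- Taking even parts, as a monoidal `Π`-functor. -/
def evenPartPi : PiMonFunctor A.superize.toPiMon A where
  functor := evenPart A
  additive := inferInstanceAs (evenPart A).Additive
  linear := inferInstanceAs ((evenPart A).Linear k)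
  monoidal := evenPartMonoidal A
  j := Iso.refl A.pi
  j_braiding X := by
    have h (X : Superize A) : 𝟙 A.pi ▷ X.of ≫ 𝟙 (A.pi ⊗ X.of) ≫ (A.β.β X.of).hom =
        (A.β.β X.of).hom ≫ X.of ◁ 𝟙 A.pi ≫ 𝟙 (X.of ⊗ A.pi) := by simp
    exact Eq.trans (congrArg (fun t => _ ≫ _ ≫ Hom.even t) (braid_zeta A _)) (h _)
  j_xi := by
    have h : A.xi.hom ≫ 𝟙 _ = (𝟙 A.pi ⊗ₘ 𝟙 A.pi) ≫ 𝟙 _ ≫ A.xi.hom := by simp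
    exact Eq.trans h (congrArg (fun t => _ ≫ _ ≫ Hom.even t) (xiIso_zeta A)).symm

/-- Regarding morphisms as even morphisms, as a monoidal `Π`-functor. -/
def ofEvenPi : PiMonFunctor A A.superize.toPiMon where
  functor := ofEven A
  additive := inferInstanceAs (ofEven A).Additive
  linear := inferInstanceAs ((ofEven A).Linear k)
  monoidal := ofEvenMonoidal A
  j := Iso.refl _
  j_braiding X := by
    refine Eq.trans (congrArg (· ≫ _) (id_whiskerRight _ _)) ?_
    refine Eq.trans (Category.id_comp _) (Eq.trans (Category.id_comp _) ?_)
    refine Eq.trans ?_ (congrArg (_ ≫ · ≫ _) (whiskerLeft_id _ _)).symm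
    refine Eq.trans ?_ (congrArg (_ ≫ ·) (Category.comp_id _)).symm
    refine Eq.trans ?_ (Category.comp_id _).symm
    exact Underlying.hom_ext (braid_zeta A ⟨X⟩).symm
  j_xi := by
    refine Eq.trans (Category.comp_id _) ?_
    refine Eq.trans ?_ (congrArg (· ≫ _) (id_tensorHom_id _ _)).symm
    refine Eq.trans ?_ (Eq.trans (Category.id_comp _) (Category.id_comp _)).symm
    exact Underlying.hom_ext (xiIso_zeta A)

/-- The underlying monoidal `Π`-category of `A.superize` is isomorphic to `A`. -/
def underlyingIso : A.superize.toPiMon ≅ A where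
  hom := evenPartPi A
  inv := ofEvenPi A
  hom_inv_id := by
    refine PiMonFunctor.ext' (CategoryTheory.Functor.ext (fun X => rfl) fun X Y f => ?_)
      (heq_of_eq ?_) (fun X Y => heq_of_eq ?_) (heq_of_eq ?_)
    · refine Eq.trans ?_ ((Category.id_comp _).trans (Category.comp_id _)).symm
      exact underlying_hom_ext A rfl
    · exact (Category.id_comp _).trans ((ofEven A).map_id _)
    · exact (Category.id_comp _).trans ((ofEven A).map_id _)
    · exact (Category.id_comp _).trans ((ofEven A).map_id _)
  inv_hom_id := by
    refine PiMonFunctor.ext' (CategoryTheory.Functor.ext (fun X => rfl) fun X Y f => ?_)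
      (heq_of_eq ?_) (fun X Y => heq_of_eq ?_) (heq_of_eq ?_)
    · exact ((Category.id_comp _).trans (Category.comp_id _)).symm
    · exact (Category.id_comp _).trans ((evenPart A).map_id _)
    · exact (Category.id_comp _).trans ((evenPart A).map_id _)
    · exact (Category.id_comp _).trans ((evenPart A).map_id _)

end Superize

instance underlying_essSurj (k : Type w) [CommRing k] : (underlying.{w, v, u} k).EssSurj :=
  ⟨fun A => ⟨A.superize, ⟨Superize.underlyingIso A⟩⟩⟩

end

end PiSuper

end

/-! ### The 2-adjunction and the equivalence. -/

theorem mainTheorem2 (k : Type w) [CommRing k] :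
    (∀ (A : PiSuper.SMon.{w, v, u} k) (B : PiSuper.PiSMon.{w, v, u} k),
      (PiSuper.restriction k A B).IsEquivalence ∧
      ∃ extension : (A ⟶ (PiSuper.forgetPi k).obj B) ⥤ ((PiSuper.piEnvelope k).obj A ⟶ B),
        extension.IsEquivalence ∧ extension ⋙ PiSuper.restriction k A B = 𝟭 _) ∧
    (PiSuper.underlying.{w, v, u} k).IsEquivalence := by
  refine ⟨fun A B => PiSuper.restriction_universal k A B, ?_⟩
  exact
    { faithful := PiSuper.underlying_faithful k
      full := PiSuper.underlying_full k
      essSurj := PiSuper.underlying_essSurj k }
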